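/- Let $K$ be an algebraically closed field of characteristic zero, let $n\ge 3$ and $k\ge 0$ be integers, and let $S\subset\mathbb{P}^n(K)$ be a finite set of points. Here a curve in a projective space over $K$ is a reduced, possibly reducible, possibly empty closed subvariety all of whose irreducible components have dimension $1$, identified with its set of $K$-points; its degree is the number of points in which it meets a general hyperplane, so that the curve of degree $0$ is the empty set. Suppose that the image of $S$ under a generic projection from a point $\mathbb{P}^n\dashrightarrow\mathbb{P}^{n-1}$ lies on a curve of degree $k$; that is, there is a nonempty Zariski open set $U\subset\mathbb{P}^n$ such that for every $p\in U$ the image of $S$ under a linear projection $\mathbb{P}^n\dashrightarrow\mathbb{P}^{n-1}$ with centre $p$ is contained in a curve of degree $k$ in $\mathbb{P}^{n-1}$ (which may depend on $p$). Then there are an integer $k'$ with $0\le k'\le k$ and a curve $C\subset\mathbb{P}^n$ of degree $k'$ that contains all but at most $(k-k')(k^2-k')$ points of $S$. -/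

import Mathlib

open scoped LinearAlgebra.Projectivization

namespace ProjCurve

variable {K : Type*} [Field K] {m : ℕ}

/-- The projective space of lines through the origin of `K ^ m`, that is, the set of `K`-points of
the projective space of dimension `m - 1`, with homogeneous coordinates indexed by `Fin m`. -/
abbrev PSpace (K : Type*) [Field K] (m : ℕ) : Type _ := ℙ K (Fin m → K)

/-- The common zero locus of a set of polynomials. It is used only for homogeneous polynomials, for
which vanishing does not depend on the choice of homogeneous coordinates. -/
def zeroLocus (T : Set (MvPolynomial (Fin m) K)) : Set (PSpace K m) :=
  {x | ∀ f ∈ T, MvPolynomial.eval x.rep f = 0}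

/-- A set is algebraic if it is the common zero locus of a set of homogeneous polynomials. -/
def IsAlgebraic (Z : Set (PSpace K m)) : Prop :=
  ∃ T : Set (MvPolynomial (Fin m) K), (∀ f ∈ T, ∃ d : ℕ, f.IsHomogeneous d) ∧ Z = zeroLocus T

theorem isAlgebraic_empty : IsAlgebraic (∅ : Set (PSpace K m)) := by
  refine ⟨{1}, ?_, ?_⟩
  · rintro f rfl
    exact ⟨0, MvPolynomial.isHomogeneous_one _ _⟩
  · ext x
    simp [zeroLocus]

theorem isAlgebraic_sInter (A : Set (Set (PSpace K m))) (hA : A ⊆ {Z | IsAlgebraic Z}) :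
    IsAlgebraic (⋂₀ A) := by
  refine ⟨{f | (∃ d : ℕ, f.IsHomogeneous d) ∧
    ∃ Z ∈ A, ∀ x ∈ Z, MvPolynomial.eval x.rep f = 0}, fun f hf => hf.1, ?_⟩
  ext x
  constructor
  · rintro hx f ⟨-, Z, hZ, hf⟩
    exact hf x (hx Z hZ)
  · intro hx Z hZ
    obtain ⟨T, hT, rfl⟩ := hA hZ
    intro f hf
    exact hx f ⟨hT f hf, _, hZ, fun y hy => hy f hf⟩

theorem isAlgebraic_union (A : Set (PSpace K m)) (hA : IsAlgebraic A) (B : Set (PSpace K m))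
    (hB : IsAlgebraic B) : IsAlgebraic (A ∪ B) := by
  obtain ⟨T, hT, rfl⟩ := hA
  obtain ⟨T', hT', rfl⟩ := hB
  refine ⟨{h | ∃ f ∈ T, ∃ g ∈ T', h = f * g}, ?_, ?_⟩
  · rintro h ⟨f, hf, g, hg, rfl⟩
    obtain ⟨d, hd⟩ := hT f hf
    obtain ⟨e, he⟩ := hT' g hg
    exact ⟨d + e, hd.mul he⟩
  · ext x
    constructor
    · rintro (hx | hx) h ⟨f, hf, g, hg, rfl⟩
      · simp [hx f hf]
      · simp [hx g hg]
    · intro hx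
      by_contra hc
      simp only [zeroLocus, Set.mem_union, Set.mem_ofPred_eq, not_or, not_forall] at hc
      obtain ⟨⟨f, hf, hf0⟩, g, hg, hg0⟩ := hc
      have := hx (f * g) ⟨f, hf, g, hg, rfl⟩
      rw [map_mul] at this
      exact (mul_ne_zero hf0 hg0) this

/-- The Zariski topology: the closed sets are the algebraic sets. -/
instance zariskiTopology : TopologicalSpace (PSpace K m) :=
  TopologicalSpace.ofClosed {Z | IsAlgebraic Z} isAlgebraic_empty isAlgebraic_sInter
    isAlgebraic_union

theorem isClosed_iff_isAlgebraic (Z : Set (PSpace K m)) : IsClosed Z ↔ IsAlgebraic Z := by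
  rw [← isOpen_compl_iff]
  change IsAlgebraic Zᶜᶜ ↔ IsAlgebraic Z
  rw [compl_compl]

/-- A (reduced, possibly reducible, possibly empty) curve: a Zariski closed set all of whose
irreducible components have dimension one. -/
def IsCurve (C : Set (PSpace K m)) : Prop :=
  IsClosed C ∧ ∀ Z ∈ irreducibleComponents C, topologicalKrullDim Z = 1

/-- The hyperplane with equation `∑ i, a i * x i = 0`, for `a` in the dual projective space. -/
def hyperplane (a : PSpace K m) : Set (PSpace K m) :=
  {x | Projectivization.orthogonal a x}

/-- A curve of degree `d`: a curve that meets a general hyperplane in exactly `d` points. The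
empty set is the curve of degree zero. -/
def IsCurveOfDegree (C : Set (PSpace K m)) (d : ℕ) : Prop :=
  IsCurve C ∧ ∃ U : Set (PSpace K m), IsOpen U ∧ U.Nonempty ∧
    ∀ a ∈ U, (C ∩ hyperplane a).encard = d

/-- The image of a set of points under the rational map of projective spaces given by a linear
map. The map is undefined at the points of the projectivization of the kernel, which contribute
nothing to the image. -/
def rationalImage {m' : ℕ} (π : (Fin m → K) →ₗ[K] (Fin m' → K)) (S : Set (PSpace K m)) :
    Set (PSpace K m') :=
  {y | ∃ x ∈ S, ∃ h : π x.rep ≠ 0, y = Projectivization.mk K (π x.rep) h}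

/-- The linear map `K ^ (n + 1) → K ^ n` induces the projection with centre `p`, from the
`n`-dimensional to the `(n - 1)`-dimensional projective space. Such a map is surjective, and it is
determined by `p` up to linear automorphisms of the target. -/
def IsProjectionFrom {n : ℕ} (p : PSpace K (n + 1))
    (π : (Fin (n + 1) → K) →ₗ[K] (Fin n → K)) : Prop :=
  LinearMap.ker π = p.submodule

/-- The image of `S` under a generic projection lies on a curve of degree `k`: for all centres `p`
in some nonempty Zariski open set, the image of `S` under a projection from `p` is contained in a
curve of degree `k`, which may depend on the projection. -/
def GenericProjectionLiesOnCurve {n : ℕ} (S : Set (PSpace K (n + 1))) (k : ℕ) : Prop :=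
  ∃ U : Set (PSpace K (n + 1)), IsOpen U ∧ U.Nonempty ∧
    ∀ p ∈ U, ∀ π : (Fin (n + 1) → K) →ₗ[K] (Fin n → K), IsProjectionFrom p π →
      ∃ C : Set (PSpace K n), IsCurveOfDegree C k ∧ rationalImage π S ⊆ C

end ProjCurve

/-! Everything is pushed down to a plane. Put m = n + 1, let t be a 3 × m matrix of indeterminates
and y the coordinates of the plane. Since m > 3, every 3 × m matrix kills some point p and so
factors through the projection from p. The given curve of degree k in the target of that projection
has itself a plane projection with an equation of degree k. So for a dense set of matrices A the
points A x, for x in S, lie on a plane curve of degree k. Linear algebra over K(t) then gives a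
single f(t, y) ≠ 0, homogeneous of degree k in y, with f(t, t x) = 0 for all x in S
(`exists_planeLocus_superset`).

Let h be a prime factor of f, of degree d > 0 in y, and call the set of x with h(t, t x) = 0 its
locus. Differentiating by t_ij gives h_{t_ij} + x_j h_{y_i} = 0, so x is recovered from its image by
x_j = -h_{t_ij} / h_{y_i}. Three facts about this quotient are polynomial conditions of degree at
most d² in y: it does not depend on i, it projects to y, and it is constant along the derivations
∂_{t_ij} + x_j ∂_{y_i}. The conditions hold at t x for each x in the locus. If the locus has more
than d³ points, Bézout over K(t) (`card_le_mul_of_not_dvd`) forces h to divide them. In the function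
field of h = 0 the quotients then form a vector ξ over which the entries of t stay independent: the
generic point of a space curve whose generic projection is h = 0. So h defines a curve of degree d,
or its locus has at most d³ points (`isCurveEquation_or_encard_planeLocus_le`).

The product of the distinct primes of the first kind has some degree k' and defines C
(`isCurveOfDegree_planeLocus`). If the other primes have total degree e ≤ k - k', the missed points
number at most ∑ d_i³ ≤ e³ ≤ (k - k')(k² - k').

The dictionary between curves and plane equations is `planeLocus_eq` in one direction (the locus is
exactly the closure of ξ) and `exists_isCurveEquation_of_isIrreducible` in the other. Lifting points
from the plane to the curve rests on `exists_specialization`, a form of the completeness of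
projective space. -/

open MvPolynomial ProjCurve

-- Specialization of generic points

universe u

/-- The product of a `3 × m` matrix and a vector. -/
def mulV {m : ℕ} {L : Type*} [CommSemiring L] (A : Fin 3 × Fin m → L) (x : Fin m → L) :
    Fin 3 → L := fun i => ∑ j, A (i, j) * x j

/-- By the Nullstellensatz: if 0 were the only possible zero over K, a power of each variable would
lie in the ideal generated by `J`, and `w` would be 0. It brings a point found over a residue field
back to K. -/
theorem exists_zero_of_zero_in_extension {K κ ι : Type*} [Field K] [IsAlgClosed K] [Field κ]
    [Finite ι] (c : K →+* κ) (J : Set (MvPolynomial ι K)) (w : ι → κ) (hw : w ≠ 0)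
    (hJ : ∀ G ∈ J, eval₂ c w G = 0) : ∃ z : ι → K, z ≠ 0 ∧ ∀ G ∈ J, eval z G = 0 := by
  by_contra! hcon
  apply hw
  funext j
  have h1 : (X j : MvPolynomial ι K) ∈ vanishingIdeal K (zeroLocus K (Ideal.span J)) := by
    rw [mem_vanishingIdeal_iff]
    intro z hz
    rw [zeroLocus_span] at hz
    have : z = 0 := by
      by_contra h0
      obtain ⟨G, hG, hG0⟩ := hcon z h0
      exact hG0 (by simpa [aeval_eq_eval] using hz G hG)
    simp [this]
  rw [vanishingIdeal_zeroLocus_eq_radical] at h1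
  obtain ⟨N, hN⟩ := h1
  have h2 : Ideal.span J ≤ RingHom.ker (eval₂Hom c w) := by
    rw [Ideal.span_le]
    intro G hG
    exact hJ G hG
  have h3 := h2 hN
  rw [RingHom.mem_ker, map_pow] at h3
  simpa using eq_zero_of_pow_eq_zero h3

theorem aeval_smul_of_isHomogeneous {K L ι : Type*} [CommSemiring K] [CommSemiring L] [Algebra K L]
    {G : MvPolynomial ι K} {d : ℕ} (hG : G.IsHomogeneous d) (c : L) (x : ι → L) :
    aeval (fun i => c * x i) G = c ^ d * aeval x G := by
  rw [aeval_def, aeval_def, eval₂_eq, eval₂_eq, Finset.mul_sum]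
  refine Finset.sum_congr rfl fun e he => ?_
  have hd : e.degree = d := by
    have := hG (mem_support_iff.1 he)
    rw [Finsupp.degree_eq_weight_one]
    exact this
  simp only [mul_pow, Finset.prod_mul_distrib, Finset.prod_pow_eq_pow_sum]
  rw [← hd, Finsupp.degree_apply]
  ring

/-- If `(A₀, y₀)` is a specialization of `(t, t ξ)`, then some specialization `z` of `ξ` in the
projective space is mapped to `y₀` by `A₀` or is not in the domain of `A₀`. -/
theorem exists_specialization {K M : Type*} [Field K] [IsAlgClosed K] [Field M] [Algebra K M]
    {m : ℕ} (t : Fin 3 × Fin m → M) (ξ : Fin m → M) (A₀ : Fin 3 × Fin m → K) (y₀ : Fin 3 → K)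
    (hy₀ : y₀ ≠ 0)
    (H : ∀ G : MvPolynomial (Fin 3 × Fin m ⊕ Fin 3) K,
      aeval (Sum.elim t (mulV t ξ)) G = 0 → eval (Sum.elim A₀ y₀) G = 0) :
    ∃ z : Fin m → K, z ≠ 0 ∧
      (∀ d (G : MvPolynomial (Fin m) K), G.IsHomogeneous d → aeval ξ G = 0 → eval z G = 0) ∧
      ∀ i k, y₀ k * mulV A₀ z i = y₀ i * mulV A₀ z k := by
  classical
  set φ : MvPolynomial (Fin 3 × Fin m ⊕ Fin 3) K →ₐ[K] M := aeval (Sum.elim t (mulV t ξ)) with hφ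
  set B : Subring M := φ.toRingHom.range with hB
  let I : Ideal B := Ideal.map φ.toRingHom.rangeRestrict (RingHom.ker (eval (Sum.elim A₀ y₀)))
  have hmemI : ∀ b : B, b ∈ I → ∃ G, eval (Sum.elim A₀ y₀) G = 0 ∧ φ G = b := by
    intro b hb
    obtain ⟨G, hG, rfl⟩ := (Ideal.mem_map_iff_of_surjective _
      φ.toRingHom.rangeRestrict_surjective).1 hb
    exact ⟨G, hG, rfl⟩
  have hI : I ≠ ⊤ := by
    intro h
    obtain ⟨G, hG, hG1⟩ := hmemI 1 (h ▸ Submodule.mem_top)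
    have := H (G - 1) (by rw [map_sub, hG1, map_one]; simp)
    rw [map_sub, hG] at this
    simp at this
  -- A valuation ring V of M containing K[t, tξ], in whose maximal ideal lies the kernel of the
  -- specialization to (A₀, y₀). Modulo that ideal t becomes A₀ and tξ becomes y₀.
  obtain ⟨V, hBV, hIV⟩ := I.image_subset_nonunits_valuationSubring hI
  have hmem : ∀ G, φ G ∈ V := fun G => hBV ⟨G, rfl⟩
  have hnon : ∀ G, eval (Sum.elim A₀ y₀) G = 0 → φ G ∈ V.nonunits := by
    intro G hG
    exact hIV ⟨⟨φ G, ⟨G, rfl⟩⟩, Ideal.mem_map_of_mem φ.toRingHom.rangeRestrict hG, rfl⟩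
  have hcV : ∀ c : K, algebraMap K M c ∈ V := fun c => by simpa using hmem (C c)
  let s : K →+* V := (algebraMap K M).codRestrict V.toSubring hcV
  let r : V →+* IsLocalRing.ResidueField V := IsLocalRing.residue V
  have hres : ∀ (a : M) (ha : a ∈ V), a ∈ V.nonunits → r ⟨a, ha⟩ = 0 := by
    intro a ha hn
    rw [IsLocalRing.residue_eq_zero_iff]
    exact (V.coe_mem_nonunits_iff (a := ⟨a, ha⟩)).1 hn
  have hη : ∀ i, φ (X (Sum.inr i)) = mulV t ξ i := by intro i; simp [hφ]
  have ht : ∀ p, φ (X (Sum.inl p)) = t p := by intro i; simp [hφ]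
  obtain ⟨k₀, hk₀⟩ : ∃ k, y₀ k ≠ 0 := by
    by_contra! h; exact hy₀ (funext h)
  have hηV : ∀ i, mulV t ξ i ∈ V := fun i => hη i ▸ hmem _
  have hrη : ∀ i, r ⟨mulV t ξ i, hηV i⟩ = r (s (y₀ i)) := by
    intro i
    rw [← sub_eq_zero, ← map_sub]
    refine hres (mulV t ξ i - algebraMap K M (y₀ i)) _ ?_
    have := hnon (X (Sum.inr i) - C (y₀ i)) (by simp)
    rwa [map_sub, hη, hφ, aeval_C] at this
  have htV : ∀ i, t i ∈ V := fun i => ht i ▸ hmem _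
  have hrt : ∀ i, r ⟨t i, htV i⟩ = r (s (A₀ i)) := by
    intro i
    rw [← sub_eq_zero, ← map_sub]
    refine hres (t i - algebraMap K M (A₀ i)) _ ?_
    have := hnon (X (Sum.inl i) - C (A₀ i)) (by simp)
    rwa [map_sub, ht, hφ, aeval_C] at this
  have hη₀ : mulV t ξ k₀ ≠ 0 := by
    intro h
    have h1 := hrη k₀
    have h2 : (⟨mulV t ξ k₀, hηV k₀⟩ : V) = 0 := Subtype.ext h
    rw [h2, map_zero] at h1
    exact hk₀ ((map_eq_zero (r.comp s)).1 h1.symm)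
  have hξ : ∃ j, ξ j ≠ 0 := by
    by_contra! h
    exact hη₀ (by simp [mulV, h])
  have : Nonempty (Fin m) := ⟨hξ.choose⟩
  -- Dividing ξ by its coordinate of largest valuation brings it into V with one coordinate equal to
  -- 1, so that its reduction is a nonzero vector.
  obtain ⟨j₀, hj₀⟩ := Finite.exists_max fun j => V.valuation (ξ j)
  have hξ₀ : ξ j₀ ≠ 0 := by
    obtain ⟨j, hj⟩ := hξ
    intro h
    have := hj₀ j
    simp only [h, map_zero, le_zero_iff, map_eq_zero] at this
    exact hj this
  have hwV : ∀ j, (ξ j₀)⁻¹ * ξ j ∈ V := by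
    intro j
    rw [← V.valuation_le_one_iff, map_mul, map_inv₀]
    have h0 : V.valuation (ξ j₀) ≠ 0 := by simpa using hξ₀
    calc (V.valuation (ξ j₀))⁻¹ * V.valuation (ξ j)
        ≤ (V.valuation (ξ j₀))⁻¹ * V.valuation (ξ j₀) := by gcongr; exact hj₀ j
      _ = 1 := inv_mul_cancel₀ h0
  let w : Fin m → V := fun j => ⟨(ξ j₀)⁻¹ * ξ j, hwV j⟩
  let J : Set (MvPolynomial (Fin m) K) :=
    {G | (∃ d, G.IsHomogeneous d) ∧ aeval ξ G = 0} ∪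
      Set.range fun p : Fin 3 × Fin 3 => C (y₀ p.2) * (∑ j, C (A₀ (p.1, j)) * X j)
        - C (y₀ p.1) * (∑ j, C (A₀ (p.2, j)) * X j)
  obtain ⟨z, hz, hzJ⟩ := exists_zero_of_zero_in_extension (r.comp s) J (r ∘ w) (by
      intro h
      have := congrFun h j₀
      have h1 : w j₀ = 1 := Subtype.ext (inv_mul_cancel₀ hξ₀)
      simp [h1] at this) (by
      rintro G (⟨⟨d, hd⟩, hG⟩ | ⟨⟨i, k⟩, rfl⟩)
      · refine (hom_eval₂ G s r w).symm.trans ?_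
        have : eval₂ s w G = 0 := by
          apply Subtype.ext
          change V.subtype (eval₂ s w G) = 0
          rw [hom_eval₂]
          have h1 := aeval_smul_of_isHomogeneous hd (ξ j₀)⁻¹ ξ
          rw [hG, mul_zero, aeval_def] at h1
          exact h1
        rw [this, map_zero]
      -- In M the vector t w is a multiple of t ξ, so their 2 × 2 minors vanish. After reduction the
      -- minors with row k₀ suffice, because y₀ k₀ is nonzero.
      · have hηw : ∀ i, r (s (y₀ k₀)) * (∑ j, r (s (A₀ (i, j))) * r (w j)) =
            r (s (y₀ i)) * (∑ j, r (s (A₀ (k₀, j))) * r (w j)) := by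
          intro i
          simp only [← hrt, ← hrη, ← map_mul, ← map_sum]
          congr 1
          apply Subtype.ext
          have h1 : ∀ i, (∑ j, t (i, j) * ((ξ j₀)⁻¹ * ξ j)) = (ξ j₀)⁻¹ * mulV t ξ i := by
            intro i
            rw [mulV, Finset.mul_sum]
            exact Finset.sum_congr rfl fun j _ => by ring
          change mulV t ξ k₀ * V.subtype (∑ j, _) = mulV t ξ i * V.subtype (∑ j, _)
          simp only [map_sum, map_mul]
          change mulV t ξ k₀ * (∑ j, t (i, j) * ((ξ j₀)⁻¹ * ξ j)) =
            mulV t ξ i * (∑ j, t (k₀, j) * ((ξ j₀)⁻¹ * ξ j))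
          rw [h1, h1]
          ring
        have hk : r (s (y₀ k₀)) ≠ 0 := fun h => hk₀ ((map_eq_zero (r.comp s)).1 h)
        simp only [eval₂_sub, eval₂_mul, eval₂_C, eval₂_sum, eval₂_X, RingHom.comp_apply,
          Function.comp_apply]
        apply mul_left_cancel₀ hk
        linear_combination r (s (y₀ k)) * hηw i - r (s (y₀ i)) * hηw k)
  refine ⟨z, hz, fun d G hd hG => hzJ G (Or.inl ⟨⟨d, hd⟩, hG⟩), fun i k => ?_⟩
  have := hzJ _ (Or.inr ⟨(i, k), rfl⟩)
  simp only [map_sub, map_mul, eval_C, map_sum, eval_X] at this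
  exact sub_eq_zero.1 this

theorem exists_forall_eval_ne_zero {K σ ι : Type*} [Field K] [Infinite K] (s : Finset ι)
    (p : ι → MvPolynomial σ K) (hp : ∀ i ∈ s, p i ≠ 0) :
    ∃ a : σ → K, ∀ i ∈ s, eval a (p i) ≠ 0 := by
  have h : ∏ i ∈ s, p i ≠ 0 := Finset.prod_ne_zero_iff.2 hp
  obtain ⟨a, ha⟩ : ∃ a, eval a (∏ i ∈ s, p i) ≠ 0 := by
    by_contra! hc
    exact h (MvPolynomial.funext fun a => by simpa using hc a)
  rw [map_prod] at ha
  exact ⟨a, Finset.prod_ne_zero_iff.1 ha⟩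

/-- The variables `t` (entries of a generic `3 × m` matrix) have weight zero, and the variables `y`
(coordinates in the plane) have weight one. -/
def planeWeight (m : ℕ) : Fin 3 × Fin m ⊕ Fin 3 → ℕ := Sum.elim 0 1

theorem aeval_smul_of_planeWeight {K L : Type*} [CommSemiring K] [CommSemiring L] [Algebra K L]
    {m d : ℕ} {h : MvPolynomial (Fin 3 × Fin m ⊕ Fin 3) K}
    (hh : IsWeightedHomogeneous (planeWeight m) h d) (A : Fin 3 × Fin m → L) (y : Fin 3 → L)
    (c : L) : aeval (Sum.elim A (fun i => c * y i)) h = c ^ d * aeval (Sum.elim A y) h := by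
  rw [aeval_def, aeval_def, eval₂_eq', eval₂_eq', Finset.mul_sum]
  refine Finset.sum_congr rfl fun e he => ?_
  have hd : ∑ i, e (Sum.inr i) = d := by
    have := hh (mem_support_iff.1 he)
    rw [Finsupp.weight_apply, Finsupp.sum_fintype _ _ (by simp)] at this
    simpa [planeWeight] using this
  simp only [Fintype.prod_sum_type, Sum.elim_inl, Sum.elim_inr, mul_pow, Finset.prod_mul_distrib,
    Finset.prod_pow_eq_pow_sum, hd]
  ring

theorem eval_smul_of_planeWeight {K : Type*} [CommSemiring K]
    {m d : ℕ} {h : MvPolynomial (Fin 3 × Fin m ⊕ Fin 3) K}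
    (hh : IsWeightedHomogeneous (planeWeight m) h d) (A : Fin 3 × Fin m → K) (y : Fin 3 → K)
    (c : K) : eval (Sum.elim A (fun i => c * y i)) h = c ^ d * eval (Sum.elim A y) h := by
  simpa [aeval_eq_eval] using aeval_smul_of_planeWeight hh A y c

theorem mulV_smul {m : ℕ} {L : Type*} [CommSemiring L] (A : Fin 3 × Fin m → L) (c : L)
    (x : Fin m → L) : mulV A (c • x) = fun i => c * mulV A x i := by
  funext i
  simp only [mulV, Finset.mul_sum, Pi.smul_apply, smul_eq_mul]
  exact Finset.sum_congr rfl fun j _ => by ring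

/-! ### Generic points of curves and their plane equations -/

section Points

variable {K : Type*} [Field K] {m : ℕ}

theorem eval_smul_of_isHomogeneous {ι : Type*} {G : MvPolynomial ι K} {d : ℕ}
    (hG : G.IsHomogeneous d) (c : K) (x : ι → K) : eval (c • x) G = c ^ d * eval x G := by
  have := aeval_smul_of_isHomogeneous (L := K) hG c x
  simpa [aeval_eq_eval, Pi.smul_def] using this

theorem eval_rep_mk {G : MvPolynomial (Fin m) K} {d : ℕ} (hG : G.IsHomogeneous d)
    (v : Fin m → K) (hv : v ≠ 0) :
    eval (Projectivization.mk K v hv).rep G = 0 ↔ eval v G = 0 := by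
  obtain ⟨a, ha⟩ := Projectivization.exists_smul_eq_mk_rep K v hv
  rw [← ha, Units.smul_def, eval_smul_of_isHomogeneous hG]
  simp

theorem eq_of_forall_mul_eq_mul {x y : PSpace K m}
    (h : ∀ i j, x.rep i * y.rep j = x.rep j * y.rep i) : x = y := by
  rw [← x.mk_rep, ← y.mk_rep, Projectivization.mk_eq_mk_iff']
  obtain ⟨j, hj⟩ : ∃ j, y.rep j ≠ 0 := by
    by_contra! hc
    exact y.rep_nonzero (funext hc)
  refine ⟨x.rep j / y.rep j, funext fun i => ?_⟩
  simp only [Pi.smul_apply, smul_eq_mul]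
  field_simp
  linear_combination -h i j

/-- The points of the projective space whose image under the projection with matrix `A` satisfies
the equation `h(A, ·)`, for all `A`. -/
def planeLocus (h : MvPolynomial (Fin 3 × Fin m ⊕ Fin 3) K) : Set (PSpace K m) :=
  {x | ∀ A : Fin 3 × Fin m → K, eval (Sum.elim A (mulV A x.rep)) h = 0}

/-- The closure in the projective space of a generic point. -/
def specializations {M : Type*} [Field M] [Algebra K M] (ξ : Fin m → M) : Set (PSpace K m) :=
  zeroLocus {G | (∃ d, G.IsHomogeneous d) ∧ aeval ξ G = 0}

theorem isClosed_specializations {M : Type*} [Field M] [Algebra K M] (ξ : Fin m → M) :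
    IsClosed (specializations (K := K) ξ) := by
  rw [isClosed_iff_isAlgebraic]
  exact ⟨_, fun f hf => hf.1, rfl⟩

/-- `ξ` is the generic point of a curve in the projective space, `t` is a generic `3 × m` matrix and
`h` is the equation of degree `d` of the projection of the curve to the plane with matrix `t`. -/
structure IsGenericPlaneEquation {M : Type*} [Field M] [Algebra K M] (t : Fin 3 × Fin m → M)
    (ξ : Fin m → M) (h : MvPolynomial (Fin 3 × Fin m ⊕ Fin 3) K) (d : ℕ) : Prop where
  ne_zero : h ≠ 0
  weight : IsWeightedHomogeneous (planeWeight m) h d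
  ker : ∀ G, aeval (Sum.elim t (mulV t ξ)) G = 0 ↔ h ∣ G
  hom : ∀ G : MvPolynomial (Fin m) K, aeval ξ G = 0 →
    ∀ e, aeval ξ (homogeneousComponent e G) = 0
  dep : ∀ g : Fin 3 → MvPolynomial (Fin m) K, ∃ P : MvPolynomial (Fin 3) K, P ≠ 0 ∧
    aeval (fun i => aeval ξ (g i)) P = 0
  indep : ∀ P : MvPolynomial (Fin 3 × Fin m) (MvPolynomial (Fin m) K),
    eval₂ (aeval ξ : MvPolynomial (Fin m) K →ₐ[K] M).toRingHom t P = 0 →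
      ∀ e, aeval ξ (coeff e P) = 0

variable {M : Type*} [Field M] [Algebra K M] {t : Fin 3 × Fin m → M} {ξ : Fin m → M}
  {h : MvPolynomial (Fin 3 × Fin m ⊕ Fin 3) K} {d : ℕ}

theorem mk_mem_specializations_iff (v : Fin m → K) (hv : v ≠ 0) :
    Projectivization.mk K v hv ∈ specializations (K := K) ξ ↔
      ∀ d (G : MvPolynomial (Fin m) K), G.IsHomogeneous d → aeval ξ G = 0 → eval v G = 0 := by
  constructor
  · intro hx d G hd hG
    exact (eval_rep_mk hd v hv).1 (hx G ⟨⟨d, hd⟩, hG⟩)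
  · rintro hx G ⟨⟨d, hd⟩, hG⟩
    exact (eval_rep_mk hd v hv).2 (hx d G hd hG)

namespace IsGenericPlaneEquation

variable (H : IsGenericPlaneEquation t ξ h d)
include H

theorem prime : Prime h := by
  have hk : Ideal.span {h} = RingHom.ker (aeval (Sum.elim t (mulV t ξ)) :
      MvPolynomial (Fin 3 × Fin m ⊕ Fin 3) K →ₐ[K] M) := by
    ext G
    rw [Ideal.mem_span_singleton, RingHom.mem_ker, H.ker]
  rw [← Ideal.span_singleton_prime H.ne_zero, hk]
  exact RingHom.ker_isPrime _

theorem eval_rep_eq_zero {x : PSpace K m} (hx : x ∈ specializations (K := K) ξ)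
    {G : MvPolynomial (Fin m) K} (hG : aeval ξ G = 0) (c : K) : eval (c • x.rep) G = 0 := by
  rw [← sum_homogeneousComponent G, map_sum]
  refine Finset.sum_eq_zero fun e _ => ?_
  rw [eval_smul_of_isHomogeneous (homogeneousComponent_isHomogeneous e G),
    hx _ ⟨⟨e, homogeneousComponent_isHomogeneous e G⟩, H.hom G hG e⟩, mul_zero]

/-- The relation h(t, tξ) = 0 is a polynomial in t with coefficients in K[ξ]. By independence of t
each coefficient vanishes at ξ, hence at every specialization of ξ. -/
theorem specializations_subset : specializations ξ ⊆ planeLocus h := by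
  intro x hx A
  set P : MvPolynomial (Fin 3 × Fin m) (MvPolynomial (Fin m) K) :=
    aeval (Sum.elim X (fun i => ∑ j, C (X j) * X (i, j))) h with hP
  have h1 : eval₂ (aeval ξ : MvPolynomial (Fin m) K →ₐ[K] M).toRingHom t P = 0 := by
    have : eval₂ (aeval ξ : MvPolynomial (Fin m) K →ₐ[K] M).toRingHom t P =
        aeval (Sum.elim t (mulV t ξ)) h := by
      rw [hP, aeval_def, ← coe_eval₂Hom, hom_eval₂, aeval_def]
      congr 1
      · ext c
        rw [RingHom.comp_apply, show algebraMap K (MvPolynomial (Fin 3 × Fin m)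
          (MvPolynomial (Fin m) K)) c = C (C c) from rfl]
        simp
      · funext i
        rcases i with p | i
        · simp
        · simp [mulV, mul_comm]
    rw [this, H.ker]
  have h2 := H.indep P h1
  have h3 : eval (Sum.elim A (mulV A x.rep)) h = eval₂ (eval x.rep) A P := by
    rw [hP, aeval_def, ← coe_eval₂Hom, hom_eval₂, ← eval₂_id]
    congr 1
    · ext c
      rw [RingHom.comp_apply, show algebraMap K (MvPolynomial (Fin 3 × Fin m)
        (MvPolynomial (Fin m) K)) c = C (C c) from rfl]
      simp
    · funext i
      rcases i with p | i
      · simp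
      · simp [mulV, mul_comm]
  rw [h3, eval₂_eq]
  refine Finset.sum_eq_zero fun e _ => ?_
  have := H.eval_rep_eq_zero hx (h2 e) 1
  rw [one_smul] at this
  rw [this, zero_mul]

/-- The centre of the projection `A` misses the locus unless h(A, ·) is identically zero. If A x =
0, take B with B x = y: then A + sB sends x to s y, so h(A + sB, y) = 0 for all s ≠ 0 by
homogeneity, and letting s = 0 gives h(A, y) = 0. -/
theorem mulV_ne_zero_of_mem_planeLocus {A : Fin 3 × Fin m → K} {y : Fin 3 → K} [CharZero K]
    (hA : eval (Sum.elim A y) h ≠ 0) {x : PSpace K m} (hx : x ∈ planeLocus h) :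
    mulV A x.rep ≠ 0 := by
  intro h0
  apply hA
  obtain ⟨j, hj⟩ : ∃ j, x.rep j ≠ 0 := by
    by_contra! hc
    exact x.rep_nonzero (funext hc)
  let B : Fin 3 × Fin m → K := fun p => if p.2 = j then y p.1 / x.rep j else 0
  have hB : mulV B x.rep = y := by
    funext i
    simp only [mulV, B]
    rw [Finset.sum_eq_single j]
    · simp [hj]
    · intro b _ hb; simp [hb]
    · simp
  let q : Polynomial K := aeval (Sum.elim (fun p => Polynomial.C (A p) +
    Polynomial.X * Polynomial.C (B p)) (fun i => Polynomial.C (y i))) h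
  have hq : ∀ s, q.eval s = eval (Sum.elim (fun p => A p + s * B p) y) h := by
    intro s
    simp only [q]
    rw [← Polynomial.coe_evalRingHom, aeval_def, hom_eval₂, ← eval₂_id]
    congr 1
    · ext c; simp
    · funext i
      rcases i with p | i
      · simp; ring
      · simp
  have hq0 : ∀ s, s ≠ 0 → q.eval s = 0 := by
    intro s hs
    have h1 := hx (fun p => A p + s * B p)
    have h2 : mulV (fun p => A p + s * B p) x.rep = fun i => s * y i := by
      funext i
      have h3 := congrFun h0 i
      have h4 := congrFun hB i
      simp only [mulV, Pi.zero_apply] at h3 h4 ⊢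
      simp only [add_mul, Finset.sum_add_distrib, h3, ← h4, Finset.mul_sum, mul_assoc, zero_add]
    rw [h2, eval_smul_of_planeWeight H.weight] at h1
    rw [hq]
    exact (mul_eq_zero.1 h1).resolve_left (pow_ne_zero _ hs)
  have hqz : q = 0 := by
    refine Polynomial.eq_zero_of_infinite_isRoot q
      (Set.Infinite.mono (s := {0}ᶜ) (fun s hs => hq0 s hs) (Set.finite_singleton 0).infinite_compl)
  have := hq 0
  rw [hqz, Polynomial.eval_zero] at this
  simpa using this.symm

/-- Points of the plane curve lift to the space curve. All relations of (t, tξ) are multiples of h,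
so (A, y) is a specialization of it; the degenerate outcome A z = 0 is excluded by
`mulV_ne_zero_of_mem_planeLocus`. -/
theorem exists_specialization_eq [IsAlgClosed K] [CharZero K] {A : Fin 3 × Fin m → K}
    {y₁ : Fin 3 → K} (hA : eval (Sum.elim A y₁) h ≠ 0) {y : Fin 3 → K} (hy : y ≠ 0)
    (hy0 : eval (Sum.elim A y) h = 0) :
    ∃ x ∈ specializations (K := K) ξ, ∃ c : K, c ≠ 0 ∧ ∀ i, mulV A x.rep i = c * y i := by
  obtain ⟨z, hz, hzG, hzA⟩ := exists_specialization t ξ A y hy (fun G hG => by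
    obtain ⟨G', rfl⟩ := (H.ker G).1 hG
    rw [map_mul, hy0, zero_mul])
  have hx : Projectivization.mk K z hz ∈ specializations (K := K) ξ :=
    (mk_mem_specializations_iff z hz).2 hzG
  refine ⟨_, hx, ?_⟩
  have hne := H.mulV_ne_zero_of_mem_planeLocus hA (H.specializations_subset hx)
  obtain ⟨a, ha⟩ := Projectivization.exists_smul_eq_mk_rep K z hz
  rw [← ha, Units.smul_def, mulV_smul] at hne ⊢
  obtain ⟨k, hk⟩ : ∃ k, y k ≠ 0 := by
    by_contra! hc
    exact hy (funext hc)
  refine ⟨a * (mulV A z k / y k), ?_, fun i => ?_⟩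
  · intro h0
    apply hne
    have h1 : mulV A z k = 0 := by simpa [hk] using h0
    funext i
    have := hzA i k
    rw [h1, mul_zero] at this
    simp [(mul_eq_zero.1 this).resolve_left hk]
  · have := hzA i k
    field_simp
    linear_combination this

end IsGenericPlaneEquation
end Points

theorem eval_aeval {K σ τ : Type*} [CommSemiring K] (x : τ → K) (v : σ → MvPolynomial τ K)
    (P : MvPolynomial σ K) : eval x (aeval v P) = eval (fun i => eval x (v i)) P := by
  rw [aeval_def, hom_eval₂, ← eval₂_id]
  congr 1
  ext c
  simp

theorem polynomial_eval_aeval {K σ : Type*} [CommSemiring K] (x : K) (v : σ → Polynomial K)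
    (P : MvPolynomial σ K) :
    (aeval v P : Polynomial K).eval x = eval (fun i => (v i).eval x) P := by
  rw [← Polynomial.coe_evalRingHom, aeval_def, hom_eval₂, ← eval₂_id]
  congr 1
  ext c
  simp

/-! ### Lines in the plane and finiteness of hypersurface sections -/

section Points

variable {K : Type*} [Field K] {m : ℕ}

/-- The restriction of `h(A, ·)` to the line through `(1, 0, 0)` and `y`, as a polynomial. -/
noncomputable def lineRestriction (h : MvPolynomial (Fin 3 × Fin m ⊕ Fin 3) K)
    (A : Fin 3 × Fin m → K) (y : Fin 3 → K) : Polynomial K :=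
  aeval (Sum.elim (fun p => Polynomial.C (A p))
    (fun i => if i = 0 then Polynomial.X else Polynomial.C (y i))) h

theorem eval_lineRestriction (h : MvPolynomial (Fin 3 × Fin m ⊕ Fin 3) K)
    (A : Fin 3 × Fin m → K) (y : Fin 3 → K) (s : K) :
    (lineRestriction h A y).eval s = eval (Sum.elim A (Function.update y 0 s)) h := by
  rw [lineRestriction, polynomial_eval_aeval]
  congr 2
  funext i
  rcases i with p | i
  · simp
  · by_cases hi : i = 0 <;> simp [hi]

/-- The coefficient of degree d is the value of h(A, ·) at the point (1, 0, 0). -/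
theorem natDegree_lineRestriction {h : MvPolynomial (Fin 3 × Fin m ⊕ Fin 3) K} {d : ℕ}
    (hh : IsWeightedHomogeneous (planeWeight m) h d) (A : Fin 3 × Fin m → K) (y : Fin 3 → K)
    (h0 : eval (Sum.elim A (Pi.single 0 1)) h ≠ 0) : (lineRestriction h A y).natDegree = d := by
  have hterm : ∀ e ∈ h.support, (e (Sum.inr 0) + e (Sum.inr 1) + e (Sum.inr 2) : ℕ) = d := by
    intro e he
    have := hh (mem_support_iff.1 he)
    rw [Finsupp.weight_apply, Finsupp.sum_fintype _ _ (by simp)] at this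
    simpa [planeWeight, Fin.sum_univ_three] using this
  have hexp : lineRestriction h A y = ∑ e ∈ h.support, Polynomial.C (coeff e h) *
      ((Polynomial.C (∏ p, A p ^ e (Sum.inl p)) * (Polynomial.X ^ e (Sum.inr 0) *
        Polynomial.C (y 1 ^ e (Sum.inr 1)) * Polynomial.C (y 2 ^ e (Sum.inr 2))))) := by
    rw [lineRestriction, aeval_def, eval₂_eq']
    refine Finset.sum_congr rfl fun e _ => ?_
    simp [Fintype.prod_sum_type, Fin.prod_univ_three, map_prod]
  have hle : (lineRestriction h A y).natDegree ≤ d := by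
    rw [hexp]
    refine Polynomial.natDegree_sum_le_of_forall_le _ _ fun e he => ?_
    have := hterm e he
    refine (Polynomial.natDegree_C_mul_le _ _).trans ((Polynomial.natDegree_C_mul_le _ _).trans ?_)
    refine (Polynomial.natDegree_mul_C_le _ _).trans ((Polynomial.natDegree_mul_C_le _ _).trans ?_)
    rw [Polynomial.natDegree_X_pow]
    omega
  refine le_antisymm hle (Polynomial.le_natDegree_of_ne_zero ?_)
  convert h0 using 1
  rw [hexp, Polynomial.finsetSum_coeff, eval_eq']
  refine Finset.sum_congr rfl fun e he => ?_
  have := hterm e he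
  simp only [Polynomial.coeff_C_mul, Polynomial.coeff_mul_C, Polynomial.coeff_X_pow]
  rw [Fintype.prod_sum_type, Fin.prod_univ_three]
  simp only [Sum.elim_inl, Sum.elim_inr]
  by_cases h1 : e (Sum.inr 1) = 0
  · by_cases h2 : e (Sum.inr 2) = 0
    · rw [if_pos (by omega), h1, h2]; simp
    · rw [if_neg (by omega)]; simp [h2]
  · rw [if_neg (by omega)]; simp [h1]

theorem exists_eval_update_eq_zero [IsAlgClosed K] {h : MvPolynomial (Fin 3 × Fin m ⊕ Fin 3) K}
    {d : ℕ} (hd : d ≠ 0)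
    (hh : IsWeightedHomogeneous (planeWeight m) h d) (A : Fin 3 × Fin m → K) (y : Fin 3 → K)
    (h0 : eval (Sum.elim A (Pi.single 0 1)) h ≠ 0) :
    ∃ s, eval (Sum.elim A (Function.update y 0 s)) h = 0 := by
  obtain ⟨s, hs⟩ := IsAlgClosed.exists_root (lineRestriction h A y) (by
    intro hdeg
    have := natDegree_lineRestriction hh A y h0
    rw [Polynomial.natDegree_eq_of_degree_eq_some hdeg] at this
    exact hd this.symm)
  exact ⟨s, by rw [← eval_lineRestriction]; exact hs⟩

/-- In each chart x_c ≠ 0 a point is determined by the ratios x_a / x_c, each of which has finitely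
many values. -/
theorem finite_of_forall_pair {Z : Set (PSpace K m)}
    (hZ : ∀ a c : Fin m, ∃ q : Polynomial K, q ≠ 0 ∧
      ∀ x ∈ Z, x.rep c ≠ 0 → q.eval (x.rep a / x.rep c) = 0) : Z.Finite := by
  choose q hq0 hq using hZ
  have hcov : Z ⊆ ⋃ c, {x ∈ Z | x.rep c ≠ 0} := by
    intro x hx
    obtain ⟨c, hc⟩ : ∃ c, x.rep c ≠ 0 := by
      by_contra! hc
      exact x.rep_nonzero (funext hc)
    exact Set.mem_iUnion.2 ⟨c, hx, hc⟩
  refine (Set.finite_iUnion fun c => ?_).subset hcov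
  refine Set.Finite.of_finite_image (f := fun x a => x.rep a / x.rep c)
    ((Set.Finite.pi' fun a => Polynomial.finite_setOfPred_isRoot (hq0 a c)).subset ?_) ?_
  · rintro _ ⟨x, ⟨hx, hc⟩, rfl⟩ a
    exact hq a c x hx hc
  · rintro x ⟨-, hx⟩ y ⟨-, hy⟩ hxy
    refine eq_of_forall_mul_eq_mul fun i j => ?_
    have hi := congrFun hxy i
    have hj := congrFun hxy j
    simp only at hi hj
    rw [div_eq_div_iff hx hy] at hi hj
    have : x.rep c * y.rep c ≠ 0 := mul_ne_zero hx hy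
    apply mul_left_cancel₀ this
    linear_combination x.rep c * y.rep j * hi - x.rep c * y.rep i * hj

variable {M : Type*} [Field M] [Algebra K M] {t : Fin 3 × Fin m → M} {ξ : Fin m → M}
  {h : MvPolynomial (Fin 3 × Fin m ⊕ Fin 3) K} {d : ℕ}

namespace IsGenericPlaneEquation

variable (H : IsGenericPlaneEquation t ξ h d)
include H

theorem finite_inter [Infinite K] {G : MvPolynomial (Fin m) K} {e : ℕ} (he : G.IsHomogeneous e)
    (hG : aeval ξ G ≠ 0) : {x ∈ specializations (K := K) ξ | eval x.rep G = 0}.Finite := by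
  classical
  refine finite_of_forall_pair fun a c => ?_
  -- A relation between ξ_a, ξ_c and G(ξ) of least total degree is not divisible by its third
  -- variable, as G(ξ) ≠ 0. Setting that variable to 0 leaves a nontrivial relation on the section G
  -- = 0.
  have hne : ∃ n, ∃ P : MvPolynomial (Fin 3) K, P ≠ 0 ∧
      aeval (fun i => aeval ξ ((![X a, X c, G] : Fin 3 → MvPolynomial (Fin m) K) i)) P = 0 ∧
      P.totalDegree = n := by
    obtain ⟨P, hP, hP0⟩ := H.dep ![X a, X c, G]
    exact ⟨_, P, hP, hP0, rfl⟩
  obtain ⟨P, hP, hP0, hPn⟩ := Nat.find_spec hne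
  have hmin := fun n hn => Nat.find_min hne (m := n) hn
  rw [← hPn] at hmin
  have hnd : ¬ (X 2 : MvPolynomial (Fin 3) K) ∣ P := by
    rintro ⟨Q, rfl⟩
    have hQ : Q ≠ 0 := right_ne_zero_of_mul hP
    refine hmin Q.totalDegree ?_ ⟨Q, hQ, ?_, rfl⟩
    · rw [totalDegree_mul_of_isDomain (X_ne_zero _) hQ, totalDegree_X]
      omega
    · rw [map_mul] at hP0
      refine (mul_eq_zero.1 hP0).resolve_left ?_
      simpa using hG
  let p : MvPolynomial (Fin 3) K := aeval (![X 0, X 1, 0] : Fin 3 → MvPolynomial (Fin 3) K) P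
  have hp : p ≠ 0 := by
    intro hp
    apply hnd
    rw [← Ideal.mem_span_singleton, ← Ideal.Quotient.eq_zero_iff_mem]
    have : Ideal.Quotient.mkₐ K (Ideal.span {(X 2 : MvPolynomial (Fin 3) K)}) =
        (Ideal.Quotient.mkₐ K (Ideal.span {(X 2 : MvPolynomial (Fin 3) K)})).comp
          (aeval (![X 0, X 1, 0] : Fin 3 → MvPolynomial (Fin 3) K)) := by
      refine algHom_ext fun i => ?_
      fin_cases i
      · simp
      · simp
      · simp
    have h1 := DFunLike.congr_fun this P
    simp only [AlgHom.comp_apply] at h1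
    change Ideal.Quotient.mk _ P = Ideal.Quotient.mk _ p at h1
    rw [h1, hp, map_zero]
  obtain ⟨y, hy⟩ := exists_forall_eval_ne_zero Finset.univ
    (![p, X 1] : Fin 2 → MvPolynomial (Fin 3) K) (by
      intro i _
      fin_cases i
      · exact hp
      · exact X_ne_zero _)
  have hy0 : eval y p ≠ 0 := hy 0 (Finset.mem_univ _)
  have hy1 : y 1 ≠ 0 := by simpa using hy 1 (Finset.mem_univ _)
  have hpe : eval y p = eval ![y 0, y 1, 0] P := by
    rw [eval_aeval]
    congr 2
    funext i
    fin_cases i <;> simp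
  -- The relation need not be homogeneous, but it holds on the whole line through the representative
  -- of x. The representative can thus be scaled to have c-th coordinate y 1, a value for which the
  -- relation stays nonzero.
  let q : Polynomial K := aeval (![Polynomial.C (y 1) * Polynomial.X, Polynomial.C (y 1), 0]) P
  have hq : ∀ s, q.eval s = eval ![y 1 * s, y 1, 0] P := by
    intro s
    rw [polynomial_eval_aeval]
    congr 2
    funext i
    fin_cases i <;> simp
  refine ⟨q, ?_, ?_⟩
  · intro hq0
    have := hq (y 0 / y 1)
    rw [hq0, Polynomial.eval_zero, mul_div_cancel₀ _ hy1, ← hpe] at this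
    exact hy0 this.symm
  · rintro x ⟨hx, hGx⟩ hc
    rw [hq]
    have h1 := H.eval_rep_eq_zero hx (G := aeval ![X a, X c, G] P) (by
      rw [← hP0, ← AlgHom.comp_apply, comp_aeval]) (y 1 / x.rep c)
    rw [eval_aeval] at h1
    refine Eq.trans ?_ h1
    congr 2
    funext i
    fin_cases i
    · simp; field_simp
    · simp; field_simp
    · simp [eval_smul_of_isHomogeneous he, hGx]

end IsGenericPlaneEquation
end Points

/-- A proper closed irreducible subset is finite, hence a point, so chains have length at most one.
The chain from a point to the whole space has length one. -/
theorem topologicalKrullDim_eq_one {X : Type*} [TopologicalSpace X] [T1Space X] [Infinite X]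
    [IrreducibleSpace X] (hX : ∀ Z : Set X, IsClosed Z → Z ≠ Set.univ → Z.Finite) :
    topologicalKrullDim X = 1 := by
  have hfin : ∀ Z : TopologicalSpace.IrreducibleCloseds X, (Z : Set X).Finite →
      ∃ x, (Z : Set X) = {x} := by
    intro Z hZ
    obtain ⟨x, hx⟩ := Z.isIrreducible.1
    refine ⟨x, Set.Subset.antisymm ?_ (Set.singleton_subset_iff.2 hx)⟩
    rcases (isPreirreducible_iff_isClosed_union_isClosed.1 Z.isIrreducible.2) {x}
      ((Z : Set X) \ {x}) isClosed_singleton (hZ.subset Set.sdiff_subset).isClosed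
      (by rw [Set.union_sdiff_self]; exact Set.subset_union_right) with h | h
    · exact h
    · exact absurd rfl (h hx).2
  refine le_antisymm (Order.krullDim_le_one_iff.2 fun Z => ?_) (Order.one_le_krullDim_iff.2 ?_)
  · by_cases hZ : (Z : Set X) = Set.univ
    · right
      intro Y _ 
      change (Y : Set X) ⊆ Z
      rw [hZ]
      exact Set.subset_univ _
    · left
      obtain ⟨x, hx⟩ := hfin Z (hX _ Z.isClosed hZ)
      intro Y hY
      change (Z : Set X) ⊆ Y
      have hY' : (Y : Set X) ⊆ Z := hY
      rw [hx] at hY' ⊢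
      obtain ⟨y, hy⟩ := Y.isIrreducible.1
      have := hY' hy
      rw [Set.mem_singleton_iff] at this
      rw [Set.singleton_subset_iff, ← this]
      exact hy
  · obtain ⟨x, y, hxy⟩ := exists_pair_ne X
    refine ⟨⟨{x}, isIrreducible_singleton, isClosed_singleton⟩,
      ⟨Set.univ, IrreducibleSpace.isIrreducible_univ X, isClosed_univ⟩, ?_⟩
    refine lt_of_le_of_ne (Set.subset_univ ({x} : Set X)) fun h => ?_
    have h1 : ({x} : Set X) = Set.univ := congrArg (fun Z => Z.carrier) h
    exact hxy (h1 ▸ Set.mem_univ y : y ∈ ({x} : Set X)).symm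

theorem topologicalKrullDim_le_zero {X : Type*} [TopologicalSpace X] [Subsingleton X] :
    topologicalKrullDim X ≤ 0 := by
  refine Order.krullDim_nonpos_iff_forall_isMax.2 fun Z Y _ => ?_
  change (Y : Set X) ⊆ Z
  obtain ⟨z, hz⟩ := Z.isIrreducible.1
  intro y _
  rwa [Subsingleton.elim y z]

/-! ### The locus of a generic plane equation is an irreducible curve -/

section Points

variable {K : Type*} [Field K] {m : ℕ}

instance : T1Space (PSpace K m) := by
  refine ⟨fun x => ?_⟩
  rw [isClosed_iff_isAlgebraic]
  refine ⟨Set.range fun p : Fin m × Fin m => X p.1 * C (x.rep p.2) - X p.2 * C (x.rep p.1), ?_, ?_⟩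
  · rintro _ ⟨p, rfl⟩
    refine ⟨1, IsHomogeneous.sub ?_ ?_⟩
    · simpa using (isHomogeneous_X K p.1).mul (isHomogeneous_C (Fin m) (x.rep p.2))
    · simpa using (isHomogeneous_X K p.2).mul (isHomogeneous_C (Fin m) (x.rep p.1))
  · ext y
    constructor
    · rintro rfl _ ⟨p, rfl⟩
      simp [mul_comm]
    · intro hy
      refine eq_of_forall_mul_eq_mul fun i j => ?_
      have := hy _ ⟨(i, j), rfl⟩
      simpa [sub_eq_zero] using this

variable {M : Type*} [Field M] [Algebra K M] {t : Fin 3 × Fin m → M} {ξ : Fin m → M}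
  {h : MvPolynomial (Fin 3 × Fin m ⊕ Fin 3) K} {d : ℕ}

/-- The linear form with the given coefficients. -/
noncomputable def linForm (a : Fin m → K) : MvPolynomial (Fin m) K := ∑ j, C (a j) * X j

theorem isHomogeneous_linForm (a : Fin m → K) : (linForm a).IsHomogeneous 1 := by
  refine IsHomogeneous.sum _ _ _ fun j _ => ?_
  simpa using (isHomogeneous_C (Fin m) (a j)).mul (isHomogeneous_X K j)

theorem eval_linForm (a v : Fin m → K) : eval v (linForm a) = ∑ j, a j * v j := by
  simp [linForm]

theorem aeval_linForm {L : Type*} [CommSemiring L] [Algebra K L] (a : Fin m → K) (v : Fin m → L) :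
    aeval v (linForm a) = ∑ j, a j • v j := by
  simp [linForm, Algebra.smul_def]

/-- A `K`-linear functional takes the coordinates of a nonzero vector over an extension to those of
a nonzero vector. -/
theorem exists_functional_ne_zero {L : Type*} [Field L] [Algebra K L] {a : L} (ha : a ≠ 0) :
    ∃ φ : L →ₗ[K] K, φ a ≠ 0 := by
  by_contra! hc
  exact ha ((Module.forall_dual_apply_eq_zero_iff K a).1 hc)

/-- The substitution of constants for the rows of the generic matrix in a given set. -/
noncomputable def fixRows (s : Finset (Fin 3)) (A : Fin 3 × Fin m → K)
    (h : MvPolynomial (Fin 3 × Fin m ⊕ Fin 3) K) : MvPolynomial (Fin 3 × Fin m ⊕ Fin 3) K :=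
  aeval (Sum.elim (fun p => if p.1 ∈ s then C (A p) else X (Sum.inl p)) (fun i => X (Sum.inr i))) h

theorem eval_fixRows (s : Finset (Fin 3)) (A B : Fin 3 × Fin m → K) (y : Fin 3 → K)
    (h : MvPolynomial (Fin 3 × Fin m ⊕ Fin 3) K) :
    eval (Sum.elim B y) (fixRows s A h) =
      eval (Sum.elim (fun p => if p.1 ∈ s then A p else B p) y) h := by
  rw [fixRows, eval_aeval]
  congr 2
  funext i
  rcases i with p | i
  · by_cases hp : p.1 ∈ s <;> simp [hp]
  · simp

/-- The linear form `∑ j, t (i, j) * v j` in row `i` of the generic matrix. -/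
noncomputable def rowForm (i : Fin 3) (v : Fin m → K) :
    MvPolynomial (Fin 3 × Fin m ⊕ Fin 3) K := ∑ j, C (v j) * X (Sum.inl (i, j))

theorem eval_rowForm (i : Fin 3) (v : Fin m → K) (A : Fin 3 × Fin m → K) (y : Fin 3 → K) :
    eval (Sum.elim A y) (rowForm i v) = mulV A v i := by
  simp [rowForm, mulV, mul_comm]

theorem rowForm_ne_zero (i : Fin 3) {v : Fin m → K} (hv : v ≠ 0) : rowForm i v ≠ 0 := by
  classical
  obtain ⟨j, hj⟩ : ∃ j, v j ≠ 0 := by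
    by_contra! hc
    exact hv (funext hc)
  intro h
  have := eval_rowForm i v (fun p => if p.2 = j then 1 else 0) 0
  rw [h, map_zero, mulV, Finset.sum_eq_single j (by intro b _ hb; simp [hb]) (by simp)] at this
  simp at this
  exact hj this.symm

theorem exists_forall_eval_ne_zero' [Infinite K] {ι : Type*} (s : Finset ι)
    (p : ι → MvPolynomial (Fin 3 × Fin m ⊕ Fin 3) K) (hp : ∀ i ∈ s, p i ≠ 0) :
    ∃ A y, ∀ i ∈ s, eval (Sum.elim A y) (p i) ≠ 0 := by
  obtain ⟨a, ha⟩ := exists_forall_eval_ne_zero s p hp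
  have h1 : Sum.elim (fun i => a (Sum.inl i)) (fun i => a (Sum.inr i)) = a :=
    Sum.elim_comp_inl_inr a
  exact ⟨fun i => a (Sum.inl i), fun i => a (Sum.inr i), by rwa [h1]⟩

namespace IsGenericPlaneEquation

variable (H : IsGenericPlaneEquation t ξ h d)
include H

theorem exists_eval_ne_zero [Infinite K] : ∃ A y, eval (Sum.elim A y) h ≠ 0 := by
  obtain ⟨A, y, hA⟩ := exists_forall_eval_ne_zero' {()} (fun _ => h) (fun _ _ => H.ne_zero)
  exact ⟨A, y, hA () (by simp)⟩

/-- In degree 0 the polynomial h does not involve y, and h(t, tξ) = 0 would be an algebraic relation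
among the entries of t alone. -/
theorem degree_ne_zero [Infinite K] : d ≠ 0 := by
  rintro rfl
  obtain ⟨A, y, hA⟩ := H.exists_eval_ne_zero
  apply hA
  have h1 := aeval_smul_of_planeWeight H.weight t (mulV t ξ) 0
  rw [(H.ker h).2 dvd_rfl, mul_zero] at h1
  let P : MvPolynomial (Fin 3 × Fin m) (MvPolynomial (Fin m) K) :=
    map C (aeval (Sum.elim X (fun _ => (0 : MvPolynomial (Fin 3 × Fin m) K))) h)
  have hP : eval₂ (aeval ξ : MvPolynomial (Fin m) K →ₐ[K] M).toRingHom t P = 0 := by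
    rw [eval₂_map, aeval_def, ← coe_eval₂Hom, hom_eval₂, ← h1, aeval_def]
    congr 1
    · ext c; simp
    · funext i
      rcases i with p | i <;> simp
  have hP0 : aeval (Sum.elim X (fun _ => (0 : MvPolynomial (Fin 3 × Fin m) K))) h = 0 := by
    ext e
    have := H.indep P hP e
    rw [coeff_map, aeval_C] at this
    simpa using this
  have h2 := eval_aeval A (Sum.elim X (fun _ => (0 : MvPolynomial (Fin 3 × Fin m) K))) h
  rw [hP0, map_zero] at h2
  have h3 := eval_smul_of_planeWeight H.weight A y 0
  rw [pow_zero, one_mul] at h3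
  rw [← h3]
  refine Eq.trans ?_ h2.symm
  congr 2
  funext i
  rcases i with p | i
  · simp
  · simp only [zero_mul, Sum.elim_inr, map_zero]

/-- If ξ = 0, then h divides every y_i, so h(A, ·) has no zero with y_1 = 1. But a plane form of
positive degree has a zero on the line through (1, 0, 0) and (0, 1, 0). -/
theorem exists_ne_zero [IsAlgClosed K] : ∃ j, ξ j ≠ 0 := by
  by_contra! hc
  have h0 : ∀ i : Fin 3, h ∣ X (Sum.inr i) := fun i => by
    rw [← H.ker]
    simp [mulV, hc]
  obtain ⟨g, hg⟩ := h0 0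
  obtain ⟨s, hs⟩ := exists_eval_update_eq_zero H.degree_ne_zero H.weight 0 ![0, 1, 0] (by
    intro h1
    have := congrArg (eval (Sum.elim (0 : Fin 3 × Fin m → K) (Pi.single 0 1))) hg
    rw [map_mul, h1] at this
    simp at this)
  obtain ⟨g, hg⟩ := h0 1
  have := congrArg (eval (Sum.elim (0 : Fin 3 × Fin m → K) (Function.update ![0, 1, 0] 0 s))) hg
  rw [map_mul, hs, zero_mul, eval_X] at this
  exact one_ne_zero this

theorem eq_or_finite_of_isClosed [Infinite K] {Z : Set (PSpace K m)} (hZ : IsClosed Z)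
    (hZs : Z ⊆ specializations ξ) : Z = specializations ξ ∨ Z.Finite := by
  obtain ⟨T, hT, rfl⟩ := (isClosed_iff_isAlgebraic Z).1 hZ
  by_cases hc : ∀ G ∈ T, aeval ξ G = 0
  · left
    exact Set.Subset.antisymm hZs fun x hx G hG => hx G ⟨hT G hG, hc G hG⟩
  · right
    push Not at hc
    obtain ⟨G, hG, hG0⟩ := hc
    obtain ⟨e, he⟩ := hT G hG
    exact (H.finite_inter he hG0).subset fun x hx => ⟨hZs hx, hx G hG⟩

variable [IsAlgClosed K] [CharZero K]

/-- Otherwise, whenever h(A, ·) is not identically zero, the point (1, 0, 0) lifts to the curve for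
the matrix `A`, that is, rows 1 and 2 have a common zero on the curve. Row 1 can be chosen to cut
the curve in finitely many points, and row 2 to avoid them. -/
theorem exists_eval_single_ne_zero : ∃ A, eval (Sum.elim A (Pi.single 0 1)) h ≠ 0 := by
  classical
  by_contra! hc
  obtain ⟨j, hj⟩ := H.exists_ne_zero
  -- A linear functional on M turns ξ into a nonzero vector u over K. A row that does not kill u
  -- cannot kill ξ either.
  obtain ⟨φ, hφ⟩ := exists_functional_ne_zero (K := K) hj
  have hu : (fun j => φ (ξ j)) ≠ 0 := fun h => hφ (congrFun h j)
  obtain ⟨A, y, hA⟩ := exists_forall_eval_ne_zero' Finset.univ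
    (![h, rowForm 1 (fun j => φ (ξ j))] : Fin 2 → _) (by
      intro i _
      fin_cases i
      · exact H.ne_zero
      · exact rowForm_ne_zero _ hu)
  have hAh : eval (Sum.elim A y) h ≠ 0 := hA 0 (Finset.mem_univ _)
  have hA1 : mulV A (fun j => φ (ξ j)) 1 ≠ 0 := by
    have := hA 1 (Finset.mem_univ _)
    rwa [← eval_rowForm (y := y)]
  have hG : aeval ξ (linForm fun j => A (1, j)) ≠ 0 := by
    intro h0
    apply hA1
    rw [aeval_linForm] at h0
    simpa [mulV] using congrArg φ h0
  have hfin := H.finite_inter (isHomogeneous_linForm _) hG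
  obtain ⟨B, y', hB⟩ := exists_forall_eval_ne_zero' (Finset.insertNone hfin.toFinset)
    (fun o => o.elim (fixRows {1} A h) fun z => rowForm 2 z.rep) (by
      intro o _
      rcases o with _ | z
      · intro h0
        apply hAh
        have := eval_fixRows {1} A A y h
        simp only [Option.elim_none] at h0
        rw [h0, map_zero] at this
        simpa using this.symm
      · exact rowForm_ne_zero _ z.rep_nonzero)
  have hBh := hB none (by simp)
  simp only [Option.elim_none, eval_fixRows] at hBh
  obtain ⟨x, hx, c, -, hAx⟩ := H.exists_specialization_eq hBh (y := Pi.single 0 1) (by simp)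
    (hc _)
  have h1 := hAx 1
  have h2 := hAx 2
  simp [mulV] at h1 h2
  have hxZ : x ∈ hfin.toFinset := by
    simp only [Set.Finite.mem_toFinset]
    exact ⟨hx, by rw [eval_linForm, h1]⟩
  have := hB (some x) (by simpa using hxZ)
  simp only [Option.elim_some, eval_rowForm] at this
  exact this h2

/-- The curve projects onto the pencil of lines through (1, 0, 0): there is a point above each line
y_2 = b y_1, and K is infinite. -/
theorem infinite_specializations : (specializations (K := K) ξ).Infinite := by
  obtain ⟨A, hA⟩ := H.exists_eval_single_ne_zero
  have hex : ∀ b : K, ∃ x ∈ specializations (K := K) ξ, mulV A x.rep 1 ≠ 0 ∧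
      mulV A x.rep 2 = b * mulV A x.rep 1 := by
    intro b
    obtain ⟨s, hs⟩ := exists_eval_update_eq_zero H.degree_ne_zero H.weight A ![0, 1, b] hA
    obtain ⟨x, hx, c, hc, hAx⟩ := H.exists_specialization_eq hA
      (fun h0 => by simpa using congrFun h0 1) hs
    refine ⟨x, hx, ?_, ?_⟩
    · rw [hAx]; simpa using hc
    · rw [hAx, hAx]; simp [mul_comm]
  choose f hf hf1 hf2 using hex
  refine Set.infinite_of_injective_forall_mem (f := f) (fun b b' hbb => ?_) hf
  have h1 := hf2 b
  rw [hbb, hf2 b'] at h1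
  exact (mul_right_cancel₀ (hf1 b') h1).symm

theorem isIrreducible_specializations : IsIrreducible (specializations (K := K) ξ) := by
  have hinf := H.infinite_specializations
  refine ⟨hinf.nonempty, isPreirreducible_iff_isClosed_union_isClosed.2 fun Z₁ Z₂ h₁ h₂ hs => ?_⟩
  rcases H.eq_or_finite_of_isClosed (h₁.inter (isClosed_specializations ξ))
    Set.inter_subset_right with h | h
  · left; rw [← h]; exact Set.inter_subset_left
  rcases H.eq_or_finite_of_isClosed (h₂.inter (isClosed_specializations ξ))
    Set.inter_subset_right with h' | h'
  · right; rw [← h']; exact Set.inter_subset_left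
  refine absurd ((h.union h').subset fun x hx => ?_) hinf
  rcases hs hx with h3 | h3
  · exact Or.inl ⟨h3, hx⟩
  · exact Or.inr ⟨h3, hx⟩

theorem topologicalKrullDim_specializations :
    topologicalKrullDim (specializations (K := K) ξ) = 1 := by
  have hinf := H.infinite_specializations
  have : Infinite (specializations (K := K) ξ) := hinf.to_subtype
  have : IrreducibleSpace (specializations (K := K) ξ) :=
    Subtype.irreducibleSpace H.isIrreducible_specializations
  refine topologicalKrullDim_eq_one fun Z hZ hne => ?_
  have hcl := (isClosed_specializations (K := K) ξ).isClosedMap_subtype_val Z hZ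
  rcases H.eq_or_finite_of_isClosed hcl (by rintro _ ⟨x, -, rfl⟩; exact x.2) with h1 | h1
  · refine absurd (Set.eq_univ_of_forall fun x => ?_) hne
    have : (x : PSpace K m) ∈ Subtype.val '' Z := by rw [h1]; exact x.2
    obtain ⟨y, hy, hyx⟩ := this
    rwa [← Subtype.ext hyx]
  · exact h1.of_finite_image Subtype.val_injective.injOn

/-- A general projection separates a point x outside the curve from the curve. If x were in the
locus, A x would lift to a point z of the curve with A z proportional to A x. Rows 0 and 1 confine z
to a finite set, and a general row 2 excludes every member of it. -/
theorem planeLocus_eq : planeLocus h = specializations ξ := by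
  classical
  refine Set.Subset.antisymm (fun x hx => ?_) H.specializations_subset
  by_contra hxs
  set v := x.rep with hv
  -- If all minors of x and ξ vanished, ξ would be a multiple of x and x would be a specialization
  -- of ξ.
  obtain ⟨j, k, hjk⟩ : ∃ j k, v j • ξ k - v k • ξ j ≠ 0 := by
    by_contra! hc
    apply hxs
    rintro G ⟨⟨e, he⟩, hG⟩
    obtain ⟨k, hk⟩ : ∃ k, v k ≠ 0 := by
      by_contra! h0
      exact x.rep_nonzero (funext h0)
    obtain ⟨j, hj⟩ := H.exists_ne_zero
    have hk' : algebraMap K M (v k) ≠ 0 := by simpa using hk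
    have hξ : ξ = fun i => ξ k * (algebraMap K M (v k))⁻¹ * algebraMap K M (v i) := by
      funext i
      have := hc k i
      simp only [Algebra.smul_def] at this
      field_simp
      linear_combination this
    have hξk : ξ k ≠ 0 := by
      intro h0
      rw [hξ] at hj
      simp [h0] at hj
    rw [hξ, aeval_smul_of_isHomogeneous he] at hG
    have h1 := (mul_eq_zero.1 hG).resolve_left (pow_ne_zero _ (mul_ne_zero hξk (inv_ne_zero hk')))
    have h2 : aeval (fun i => algebraMap K M (v i)) G = algebraMap K M (eval v G) := by
      rw [← aeval_eq_eval]
      exact (aeval_algebraMap_apply M v G)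
    rw [h2] at h1
    exact (map_eq_zero _).1 h1
  obtain ⟨φ, hφ⟩ := exists_functional_ne_zero (K := K) hjk
  set u : Fin m → K := fun j => φ (ξ j) with hu
  have hdet : rowForm 0 v * rowForm 1 u - rowForm 1 v * rowForm 0 u ≠ 0 := by
    intro h0
    have := congrArg (eval (Sum.elim (fun p => if p.1 = 0 then (if p.2 = j then 1 else 0) else
      if p.2 = k then 1 else 0) 0)) h0
    simp only [map_sub, map_mul, eval_rowForm, map_zero] at this
    simp [mulV] at this
    apply hφ
    simp only [map_sub, map_smul, smul_eq_mul]
    exact this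
  obtain ⟨A, y, hA⟩ := exists_forall_eval_ne_zero' Finset.univ
    (![h, rowForm 0 v, rowForm 0 v * rowForm 1 u - rowForm 1 v * rowForm 0 u] : Fin 3 → _) (by
      intro i _
      fin_cases i
      · exact H.ne_zero
      · exact rowForm_ne_zero _ x.rep_nonzero
      · exact hdet)
  have hAh : eval (Sum.elim A y) h ≠ 0 := hA 0 (Finset.mem_univ _)
  have hA0 : mulV A v 0 ≠ 0 := by
    have := hA 1 (Finset.mem_univ _)
    rwa [← eval_rowForm (y := y)]
  have hA1 : mulV A v 0 * mulV A u 1 - mulV A v 1 * mulV A u 0 ≠ 0 := by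
    have := hA 2 (Finset.mem_univ _)
    simpa [eval_rowForm] using this
  -- The linear form in the pencil of rows 0 and 1 that vanishes at x; it vanishes at every z with A
  -- z proportional to A x.
  set a : Fin m → K := fun j => mulV A v 0 * A (1, j) - mulV A v 1 * A (0, j) with ha
  have hsum : ∀ w : Fin m → K, ∑ j, a j * w j =
      mulV A v 0 * mulV A w 1 - mulV A v 1 * mulV A w 0 := by
    intro w
    rw [mulV, mulV, mulV, mulV, Finset.mul_sum, Finset.mul_sum, ← Finset.sum_sub_distrib]
    exact Finset.sum_congr rfl fun j _ => by simp only [ha, mulV]; ring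
  have hG : aeval ξ (linForm a) ≠ 0 := by
    intro h0
    apply hA1
    rw [aeval_linForm] at h0
    rw [← hsum]
    simpa [hu] using congrArg φ h0
  have hfin := H.finite_inter (isHomogeneous_linForm _) hG
  have hne : ∀ z ∈ hfin.toFinset, (mulV A v 0 • z.rep - mulV A z.rep 0 • v) ≠ 0 := by
    intro z hz h0
    have hzs : z ∈ specializations ξ := ((Set.Finite.mem_toFinset _).1 hz).1
    apply hxs
    convert hzs using 1
    refine eq_of_forall_mul_eq_mul fun i l => ?_
    have hi := congrFun h0 i
    have hl := congrFun h0 l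
    simp only [Pi.sub_apply, Pi.smul_apply, smul_eq_mul, Pi.zero_apply] at hi hl
    apply mul_left_cancel₀ hA0
    rw [← hv]
    linear_combination v i * hl - v l * hi
  obtain ⟨B, y', hB⟩ := exists_forall_eval_ne_zero' (Finset.insertNone hfin.toFinset)
    (fun o => o.elim (fixRows {0, 1} A h)
      fun z => rowForm 2 (mulV A v 0 • z.rep - mulV A z.rep 0 • v)) (by
      intro o ho
      rcases o with _ | z
      · intro h0
        apply hAh
        have := eval_fixRows {0, 1} A A y h
        simp only [Option.elim_none] at h0
        rw [h0, map_zero] at this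
        simpa using this.symm
      · exact rowForm_ne_zero _ (hne z (by simpa using ho)))
  have hBh := hB none (by simp)
  simp only [Option.elim_none, eval_fixRows] at hBh
  set A' : Fin 3 × Fin m → K := fun p => if p.1 ∈ ({0, 1} : Finset (Fin 3)) then A p else B p
    with hA'
  have hr0 : ∀ w, mulV A' w 0 = mulV A w 0 := fun w => by simp [mulV, hA']
  have hr1 : ∀ w, mulV A' w 1 = mulV A w 1 := fun w => by simp [mulV, hA']
  have hr2 : ∀ w, mulV A' w 2 = mulV B w 2 := fun w => by simp [mulV, hA']
  obtain ⟨z, hz, c, -, hAz⟩ := H.exists_specialization_eq hBh (y := mulV A' v)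
    (fun h0 => hA0 (by rw [← hr0, h0]; rfl)) (hx A')
  have h0 := hAz 0
  have h1 := hAz 1
  have h2 := hAz 2
  rw [hr0, hr0] at h0
  rw [hr1, hr1] at h1
  rw [hr2, hr2] at h2
  have hzZ : z ∈ hfin.toFinset := by
    simp only [Set.Finite.mem_toFinset]
    refine ⟨hz, ?_⟩
    rw [eval_linForm, hsum, h0, h1]
    ring
  have := hB (some z) (by simpa using hzZ)
  simp only [Option.elim_some, eval_rowForm] at this
  apply this
  have hlin : mulV B (mulV A v 0 • z.rep - mulV A z.rep 0 • v) 2 =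
      mulV A v 0 * mulV B z.rep 2 - mulV A z.rep 0 * mulV B v 2 := by
    simp only [mulV, Finset.mul_sum, ← Finset.sum_sub_distrib]
    refine Finset.sum_congr rfl fun j _ => ?_
    simp only [Pi.sub_apply, Pi.smul_apply, smul_eq_mul]
    ring
  rw [hlin, h2, h0]
  ring

end IsGenericPlaneEquation
end Points

/-! ### Factors of weighted homogeneous polynomials -/

section Weighted

variable {σ K : Type*} [Field K] (w : σ → ℕ)

/-- The substitution `X i ↦ X i * T ^ w i`. -/
noncomputable def weightScaling : MvPolynomial σ K →ₐ[K] Polynomial (MvPolynomial σ K) :=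
  aeval fun i => Polynomial.C (X i) * Polynomial.X ^ w i

theorem weightScaling_monomial (e : σ →₀ ℕ) (c : K) : weightScaling w (monomial e c) =
    Polynomial.C (monomial e c) * Polynomial.X ^ Finsupp.weight w e := by
  rw [weightScaling, aeval_monomial, Finsupp.prod, Finsupp.weight_apply, Finsupp.sum]
  simp only [mul_pow, Finset.prod_mul_distrib, ← pow_mul, Finset.prod_pow_eq_pow_sum]
  rw [monomial_eq, Finsupp.prod, map_mul, map_prod, mul_assoc]
  simp [mul_comm]

theorem coeff_weightScaling (p : MvPolynomial σ K) (n : ℕ) :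
    (weightScaling w p).coeff n = weightedHomogeneousComponent w n p := by
  classical
  conv_lhs => rw [p.as_sum, map_sum, Polynomial.finsetSum_coeff]
  rw [weightedHomogeneousComponent_apply, Finset.sum_filter]
  refine Finset.sum_congr rfl fun e _ => ?_
  rw [weightScaling_monomial, Polynomial.coeff_C_mul, Polynomial.coeff_X_pow]
  simp [eq_comm]

theorem weightScaling_of_isWeightedHomogeneous {p : MvPolynomial σ K} {n : ℕ}
    (hp : IsWeightedHomogeneous w p n) :
    weightScaling w p = Polynomial.C p * Polynomial.X ^ n := by
  ext1 k
  rw [coeff_weightScaling, Polynomial.coeff_C_mul, Polynomial.coeff_X_pow]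
  by_cases hk : k = n
  · rw [if_pos hk, mul_one, hk, hp.weightedHomogeneousComponent_same]
  · rw [if_neg hk, mul_zero, hp.weightedHomogeneousComponent_ne k hk]

theorem isWeightedHomogeneous_of_weightScaling {p a : MvPolynomial σ K} {n : ℕ}
    (hp : weightScaling w p = Polynomial.C a * Polynomial.X ^ n) :
    IsWeightedHomogeneous w p n := by
  have h : ∀ k, k ≠ n → weightedHomogeneousComponent w k p = 0 := fun k hk => by
    rw [← coeff_weightScaling, hp, Polynomial.coeff_C_mul, Polynomial.coeff_X_pow, if_neg hk,
      mul_zero]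
  rw [← sum_weightedHomogeneousComponent w p, finsum_eq_single _ n h]
  exact weightedHomogeneousComponent_isWeightedHomogeneous n p

/-- Degrees and trailing degrees both add under multiplication. They agree for the product, so they
agree for each factor. -/
theorem exists_eq_C_mul_X_pow {A : Type*} [CommRing A] [IsDomain A] {P Q : Polynomial A} {a : A}
    {n : ℕ} (ha : a ≠ 0) (h : P * Q = Polynomial.C a * Polynomial.X ^ n) :
    ∃ b, P = Polynomial.C b * Polynomial.X ^ P.natDegree := by
  have hPQ : P * Q ≠ 0 := by
    rw [h]; simp [ha]
  have hP := left_ne_zero_of_mul hPQ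
  have hQ := right_ne_zero_of_mul hPQ
  have h1 := Polynomial.natDegree_mul hP hQ
  have h2 := Polynomial.natTrailingDegree_mul hP hQ
  rw [h, Polynomial.natDegree_C_mul_X_pow n a ha] at h1
  rw [h, Polynomial.C_mul_X_pow_eq_monomial, Polynomial.natTrailingDegree_monomial ha] at h2
  have h3 := Polynomial.natTrailingDegree_le_natDegree P
  have h4 := Polynomial.natTrailingDegree_le_natDegree Q
  refine ⟨P.leadingCoeff, ?_⟩
  ext k
  rw [Polynomial.coeff_C_mul, Polynomial.coeff_X_pow]
  rcases lt_trichotomy k P.natDegree with hk | hk | hk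
  · rw [if_neg hk.ne, mul_zero]
    exact Polynomial.coeff_eq_zero_of_lt_natTrailingDegree (by omega)
  · rw [if_pos hk, mul_one, hk, Polynomial.leadingCoeff]
  · rw [if_neg hk.ne', mul_zero]
    exact Polynomial.coeff_eq_zero_of_natDegree_lt hk

theorem MvPolynomial.IsWeightedHomogeneous.of_mul {p q : MvPolynomial σ K} {n : ℕ}
    (h0 : p * q ≠ 0) (h : IsWeightedHomogeneous w (p * q) n) :
    ∃ a b, a + b = n ∧ IsWeightedHomogeneous w p a ∧ IsWeightedHomogeneous w q b := by
  have h1 := weightScaling_of_isWeightedHomogeneous w h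
  rw [map_mul] at h1
  obtain ⟨a, ha⟩ := exists_eq_C_mul_X_pow h0 h1
  obtain ⟨b, hb⟩ := exists_eq_C_mul_X_pow h0 ((mul_comm _ _).trans h1)
  have hp := isWeightedHomogeneous_of_weightScaling w ha
  have hq := isWeightedHomogeneous_of_weightScaling w hb
  exact ⟨_, _, (hp.mul hq).inj_right h0 h, hp, hq⟩

end Weighted

/-! ### Transcendence degree, elimination and irreducible components -/

theorem algebraicIndependent_option_of_map_eq_zero {K A B ι : Type*} [Field K] [CommRing A]
    [IsDomain A] [Algebra K A] [CommRing B] [Algebra K B] (φ : A →ₐ[K] B) {x : ι → A}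
    (hx : AlgebraicIndependent K (φ ∘ x)) {a : A} (ha : a ≠ 0) (hφ : φ a = 0) :
    AlgebraicIndependent K (fun o : Option ι => o.elim a x) := by
  have hx' : AlgebraicIndependent K x := AlgebraicIndependent.of_comp φ hx
  rw [hx'.option_iff_transcendental]
  rintro ⟨p, hp, hpa⟩
  -- After removal of powers of the variable from a relation for `a` over K[x], its constant term is
  -- nonzero. Since φ kills `a`, it kills that term, against the independence of the images of x.
  obtain ⟨q, hq, hndvd⟩ := p.exists_eq_pow_rootMultiplicity_mul_and_not_dvd hp 0
  rw [map_zero, sub_zero, Polynomial.X_dvd_iff] at hndvd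
  have hqa : Polynomial.aeval a q = 0 := by
    rw [hq, map_mul, map_pow] at hpa
    refine (mul_eq_zero.1 hpa).resolve_left (pow_ne_zero _ ?_)
    simpa using ha
  have h1 : φ (q.coeff 0 : A) = 0 := by
    have := congrArg φ hqa
    rw [← q.divX_mul_X_add] at this
    simpa [hφ, Subalgebra.algebraMap_def] using this
  obtain ⟨P, hP⟩ : (q.coeff 0 : A) ∈ (aeval (R := K) x).range := by
    rw [← Algebra.adjoin_range_eq_range_aeval]
    exact (q.coeff 0).2
  change aeval x P = (q.coeff 0 : A) at hP
  rw [← hP, ← AlgHom.comp_apply, comp_aeval] at h1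
  have hP0 : P = 0 := hx (by rw [map_zero]; exact h1)
  rw [hP0, map_zero] at hP
  exact hndvd (Subtype.ext hP.symm)

theorem AlgebraicIndependent.card_le_of_mvPolynomial {K σ ι : Type*} [Field K] [Fintype σ]
    [Fintype ι] {x : ι → MvPolynomial σ K} (hx : AlgebraicIndependent K x) :
    Fintype.card ι ≤ Fintype.card σ := by
  have h1 := hx.lift_cardinalMk_le_trdeg
  rw [trdeg_of_isDomain] at h1
  simpa using h1

theorem card_lt_of_map_eq_zero {K σ B ι : Type*} [Field K] [Fintype σ] [Fintype ι]
    [CommRing B] [Algebra K B] (φ : MvPolynomial σ K →ₐ[K] B)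
    {x : ι → MvPolynomial σ K} (hx : AlgebraicIndependent K (φ ∘ x))
    {h : MvPolynomial σ K} (hh : h ≠ 0) (hφh : φ h = 0) : Fintype.card ι + 1 ≤ Fintype.card σ := by
  have h1 := (algebraicIndependent_option_of_map_eq_zero φ hx hh hφh).card_le_of_mvPolynomial
  simpa using h1

/-- Each of h and G lowers the transcendence degree by one: modulo the prime h the ring is a domain,
and G is nonzero there. -/
theorem card_add_two_le_of_map_eq_zero {K σ B ι : Type*} [Field K] [Fintype σ] [Fintype ι]
    [CommRing B] [Algebra K B] (φ : MvPolynomial σ K →ₐ[K] B)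
    {x : ι → MvPolynomial σ K} (hx : AlgebraicIndependent K (φ ∘ x))
    {h G : MvPolynomial σ K} (hh : Prime h) (hφh : φ h = 0) (hG : ¬ h ∣ G) (hφG : φ G = 0) :
    Fintype.card ι + 2 ≤ Fintype.card σ := by
  have hprime : (Ideal.span {h}).IsPrime := (Ideal.span_singleton_prime hh.ne_zero).2 hh
  let ψ : MvPolynomial σ K ⧸ Ideal.span {h} →ₐ[K] B := Ideal.Quotient.liftₐ _ φ (by
    intro a ha
    obtain ⟨b, rfl⟩ := Ideal.mem_span_singleton.1 ha
    rw [map_mul, hφh, zero_mul])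
  let π : MvPolynomial σ K →ₐ[K] MvPolynomial σ K ⧸ Ideal.span {h} := Ideal.Quotient.mkₐ K _
  have h1 : AlgebraicIndependent K (fun o : Option ι => o.elim (π G) (π ∘ x)) := by
    refine algebraicIndependent_option_of_map_eq_zero ψ (x := π ∘ x) hx (fun h0 => hG ?_) hφG
    rwa [← Ideal.mem_span_singleton, ← Ideal.Quotient.eq_zero_iff_mem]
  have h2 := card_lt_of_map_eq_zero π (x := fun o : Option ι => o.elim G x) (by
      convert h1 using 1
      funext o
      rcases o with _ | i <;> rfl) hh.ne_zero
    (Ideal.Quotient.eq_zero_iff_mem.2 (Ideal.mem_span_singleton_self h))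
  rw [Fintype.card_option] at h2
  omega

/-- If no prime factor of `f` divides its derivative with respect to one of the variables, then
that variable can be eliminated from `f` and the derivative. -/
theorem exists_elimination {K σ : Type*} [Field K] [Fintype σ] [DecidableEq σ] (i : σ)
    {f g : MvPolynomial σ K} (hf : f ≠ 0) (hfg : ∀ p, Prime p → p ∣ f → ¬ p ∣ g) :
    ∃ c : MvPolynomial {j // j ≠ i} K, c ≠ 0 ∧
      ∃ a b, a * f + b * g = rename Subtype.val c := by
  set ρ : MvPolynomial {j // j ≠ i} K →ₐ[K] MvPolynomial σ K := rename Subtype.val with hρ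
  let S : Submonoid (MvPolynomial σ K) := (nonZeroDivisors _).map ρ
  by_cases hdis : Disjoint (Ideal.span {f, g} : Set (MvPolynomial σ K)) S
  · exfalso
    -- If the ideal of f and g contained no nonzero polynomial free of the variable i, it would lie
    -- in a prime 𝔮 modulo which the other variables are independent. But 𝔮 contains a prime factor
    -- p of f and also g, not divisible by p, which leaves too small a transcendence degree.
    obtain ⟨𝔮, h𝔮, hle, hd⟩ := Ideal.exists_le_prime_disjoint _ S hdis
    have hf𝔮 : f ∈ 𝔮 := hle (Ideal.subset_span (by simp))
    have hg𝔮 : g ∈ 𝔮 := hle (Ideal.subset_span (by simp))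
    obtain ⟨u, hu⟩ := UniqueFactorizationMonoid.factors_prod hf
    have hmem : (UniqueFactorizationMonoid.factors f).prod ∈ 𝔮 := by
      have : (UniqueFactorizationMonoid.factors f).prod * u ∈ 𝔮 := by rwa [hu]
      exact (h𝔮.mem_or_mem this).resolve_right fun h =>
        h𝔮.ne_top (Ideal.eq_top_of_isUnit_mem _ h u.isUnit)
    obtain ⟨p, hp, hp𝔮⟩ := (h𝔮.multiset_prod_mem_iff_exists_mem _).1 hmem
    have hpp : Prime p := UniqueFactorizationMonoid.prime_of_factor p hp
    have hpf : p ∣ f := UniqueFactorizationMonoid.dvd_of_mem_factors hp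
    let π : MvPolynomial σ K →ₐ[K] MvPolynomial σ K ⧸ 𝔮 := Ideal.Quotient.mkₐ K 𝔮
    have hind : AlgebraicIndependent K
        (π ∘ fun j : {j // j ≠ i} => (X j.1 : MvPolynomial σ K)) := by
      rw [algebraicIndependent_iff]
      intro c hc
      by_contra hc0
      have hmem𝔮 : ρ c ∈ 𝔮 := by
        refine Ideal.Quotient.eq_zero_iff_mem.1 ?_
        rw [← hc, hρ]
        change π (rename Subtype.val c) = _
        rw [← AlgHom.comp_apply]
        congr 1
        ext j
        simp
      exact Set.disjoint_left.1 hd hmem𝔮 ⟨c, mem_nonZeroDivisors_of_ne_zero hc0, rfl⟩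
    have h1 := card_add_two_le_of_map_eq_zero π hind hpp (Ideal.Quotient.eq_zero_iff_mem.2 hp𝔮)
      (hfg p hpp hpf) (Ideal.Quotient.eq_zero_iff_mem.2 hg𝔮)
    have h2 : Fintype.card {j // j ≠ i} = Fintype.card σ - 1 := by
      simp [Fintype.card_subtype_compl]
    have h3 : 0 < Fintype.card σ := Fintype.card_pos_iff.2 ⟨i⟩
    omega
  · obtain ⟨x, hx, c, hc, rfl⟩ := Set.not_disjoint_iff.1 hdis
    obtain ⟨a, b, hab⟩ := Ideal.mem_span_pair.1 hx
    exact ⟨c, nonZeroDivisors.ne_zero hc, a, b, hab⟩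

theorem topologicalKrullDim_image_val {X : Type*} [TopologicalSpace X] {C : Set X} (Z : Set C) :
    topologicalKrullDim (Subtype.val '' Z : Set X) = topologicalKrullDim Z :=
  (IsHomeomorph.topologicalKrullDim_eq _
    (Topology.IsEmbedding.subtypeVal.homeomorphImage Z).isHomeomorph).symm

theorem isIrreducible_preimage_val {X : Type*} [TopologicalSpace X] {C Γ : Set X} (h : Γ ⊆ C)
    (hΓ : IsIrreducible Γ) : IsIrreducible (Subtype.val ⁻¹' Γ : Set C) := by
  have : IrreducibleSpace Γ := Subtype.irreducibleSpace hΓ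
  convert (IrreducibleSpace.isIrreducible_univ Γ).image (Set.inclusion h)
    (continuous_inclusion h).continuousOn
  rw [Set.image_univ, Set.range_inclusion]
  rfl

theorem exists_image_val_eq_of_mem_irreducibleComponents {X ι : Type*} [TopologicalSpace X]
    (s : Finset ι) (Γ : ι → Set X) (hΓ : ∀ i ∈ s, IsClosed (Γ i) ∧ IsIrreducible (Γ i))
    {Z : Set (⋃ i ∈ s, Γ i : Set X)}
    (hZ : Z ∈ irreducibleComponents (⋃ i ∈ s, Γ i : Set X)) :
    ∃ i ∈ s, Subtype.val '' Z = Γ i := by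
  classical
  have hirr : IsIrreducible (Subtype.val '' Z) := hZ.1.image _ continuous_subtype_val.continuousOn
  obtain ⟨G, hG, hZG⟩ := isIrreducible_iff_sUnion_isClosed.1 hirr (s.image Γ)
    (by
      intro G hG
      obtain ⟨i, hi, rfl⟩ := Finset.mem_image.1 hG
      exact (hΓ i hi).1) (by
      rintro _ ⟨x, -, rfl⟩
      obtain ⟨i, hi, hx⟩ := Set.mem_iUnion₂.1 x.2
      exact ⟨Γ i, by simpa using ⟨i, hi, rfl⟩, hx⟩)
  obtain ⟨i, hi, rfl⟩ := Finset.mem_image.1 hG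
  refine ⟨i, hi, Set.Subset.antisymm hZG fun x hx => ?_⟩
  have hsub : Γ i ⊆ ⋃ i ∈ s, Γ i := Set.subset_biUnion_of_mem (u := Γ) hi
  have hle : (Subtype.val ⁻¹' Γ i : Set (⋃ i ∈ s, Γ i : Set X)) ≤ Z :=
    hZ.2 (isIrreducible_preimage_val hsub (hΓ i hi).2) fun z hz => hZG ⟨z, hz, rfl⟩
  exact ⟨⟨x, hsub hx⟩, hle hx, rfl⟩

theorem exists_prime_dvd_map_eq_zero {A B : Type*} [CommRing A] [IsDomain A]
    [UniqueFactorizationMonoid A] [CommRing B] [IsDomain B] (φ : A →+* B) {f : A} (hf : f ≠ 0)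
    (hφ : φ f = 0) : ∃ p ∈ UniqueFactorizationMonoid.factors f, φ p = 0 := by
  obtain ⟨u, hu⟩ := UniqueFactorizationMonoid.factors_prod hf
  rw [← hu, map_mul, map_multiset_prod] at hφ
  have h1 := (mul_eq_zero.1 hφ).resolve_right (u.isUnit.map φ).ne_zero
  rw [Multiset.prod_eq_zero_iff, Multiset.mem_map] at h1
  exact h1

theorem exists_smul_eval_ne_zero {K : Type*} [Field K] [Infinite K] {σ : Type*}
    {p : MvPolynomial σ K} {v : σ → K} {e : ℕ} (h : eval v (homogeneousComponent e p) ≠ 0) :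
    ∃ c : K, c ≠ 0 ∧ eval (c • v) p ≠ 0 := by
  by_contra! hc
  let P : Polynomial K := ∑ i ∈ Finset.range (p.totalDegree + 1),
    Polynomial.C (eval v (homogeneousComponent i p)) * Polynomial.X ^ i
  have hP : ∀ c, P.eval c = eval (c • v) p := by
    intro c
    conv_rhs => rw [← sum_homogeneousComponent p, map_sum]
    rw [Polynomial.eval_finsetSum]
    refine Finset.sum_congr rfl fun i _ => ?_
    rw [eval_smul_of_isHomogeneous (homogeneousComponent_isHomogeneous i p), Polynomial.eval_mul,
      Polynomial.eval_C, Polynomial.eval_pow, Polynomial.eval_X, mul_comm]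
  have hP0 : P = 0 := Polynomial.eq_zero_of_infinite_isRoot P
    (Set.Infinite.mono (s := {0}ᶜ) (fun c hc0 => (hP c).trans (hc c hc0))
      (Set.finite_singleton 0).infinite_compl)
  have he : e ∈ Finset.range (p.totalDegree + 1) := by
    by_contra he
    rw [homogeneousComponent_eq_zero _ _ (by simpa using he)] at h
    simp at h
  have := congrArg (fun Q => Polynomial.coeff Q e) hP0
  simp only [P, Polynomial.finsetSum_coeff, Polynomial.coeff_C_mul, Polynomial.coeff_X_pow,
    Polynomial.coeff_zero] at this
  rw [Finset.sum_eq_single e (by intro b _ hb; simp [hb.symm]) (fun h' => absurd he h')] at this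
  simp at this
  exact h this

/-! ### Loci of products of curve equations -/

section

variable {K : Type u} [Field K] {m : ℕ}

/-- Substitution of the coordinates of the image of `x` under the generic projection. -/
noncomputable def planeSubst (x : Fin m → K) :
    MvPolynomial (Fin 3 × Fin m ⊕ Fin 3) K →ₐ[K] MvPolynomial (Fin 3 × Fin m) K :=
  aeval (Sum.elim X (fun i => ∑ j, C (x j) * X (i, j)))

theorem eval_planeSubst (x : Fin m → K) (h : MvPolynomial (Fin 3 × Fin m ⊕ Fin 3) K)
    (A : Fin 3 × Fin m → K) : eval A (planeSubst x h) = eval (Sum.elim A (mulV A x)) h := by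
  rw [planeSubst, eval_aeval]
  congr 2
  funext i
  rcases i with p | i
  · simp
  · simp [mulV, mul_comm]

theorem mem_planeLocus_iff [Infinite K] {h : MvPolynomial (Fin 3 × Fin m ⊕ Fin 3) K}
    {x : PSpace K m} : x ∈ planeLocus h ↔ planeSubst x.rep h = 0 := by
  constructor
  · intro hx
    refine MvPolynomial.funext fun A => ?_
    rw [eval_planeSubst, map_zero]
    exact hx A
  · intro hx A
    rw [← eval_planeSubst, hx, map_zero]

theorem planeLocus_subset_of_dvd {h f : MvPolynomial (Fin 3 × Fin m ⊕ Fin 3) K} (hf : h ∣ f) :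
    planeLocus h ⊆ planeLocus f := by
  rintro x hx A
  obtain ⟨g, rfl⟩ := hf
  rw [map_mul, hx A, zero_mul]

theorem planeLocus_eq_biUnion [Infinite K] [DecidableEq (MvPolynomial (Fin 3 × Fin m ⊕ Fin 3) K)]
    {f : MvPolynomial (Fin 3 × Fin m ⊕ Fin 3) K} (hf : f ≠ 0) :
    planeLocus f = ⋃ p ∈ (UniqueFactorizationMonoid.factors f).toFinset, planeLocus p := by
  ext x
  simp only [Set.mem_iUnion₂, Multiset.mem_toFinset, exists_prop]
  constructor
  · intro hx
    obtain ⟨p, hp, hp0⟩ := exists_prime_dvd_map_eq_zero (planeSubst x.rep).toRingHom hf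
      (mem_planeLocus_iff.1 hx)
    exact ⟨p, hp, mem_planeLocus_iff.2 hp0⟩
  · rintro ⟨p, hp, hx⟩
    exact planeLocus_subset_of_dvd (UniqueFactorizationMonoid.dvd_of_mem_factors hp) hx

/-- `h` is the equation of degree `d` of the generic projection to the plane of an irreducible
curve. -/
def IsCurveEquation (h : MvPolynomial (Fin 3 × Fin m ⊕ Fin 3) K) (d : ℕ) : Prop :=
  ∃ (M : Type u) (_ : Field M) (_ : Algebra K M) (t : Fin 3 × Fin m → M) (ξ : Fin m → M),
    IsGenericPlaneEquation t ξ h d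

theorem IsCurveEquation.of_associated {h p : MvPolynomial (Fin 3 × Fin m ⊕ Fin 3) K} {d : ℕ}
    (H : IsCurveEquation h d) (hp : Associated h p) : ∃ e, IsCurveEquation p e := by
  obtain ⟨M, _, _, t, ξ, H⟩ := H
  obtain ⟨q, hq⟩ := hp.symm.dvd
  have hne := H.ne_zero
  have hw := H.weight
  rw [hq] at hne hw
  obtain ⟨a, b, -, ha, -⟩ := IsWeightedHomogeneous.of_mul _ hne hw
  exact ⟨a, M, _, _, t, ξ, ⟨left_ne_zero_of_mul hne, ha,
    fun G => (H.ker G).trans hp.dvd_iff_dvd_left, H.hom, H.dep, H.indep⟩⟩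

variable [IsAlgClosed K] [CharZero K]

namespace IsCurveEquation

variable {h : MvPolynomial (Fin 3 × Fin m ⊕ Fin 3) K} {d : ℕ} (H : IsCurveEquation h d)
include H

theorem isClosed : IsClosed (planeLocus h) := by
  obtain ⟨M, _, _, t, ξ, H⟩ := H
  rw [H.planeLocus_eq]
  exact isClosed_specializations ξ

theorem isIrreducible : IsIrreducible (planeLocus h) := by
  obtain ⟨M, _, _, t, ξ, H⟩ := H
  rw [H.planeLocus_eq]
  exact H.isIrreducible_specializations

theorem topologicalKrullDim_eq : topologicalKrullDim (planeLocus h) = 1 := by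
  obtain ⟨M, _, _, t, ξ, H⟩ := H
  rw [H.planeLocus_eq]
  exact H.topologicalKrullDim_specializations

end IsCurveEquation

theorem isCurve_planeLocus {f : MvPolynomial (Fin 3 × Fin m ⊕ Fin 3) K} (hf : f ≠ 0)
    (hgood : ∀ p ∈ UniqueFactorizationMonoid.factors f, ∃ d, IsCurveEquation p d) :
    IsCurve (planeLocus f) := by
  classical
  rw [planeLocus_eq_biUnion hf]
  have hgood' : ∀ p ∈ (UniqueFactorizationMonoid.factors f).toFinset, ∃ d, IsCurveEquation p d :=
    fun p hp => hgood p (Multiset.mem_toFinset.1 hp)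
  refine ⟨isClosed_biUnion_finset fun p hp => (hgood' p hp).choose_spec.isClosed,
    fun Z hZ => ?_⟩
  obtain ⟨p, hp, hpZ⟩ := exists_image_val_eq_of_mem_irreducibleComponents _ _
    (fun p hp => ⟨(hgood' p hp).choose_spec.isClosed, (hgood' p hp).choose_spec.isIrreducible⟩) hZ
  rw [← topologicalKrullDim_image_val, hpZ]
  exact (hgood' p hp).choose_spec.topologicalKrullDim_eq

end

/-! ### The degree of the curve defined by a plane equation -/

section

variable {K : Type u} [Field K] {m : ℕ}

theorem derivative_lineRestriction (f : MvPolynomial (Fin 3 × Fin m ⊕ Fin 3) K)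
    (A : Fin 3 × Fin m → K) (y : Fin 3 → K) :
    (lineRestriction f A y).derivative = lineRestriction (pderiv (Sum.inr 0) f) A y := by
  classical
  induction f using MvPolynomial.induction_on with
  | C a => simp [lineRestriction, Polynomial.algebraMap_eq]
  | add p q hp hq =>
    simp only [lineRestriction, map_add] at hp hq ⊢
    rw [hp, hq]
  | mul_X p i hp =>
    simp only [lineRestriction, map_mul, Derivation.leibniz, map_add, smul_eq_mul,
      Polynomial.derivative_mul] at hp ⊢
    rw [hp]
    rcases i with i | i
    · simp [pderiv_X, mul_comm]
    · by_cases hi : i = 0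
      · subst hi; simp [mul_comm]; ring
      · simp [pderiv_X, hi, mul_comm]

theorem eval_lineRestriction_rename
    (c : MvPolynomial {j : Fin 3 × Fin m ⊕ Fin 3 // j ≠ Sum.inr 0} K)
    (A : Fin 3 × Fin m → K) (y : Fin 3 → K) (s : K) :
    (lineRestriction (rename Subtype.val c) A y).eval s =
      eval (Sum.elim A y) (rename Subtype.val c) := by
  rw [eval_lineRestriction, eval_rename, eval_rename]
  congr 2
  funext ⟨j, hj⟩
  rcases j with j | j
  · rfl
  · have : j ≠ 0 := fun h => hj (by rw [h])
    simp [Function.comp, this]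

/-- The value of `h(t, ·)` at the point `(1, 0, 0)`. -/
noncomputable def valueAtSingle : MvPolynomial (Fin 3 × Fin m ⊕ Fin 3) K →ₐ[K]
    MvPolynomial (Fin 3 × Fin m ⊕ Fin 3) K :=
  aeval (Sum.elim (fun p => X (Sum.inl p)) (fun i => C ((Pi.single 0 1 : Fin 3 → K) i)))

theorem eval_valueAtSingle (h : MvPolynomial (Fin 3 × Fin m ⊕ Fin 3) K)
    (A : Fin 3 × Fin m → K) (y : Fin 3 → K) :
    eval (Sum.elim A y) (valueAtSingle h) = eval (Sum.elim A (Pi.single 0 1)) h := by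
  rw [valueAtSingle, eval_aeval]
  congr 2
  funext i
  rcases i with p | i <;> simp

/-- The matrix with its middle row `r₁` replaced in such a way that `w = β r₁ - α r₂`. -/
def withLine (w : Fin m → K) (α β : K) (A : Fin 3 × Fin m → K) : Fin 3 × Fin m → K :=
  fun p => if p.1 = 1 then (w p.2 + α * A (2, p.2)) / β else A p

theorem mulV_withLine_zero (w x : Fin m → K) (α β : K) (A : Fin 3 × Fin m → K) :
    mulV (withLine w α β A) x 0 = mulV A x 0 := by simp [mulV, withLine]

theorem mulV_withLine_two (w x : Fin m → K) (α β : K) (A : Fin 3 × Fin m → K) :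
    mulV (withLine w α β A) x 2 = mulV A x 2 := by simp [mulV, withLine]

theorem mulV_withLine_one (w x : Fin m → K) (α : K) {β : K} (hβ : β ≠ 0)
    (A : Fin 3 × Fin m → K) :
    β * mulV (withLine w α β A) x 1 = ∑ j, w j * x j + α * mulV A x 2 := by
  simp only [mulV, withLine, Finset.mul_sum, ← Finset.sum_add_distrib]
  refine Finset.sum_congr rfl fun j _ => ?_
  simp only [if_true]
  field_simp

theorem orthogonal_iff (a x : PSpace K m) (c : K) (hc : c ≠ 0) :
    Projectivization.orthogonal a x ↔ ∑ j, (c • a.rep) j * x.rep j = 0 := by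
  conv_lhs => rw [← a.mk_rep, ← x.mk_rep,
    Projectivization.orthogonal_mk a.rep_nonzero x.rep_nonzero]
  simp only [dotProduct, Pi.smul_apply, smul_eq_mul, mul_assoc, ← Finset.mul_sum]
  simp [hc]

/-- If a finite number of conditions hold generically, they hold for the lines of an open set. -/
theorem exists_isOpen_forall_exists_smul [Infinite K] (hm : 0 < m) {q : MvPolynomial (Fin m) K}
    (hq : q ≠ 0) : ∃ U : Set (PSpace K m), IsOpen U ∧ U.Nonempty ∧
      ∀ a ∈ U, ∃ c : K, c ≠ 0 ∧ eval (c • a.rep) q ≠ 0 := by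
  obtain ⟨e, he⟩ : ∃ e, homogeneousComponent e q ≠ 0 := by
    by_contra! h
    apply hq
    rw [← sum_homogeneousComponent q]
    exact Finset.sum_eq_zero fun e _ => h e
  have hhom := homogeneousComponent_isHomogeneous e q
  refine ⟨(zeroLocus {homogeneousComponent e q})ᶜ, ?_, ?_, ?_⟩
  · rw [isOpen_compl_iff, isClosed_iff_isAlgebraic]
    exact ⟨_, by rintro _ rfl; exact ⟨e, hhom⟩, rfl⟩
  · obtain ⟨v, hv⟩ := exists_forall_eval_ne_zero Finset.univ
      (![homogeneousComponent e q, X ⟨0, hm⟩] : Fin 2 → _) (by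
        intro i _
        fin_cases i
        · exact he
        · exact X_ne_zero _)
    have hv0 : v ≠ 0 := by
      rintro rfl
      simpa using hv 1 (Finset.mem_univ _)
    refine ⟨Projectivization.mk K v hv0, fun h => hv 0 (Finset.mem_univ _) ?_⟩
    exact (eval_rep_mk hhom v hv0).1 (h _ rfl)
  · intro a ha
    refine exists_smul_eval_ne_zero (e := e) fun h => ha ?_
    rintro _ rfl
    exact h

theorem lineRestriction_mul (f g : MvPolynomial (Fin 3 × Fin m ⊕ Fin 3) K)
    (A : Fin 3 × Fin m → K) (y : Fin 3 → K) :
    lineRestriction (f * g) A y = lineRestriction f A y * lineRestriction g A y := by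
  simp [lineRestriction]

theorem lineRestriction_add (f g : MvPolynomial (Fin 3 × Fin m ⊕ Fin 3) K)
    (A : Fin 3 × Fin m → K) (y : Fin 3 → K) :
    lineRestriction (f + g) A y = lineRestriction f A y + lineRestriction g A y := by
  simp [lineRestriction]

/-- As p divides f exactly once, p dividing the derivative of f would force it to divide its own
derivative. Restricted to a line, a polynomial of degree d > 0 would divide its nonzero derivative,
of smaller degree. -/
theorem not_dvd_pderiv_of_squarefree [CharZero K] {p f : MvPolynomial (Fin 3 × Fin m ⊕ Fin 3) K}
    {d : ℕ} (hp : Prime p) (hd : d ≠ 0) (hw : IsWeightedHomogeneous (planeWeight m) p d)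
    {A : Fin 3 × Fin m → K} (hA : eval (Sum.elim A (Pi.single 0 1)) p ≠ 0) (hpf : p ∣ f)
    (hf : Squarefree f) : ¬ p ∣ pderiv (Sum.inr 0) f := by
  intro h
  obtain ⟨g, rfl⟩ := hpf
  have hg : ¬ p ∣ g := fun ⟨g', hg'⟩ => hp.not_isUnit (hf p ⟨g', by rw [hg', mul_assoc]⟩)
  rw [Derivation.leibniz, smul_eq_mul, smul_eq_mul] at h
  have h1 := (dvd_add_right (dvd_mul_right p _)).1 h
  obtain ⟨q, hq⟩ := (hp.dvd_or_dvd h1).resolve_left hg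
  have hn := natDegree_lineRestriction hw A 0 hA
  have hder := derivative_lineRestriction p A 0
  rw [hq, lineRestriction_mul] at hder
  have hne : (lineRestriction p A 0).derivative ≠ 0 := fun h0 => by
    have := Polynomial.derivative_eq_zero.1 h0
    omega
  have h2 := Polynomial.natDegree_derivative_lt (p := lineRestriction p A 0) (by omega)
  have h3 := Polynomial.natDegree_le_of_dvd ⟨_, hder⟩ hne
  omega

/-- The eliminant c does not involve the variable along the line, so there it is a nonzero constant
combination of the restriction and its derivative. The restriction is therefore separable. -/
theorem card_roots_lineRestriction [DecidableEq K] [IsAlgClosed K]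
    {f : MvPolynomial (Fin 3 × Fin m ⊕ Fin 3) K}
    {d : ℕ} (hw : IsWeightedHomogeneous (planeWeight m) f d)
    {c : MvPolynomial {j : Fin 3 × Fin m ⊕ Fin 3 // j ≠ Sum.inr 0} K}
    {a b : MvPolynomial (Fin 3 × Fin m ⊕ Fin 3) K}
    (hc : a * f + b * pderiv (Sum.inr 0) f = rename Subtype.val c)
    {A : Fin 3 × Fin m → K} {y : Fin 3 → K}
    (hA : eval (Sum.elim A (Pi.single 0 1)) f ≠ 0)
    (hcA : eval (Sum.elim A y) (rename Subtype.val c) ≠ 0) :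
    (lineRestriction f A y).roots.toFinset.card = d := by
  classical
  have hL : lineRestriction (rename Subtype.val c) A y =
      Polynomial.C (eval (Sum.elim A y) (rename Subtype.val c)) :=
    Polynomial.funext fun s => by rw [eval_lineRestriction_rename, Polynomial.eval_C]
  have hsep : (lineRestriction f A y).Separable := by
    refine ⟨Polynomial.C (eval (Sum.elim A y) (rename Subtype.val c))⁻¹ * lineRestriction a A y,
      Polynomial.C (eval (Sum.elim A y) (rename Subtype.val c))⁻¹ * lineRestriction b A y, ?_⟩
    rw [derivative_lineRestriction, mul_assoc, mul_assoc, ← mul_add, ← lineRestriction_mul,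
      ← lineRestriction_mul, ← lineRestriction_add, hc, hL, ← Polynomial.C_mul,
      inv_mul_cancel₀ hcA, Polynomial.C_1]
  rw [Multiset.toFinset_card_of_nodup (Polynomial.nodup_roots hsep),
    ← natDegree_lineRestriction hw A y hA]
  exact (IsAlgClosed.splits (lineRestriction f A y)).natDegree_eq_card_roots.symm

theorem exists_mem_planeLocus_of_eval_eq_zero [IsAlgClosed K] [CharZero K]
    {f : MvPolynomial (Fin 3 × Fin m ⊕ Fin 3) K} (hf : f ≠ 0)
    (hgood : ∀ p ∈ UniqueFactorizationMonoid.factors f, ∃ d, IsCurveEquation p d)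
    {A : Fin 3 × Fin m → K} {y y₁ : Fin 3 → K}
    (hA : eval (Sum.elim A y₁) f ≠ 0) (hy : y ≠ 0)
    (h : eval (Sum.elim A y) f = 0) :
    ∃ x ∈ planeLocus f, ∃ c ≠ 0, ∀ i, mulV A x.rep i = c * y i := by
  obtain ⟨p, hp, hp0⟩ := exists_prime_dvd_map_eq_zero (eval (Sum.elim A y)) hf h
  obtain ⟨d, M, _, _, t, ξ, H⟩ := hgood p hp
  have hpf := UniqueFactorizationMonoid.dvd_of_mem_factors hp
  have hAp : eval (Sum.elim A y₁) p ≠ 0 := fun h0 => hA <| by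
    obtain ⟨q, rfl⟩ := hpf
    rw [map_mul, h0, zero_mul]
  obtain ⟨x, hx, c, hc, hxc⟩ := H.exists_specialization_eq hAp hy hp0
  exact ⟨x, planeLocus_subset_of_dvd hpf (H.specializations_subset hx), c, hc, hxc⟩

/-- Under the matrix `withLine w (y 1) (y 2) A` the hyperplane w is the preimage of the line through
(1, 0, 0) and y. Roots of the restriction are points of the plane curve on this line, and distinct
roots lift to distinct points of the section. -/
theorem le_encard_inter_hyperplane [DecidableEq K] [IsAlgClosed K] [CharZero K]
    {f : MvPolynomial (Fin 3 × Fin m ⊕ Fin 3) K} (hf : f ≠ 0)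
    (hgood : ∀ p ∈ UniqueFactorizationMonoid.factors f, ∃ d, IsCurveEquation p d)
    {w : Fin m → K} {A : Fin 3 × Fin m → K} {y : Fin 3 → K} (hy : y 2 ≠ 0)
    (hA : eval (Sum.elim (withLine w (y 1) (y 2) A) (Pi.single 0 1)) f ≠ 0) :
    ((lineRestriction f (withLine w (y 1) (y 2) A) y).roots.toFinset.card : ℕ∞) ≤
      (planeLocus f ∩ {x | ∑ j, w j * x.rep j = 0}).encard := by
  set R := (lineRestriction f (withLine w (y 1) (y 2) A) y).roots.toFinset
  have key : ∀ s ∈ R, ∃ x ∈ planeLocus f ∩ {x | ∑ j, w j * x.rep j = 0},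
      y 2 * mulV A x.rep 0 = s * mulV A x.rep 2 ∧ mulV A x.rep 2 ≠ 0 := by
    intro s hs
    have hs0 : eval (Sum.elim (withLine w (y 1) (y 2) A) (Function.update y 0 s)) f = 0 := by
      rw [← eval_lineRestriction]
      exact Polynomial.isRoot_of_mem_roots (Multiset.mem_toFinset.1 hs)
    obtain ⟨x, hx, c, hc, hxc⟩ := exists_mem_planeLocus_of_eval_eq_zero hf hgood hA
      (fun h => hy (by simpa using congrFun h 2)) hs0
    have h0 := hxc 0
    have h1 := hxc 1
    have h2 := hxc 2
    have h3 := mulV_withLine_one w x.rep (y 1) hy A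
    rw [mulV_withLine_zero] at h0
    rw [mulV_withLine_two] at h2
    simp only [Function.update_self, ne_eq, Fin.reduceEq, not_false_eq_true,
      Function.update_of_ne] at h0 h1 h2
    refine ⟨x, ⟨hx, ?_⟩, by rw [h0, h2]; ring, by rw [h2]; exact mul_ne_zero hc hy⟩
    rw [h1, h2] at h3
    change ∑ j, w j * x.rep j = 0
    linear_combination -h3
  rcases R.eq_empty_or_nonempty with hR | ⟨s₀, hs₀⟩
  · simp [hR]
  have : Nonempty (PSpace K m) := ⟨(key s₀ hs₀).choose⟩
  choose! x hx hx2 using key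
  have hinj : Set.InjOn x (R : Set K) := by
    intro s hs s' hs' h
    have h1 := (hx2 s hs).1
    have h2 := (hx2 s' hs').1
    rw [h] at h1
    exact mul_right_cancel₀ (hx2 s' hs').2 (h1.symm.trans h2)
  rw [← Set.encard_coe_eq_coe_finsetCard, ← hinj.encard_image]
  exact Set.encard_le_encard (by rintro _ ⟨s, hs, rfl⟩; exact hx s hs)

theorem exists_mulV_mul_ne {z z' : PSpace K m} (h : z ≠ z') :
    rowForm 0 z.rep * rowForm 2 z'.rep - rowForm 0 z'.rep * rowForm 2 z.rep ≠ 0 := by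
  intro h0
  refine h (eq_of_forall_mul_eq_mul fun i j => ?_)
  have := congrArg (eval (Sum.elim (fun p : Fin 3 × Fin m =>
    if p.1 = 0 then (if p.2 = i then 1 else 0) else (if p.2 = j then 1 else 0)) 0)) h0
  simp only [map_sub, map_mul, eval_rowForm, mulV, map_zero] at this
  simp at this
  linear_combination this

/-- Rows 0 and 2 are free once the hyperplane and the line are fixed. A general choice sends the
points of `T` to distinct points of the line, hence to distinct roots of a polynomial of degree d.
-/
theorem card_le_of_subset_inter_hyperplane [IsAlgClosed K]
    {f : MvPolynomial (Fin 3 × Fin m ⊕ Fin 3) K} {d : ℕ}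
    (hw : IsWeightedHomogeneous (planeWeight m) f d)
    {w : Fin m → K} {A : Fin 3 × Fin m → K} {y : Fin 3 → K} (hy : y 2 ≠ 0)
    (hA : eval (Sum.elim (withLine w (y 1) (y 2) A) (Pi.single 0 1)) f ≠ 0)
    (T : Finset (PSpace K m)) (hT : (T : Set (PSpace K m)) ⊆
      planeLocus f ∩ {x | ∑ j, w j * x.rep j = 0}) : T.card ≤ d := by
  classical
  let φ : MvPolynomial (Fin 3 × Fin m ⊕ Fin 3) K →ₐ[K] MvPolynomial (Fin 3 × Fin m ⊕ Fin 3) K :=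
    aeval (Sum.elim
      (fun p => if p.1 = 1 then C (y 2)⁻¹ * (C (w p.2) + C (y 1) * X (Sum.inl (2, p.2)))
      else X (Sum.inl p)) (fun i => C (y i)))
  have hφ : ∀ B z G, eval (Sum.elim B z) (φ G) =
      eval (Sum.elim (withLine w (y 1) (y 2) B) y) G := by
    intro B z G
    rw [eval_aeval]
    congr 2
    funext i
    rcases i with p | i
    · by_cases hp : p.1 = 1
      · simp [withLine, hp]; field_simp
      · simp [withLine, hp]
    · simp
  obtain ⟨B, z₀, hB⟩ := exists_forall_eval_ne_zero' (K := K) (m := m) (insert (φ (valueAtSingle f))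
      ((T.image fun z => rowForm 2 z.rep) ∪ T.offDiag.image fun z =>
        rowForm 0 z.1.rep * rowForm 2 z.2.rep - rowForm 0 z.2.rep * rowForm 2 z.1.rep)) id (by
    intro p hp
    simp only [Finset.mem_insert, Finset.mem_union, Finset.mem_image, Finset.mem_offDiag] at hp
    rcases hp with rfl | ⟨z, hz, rfl⟩ | ⟨z, hz, rfl⟩
    · intro h0
      apply hA
      have := congrArg (eval (Sum.elim A y)) h0
      rwa [id, hφ, eval_valueAtSingle, map_zero] at this
    · exact rowForm_ne_zero _ z.rep_nonzero
    · exact exists_mulV_mul_ne hz.2.2)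
  simp only [Finset.mem_insert, Finset.mem_union, Finset.mem_image, Finset.mem_offDiag, id] at hB
  have h1 := hB _ (Or.inl rfl)
  rw [hφ, eval_valueAtSingle] at h1
  have h2 : ∀ z ∈ T, mulV B z.rep 2 ≠ 0 := fun z hz => by
    have := hB _ (Or.inr (Or.inl ⟨z, hz, rfl⟩))
    rwa [eval_rowForm] at this
  have hdeg := natDegree_lineRestriction hw _ y h1
  -- A zero restriction is possible only for d = 0, where h(A, ·) is constant and equals its nonzero
  -- value at (1, 0, 0).
  have hL : lineRestriction f (withLine w (y 1) (y 2) B) y ≠ 0 := by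
    intro h0
    have h3 := natDegree_lineRestriction hw (withLine w (y 1) (y 2) B) 0 h1
    have h4 : ∀ s, _ := eval_lineRestriction f (withLine w (y 1) (y 2) B) y
    have hd0 : d = 0 := by rw [← hdeg, h0]; simp
    subst hd0
    apply h1
    have h5 := eval_smul_of_planeWeight hw (withLine w (y 1) (y 2) B) (Pi.single 0 1) 0
    have h6 := eval_smul_of_planeWeight hw (withLine w (y 1) (y 2) B) (Function.update y 0 0) 0
    rw [← h4, h0] at h6
    simp only [pow_zero, one_mul, zero_mul, Polynomial.eval_zero] at h5 h6
    rw [← h5, h6]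
  have hmaps : ∀ z ∈ T, y 2 * mulV B z.rep 0 / mulV B z.rep 2 ∈
      (lineRestriction f (withLine w (y 1) (y 2) B) y).roots.toFinset := by
    intro z hz
    rw [Multiset.mem_toFinset, Polynomial.mem_roots hL, Polynomial.IsRoot.def,
      eval_lineRestriction]
    have hz1 := (hT hz).1 (withLine w (y 1) (y 2) B)
    have hz2 : ∑ j, w j * z.rep j = 0 := (hT hz).2
    have h3 := mulV_withLine_one w z.rep (y 1) hy B
    rw [hz2, zero_add] at h3
    have hz3 : mulV (withLine w (y 1) (y 2) B) z.rep = fun i => mulV B z.rep 2 / y 2 *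
        Function.update y 0 (y 2 * mulV B z.rep 0 / mulV B z.rep 2) i := by
      have := h2 z hz
      funext i
      fin_cases i
      · simp [mulV_withLine_zero]; field_simp
      · simp only [Fin.mk_one, Fin.isValue, ne_eq, one_ne_zero, not_false_eq_true,
          Function.update_of_ne]
        field_simp
        linear_combination h3
      · simp [mulV_withLine_two]; field_simp
    rw [hz3, eval_smul_of_planeWeight hw] at hz1
    exact (mul_eq_zero.1 hz1).resolve_left (pow_ne_zero _ (div_ne_zero (h2 z hz) hy))
  have hinj : Set.InjOn (fun z : PSpace K m => y 2 * mulV B z.rep 0 / mulV B z.rep 2) T := by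
    intro z hz z' hz' h
    by_contra hne
    have h3 := hB _ (Or.inr (Or.inr ⟨(z, z'), ⟨hz, hz', hne⟩, rfl⟩))
    simp only [map_sub, map_mul, eval_rowForm] at h3
    apply h3
    have h4 := h2 z hz
    have h5 := h2 z' hz'
    simp only at h
    rw [div_eq_div_iff h4 h5] at h
    apply mul_left_cancel₀ hy
    linear_combination h
  calc T.card ≤ _ := Finset.card_le_card_of_injOn _ hmaps hinj
    _ ≤ _ := Multiset.toFinset_card_le _
    _ ≤ _ := Polynomial.card_roots' _
    _ = d := hdeg

theorem isCurveOfDegree_planeLocus [IsAlgClosed K] [CharZero K] (hm : 0 < m)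
    {f : MvPolynomial (Fin 3 × Fin m ⊕ Fin 3) K} {d : ℕ} (hf : f ≠ 0)
    (hw : IsWeightedHomogeneous (planeWeight m) f d) (hsq : Squarefree f)
    (hgood : ∀ p ∈ UniqueFactorizationMonoid.factors f, ∃ d, IsCurveEquation p d) :
    IsCurveOfDegree (planeLocus f) d := by
  classical
  refine ⟨isCurve_planeLocus hf hgood, ?_⟩
  obtain ⟨c, hc0, a, b, hc⟩ := exists_elimination (Sum.inr 0) hf
    (g := pderiv (Sum.inr 0) f) (by
      intro p hp hpf
      obtain ⟨q, hq, hpq⟩ :=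
        UniqueFactorizationMonoid.exists_mem_factors_of_dvd hf hp.irreducible hpf
      obtain ⟨e, M, _, _, t, ξ, H⟩ := hgood q hq
      obtain ⟨A, hA⟩ := H.exists_eval_single_ne_zero
      rw [hpq.dvd_iff_dvd_left]
      exact not_dvd_pderiv_of_squarefree H.prime H.degree_ne_zero H.weight hA
        (UniqueFactorizationMonoid.dvd_of_mem_factors hq) hsq)
  have hv : valueAtSingle f ≠ 0 := by
    intro h0
    obtain ⟨p, hp, hp0⟩ := exists_prime_dvd_map_eq_zero valueAtSingle.toRingHom hf h0
    obtain ⟨e, M, _, _, t, ξ, H⟩ := hgood p hp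
    obtain ⟨A, hA⟩ := H.exists_eval_single_ne_zero
    apply hA
    rw [← eval_valueAtSingle p A 0]
    exact (congrArg _ hp0).trans (map_zero _)
  have hc1 : rename Subtype.val c ≠ 0 := by
    rwa [ne_eq, map_eq_zero_iff _ (rename_injective _ Subtype.val_injective)]
  obtain ⟨A, y, hA⟩ := exists_forall_eval_ne_zero' Finset.univ
    (![rename Subtype.val c, valueAtSingle f, X (Sum.inr 2)] : Fin 3 → _) (by
      intro i _
      fin_cases i
      · exact hc1
      · exact hv
      · exact X_ne_zero _)
  have hA0 : eval (Sum.elim A y) (rename Subtype.val c) ≠ 0 := hA 0 (Finset.mem_univ _)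
  have hA1 : eval (Sum.elim A (Pi.single 0 1)) f ≠ 0 := by
    rw [← eval_valueAtSingle f A y]
    exact hA 1 (Finset.mem_univ _)
  have hy : y 2 ≠ 0 := by simpa using hA 2 (Finset.mem_univ _)
  let ψ : MvPolynomial (Fin 3 × Fin m ⊕ Fin 3) K →ₐ[K] MvPolynomial (Fin m) K :=
    aeval (Sum.elim (fun p => if p.1 = 1 then C (y 2)⁻¹ * (X p.2 + C (y 1 * A (2, p.2)))
      else C (A p)) (fun i => C (y i)))
  have hψ : ∀ w G, eval w (ψ G) = eval (Sum.elim (withLine w (y 1) (y 2) A) y) G := by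
    intro w G
    rw [eval_aeval]
    congr 2
    funext i
    rcases i with p | i
    · by_cases hp : p.1 = 1
      · simp [withLine, hp]; field_simp
      · simp [withLine, hp]
    · simp
  -- The hyperplane y 2 · r₁ - y 1 · r₂ formed from the rows of A reproduces A under `withLine`, and
  -- there neither factor vanishes.
  have hq : ψ (rename Subtype.val c * valueAtSingle f) ≠ 0 := by
    intro h0
    have h1 := congrArg (eval (fun j => y 2 * A (1, j) - y 1 * A (2, j))) h0
    have h2 : withLine (fun j => y 2 * A (1, j) - y 1 * A (2, j)) (y 1) (y 2) A = A := by
      funext ⟨i, j⟩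
      by_cases hi : i = 1
      · simp only [withLine, hi, if_true]
        field_simp
        ring
      · simp [withLine, hi]
    rw [hψ, h2, map_mul, eval_valueAtSingle, map_zero] at h1
    exact mul_ne_zero hA0 hA1 h1
  obtain ⟨U, hU, hU0, hUa⟩ := exists_isOpen_forall_exists_smul hm hq
  refine ⟨U, hU, hU0, fun x hx => ?_⟩
  obtain ⟨s, hs, hsx⟩ := hUa x hx
  rw [hψ, map_mul, eval_valueAtSingle] at hsx
  have hs0 := left_ne_zero_of_mul hsx
  have hs1 := right_ne_zero_of_mul hsx
  have hset : hyperplane x = {z | ∑ j, (s • x.rep) j * z.rep j = 0} := by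
    ext z
    exact orthogonal_iff x z s hs
  rw [hset]
  refine le_antisymm ?_ ?_
  · by_contra! hlt
    obtain ⟨T, hT, hTc⟩ := Set.exists_subset_encard_eq (k := ((d + 1 : ℕ) : ℕ∞))
      (Order.add_one_le_of_lt hlt)
    have hfin : T.Finite := Set.finite_of_encard_eq_coe hTc
    have := card_le_of_subset_inter_hyperplane hw hy hs1 hfin.toFinset (by simpa using hT)
    rw [hfin.encard_eq_coe_toFinset_card] at hTc
    have := Nat.cast_injective (R := ℕ∞) hTc
    omega
  · rw [← card_roots_lineRestriction hw hc hs1 hs0]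
    exact le_encard_inter_hyperplane hf hgood hy hs1

end

/-! ### Bézout's inequality for plane curves -/

section

variable {F : Type*} [Field F]

theorem finrank_homogeneousSubmodule_three (k : ℕ) :
    Module.Finite F (homogeneousSubmodule (Fin 3) F k) ∧
    Module.finrank F (homogeneousSubmodule (Fin 3) F k) = (k + 2).choose 2 := by
  classical
  have hset : {d : Fin 3 →₀ ℕ | d.degree = k} =
      ((Finset.univ : Finset (Fin 3)).finsuppAntidiag k : Set (Fin 3 →₀ ℕ)) := by
    ext d
    simp [Finset.mem_finsuppAntidiag, Finsupp.degree_eq_sum]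
  have e := (LinearEquiv.ofEq _ _ ((homogeneousSubmodule_eq_finsupp_supported (Fin 3) F k).trans
    (by rw [hset]))).trans (AddMonoidAlgebra.supportedEquivFinsupp (R := F) (S := F)
      ((Finset.univ : Finset (Fin 3)).finsuppAntidiag k : Set (Fin 3 →₀ ℕ)))
  refine ⟨Module.Finite.equiv e.symm, ?_⟩
  rw [e.finrank_eq, Module.finrank_finsupp_self]
  simp only [Finset.coe_sort_coe, Fintype.card_coe]
  rw [Finset.card_finsuppAntidiag_nat_eq_choose]
  simp only [Finset.card_univ, Fintype.card_fin]
  rw [show 3 + k - 1 = k + 2 by omega, Nat.choose_symm_add]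

/-- The linear form that vanishes at `q` and is nonzero at `p` if `p i * q k ≠ p k * q i`. -/
theorem exists_isHomogeneous_eval_eq_zero {p q : Fin 3 → F} {i k : Fin 3}
    (h : p i * q k ≠ p k * q i) : ∃ ℓ : MvPolynomial (Fin 3) F, ℓ.IsHomogeneous 1 ∧
      eval q ℓ = 0 ∧ eval p ℓ ≠ 0 := by
  refine ⟨C (q k) * X i - C (q i) * X k, ?_, ?_, ?_⟩
  · refine IsHomogeneous.sub ?_ ?_ <;>
    · simpa using (isHomogeneous_C _ _).mul (isHomogeneous_X F _)
  · simp; ring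
  · simp only [map_sub, map_mul, eval_C, eval_X]
    intro h0
    apply h
    linear_combination h0

/-- A product of lines through the points of `T` that miss p, padded by a power of the coordinate X
i to reach the degree n. -/
theorem exists_isHomogeneous_separating (T : Finset (Fin 3 → F)) {p : Fin 3 → F} {i k : Fin 3}
    (hp : p i ≠ 0) (hT : ∀ q ∈ T, p i * q k ≠ p k * q i) (n : ℕ) (hn : T.card ≤ n) :
    ∃ G : MvPolynomial (Fin 3) F, G.IsHomogeneous n ∧ eval p G ≠ 0 ∧ ∀ q ∈ T, eval q G = 0 := by
  choose! ℓ h1 h2 h3 using fun q (hq : q ∈ T) => exists_isHomogeneous_eval_eq_zero (hT q hq)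
  refine ⟨(∏ q ∈ T, ℓ q) * X i ^ (n - T.card), ?_, ?_, ?_⟩
  · have := (IsHomogeneous.prod T ℓ (fun _ => 1) h1).mul ((isHomogeneous_X F i).pow (n - T.card))
    simpa [Nat.add_sub_cancel' hn] using this
  · rw [map_mul, map_prod, map_pow, eval_X]
    exact mul_ne_zero (Finset.prod_ne_zero_iff.2 h3) (pow_ne_zero _ hp)
  · intro q hq
    rw [map_mul, map_prod, Finset.prod_eq_zero hq (h2 q hq), zero_mul]

/-- This is the Hilbert function of a complete intersection of type (d, e), which equals d e in
degree d + e + r. -/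
theorem choose_two_identity (d e r : ℕ) : (d + e + r + 2).choose 2 + (r + 2).choose 2 =
    (e + r + 2).choose 2 + (d + r + 2).choose 2 + d * e := by
  have h : ∀ n : ℕ, (n + 2).choose 2 * 2 = (n + 2) * (n + 1) := fun n => by
    have := Nat.choose_two_right (n + 2)
    rw [this]
    exact Nat.div_mul_cancel (by
      have := (Nat.even_mul_succ_self (n + 1)).two_dvd
      rwa [mul_comm] at this)
  have h1 := h (d + e + r)
  have h2 := h r
  have h3 := h (e + r)
  have h4 := h (d + r)
  nlinarith

/-- Bézout's inequality for two plane curves without a common component. -/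
theorem card_le_mul_of_ternary {h N : MvPolynomial (Fin 3) F} {d e : ℕ} (hd : h.IsHomogeneous d)
    (he : N.IsHomogeneous e) (h0 : h ≠ 0)
    (hcop : ∀ u v, u * h + v * N = 0 → h ∣ v) (T : Finset (Fin 3 → F)) {i k : Fin 3}
    (hTi : ∀ p ∈ T, p i ≠ 0) (hT : ∀ p ∈ T, ∀ q ∈ T, p ≠ q → p i * q k ≠ p k * q i)
    (hTh : ∀ p ∈ T, eval p h = 0) (hTN : ∀ p ∈ T, eval p N = 0) : T.card ≤ d * e := by
  classical
  set r := T.card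
  obtain ⟨_, f0⟩ := finrank_homogeneousSubmodule_three (F := F) r
  obtain ⟨_, f1⟩ := finrank_homogeneousSubmodule_three (F := F) (e + r)
  obtain ⟨_, f2⟩ := finrank_homogeneousSubmodule_three (F := F) (d + r)
  obtain ⟨_, f3⟩ := finrank_homogeneousSubmodule_three (F := F) (d + e + r)
  -- Koszul complex in degree d + e + r: L has the multiples of h and N as its image, and W
  -- parametrizes its syzygies. The image of L has codimension at most d e and lies in the kernel of
  -- evaluation at T. The shift r = |T| makes that evaluation surjective, so |T| ≤ d e.
  let L : homogeneousSubmodule (Fin 3) F (e + r) × homogeneousSubmodule (Fin 3) F (d + r) →ₗ[F]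
      homogeneousSubmodule (Fin 3) F (d + e + r) :=
    { toFun := fun u => ⟨u.1.1 * h + u.2.1 * N, by
        have h1 := IsHomogeneous.mul u.1.2 hd
        have h2 := IsHomogeneous.mul u.2.2 he
        rw [show e + r + d = d + e + r by ring] at h1
        rw [show d + r + e = d + e + r by ring] at h2
        exact h1.add h2⟩
      map_add' := fun u v => Subtype.ext (by simp; ring)
      map_smul' := fun c u => Subtype.ext (by simp [smul_add]) }
  let W : homogeneousSubmodule (Fin 3) F r →ₗ[F]
      homogeneousSubmodule (Fin 3) F (e + r) × homogeneousSubmodule (Fin 3) F (d + r) :=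
    { toFun := fun w => (⟨-(w.1 * N), by
          have h1 := IsHomogeneous.mul w.2 he
          rw [show r + e = e + r by ring] at h1
          exact h1.neg⟩, ⟨w.1 * h, by
          have h1 := IsHomogeneous.mul w.2 hd
          rw [show r + d = d + r by ring] at h1
          exact h1⟩)
      map_add' := fun u v => Prod.ext (Subtype.ext (by simp; ring)) (Subtype.ext (by simp; ring))
      map_smul' := fun c u => Prod.ext (Subtype.ext (by simp)) (Subtype.ext (by simp)) }
  let E : homogeneousSubmodule (Fin 3) F (d + e + r) →ₗ[F] (T → F) :=
    { toFun := fun G p => eval p.1 G.1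
      map_add' := fun u v => by ext; simp
      map_smul' := fun c u => by ext; simp [smul_eval] }
  have hker : LinearMap.ker L ≤ LinearMap.range W := by
    rintro ⟨⟨u, hu⟩, ⟨v, hv⟩⟩ huv
    have huv : u * h + v * N = 0 := congrArg Subtype.val (LinearMap.mem_ker.1 huv)
    obtain ⟨w, hw⟩ := hcop u v huv
    by_cases hv0 : v = 0
    · refine ⟨0, ?_⟩
      have hu0 : u = 0 := by
        rw [hv0, zero_mul, add_zero] at huv
        exact (mul_eq_zero.1 huv).resolve_right h0
      subst hv0 hu0
      exact map_zero W
    have hw' : w.IsHomogeneous r := by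
      have h1 : IsWeightedHomogeneous 1 (h * w) (d + r) := hw ▸ hv
      obtain ⟨a, b, hab, ha, hb⟩ := MvPolynomial.IsWeightedHomogeneous.of_mul 1 (hw ▸ hv0) h1
      have : a = d := ha.inj_right h0 hd
      have : b = r := by omega
      exact this ▸ hb
    refine ⟨⟨w, hw'⟩, Prod.ext (Subtype.ext ?_) (Subtype.ext ?_)⟩
    · change -(w * N) = u
      have : h * (u + w * N) = 0 := by rw [hw] at huv; linear_combination huv
      linear_combination -(mul_eq_zero.1 this).resolve_left h0
    · change w * h = v
      rw [hw, mul_comm]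
  have hsurj : Function.Surjective E := by
    intro g
    have : ∀ p : T, ∃ G : MvPolynomial (Fin 3) F, G.IsHomogeneous (d + e + r) ∧
        eval p.1 G ≠ 0 ∧ ∀ q ∈ T.erase p.1, eval q G = 0 := fun p =>
      exists_isHomogeneous_separating (T.erase p.1) (hTi p.1 p.2) (fun q hq =>
        hT p.1 p.2 q (Finset.mem_of_mem_erase hq) (Finset.ne_of_mem_erase hq).symm) _ (by
          have := Finset.card_le_card (Finset.erase_subset p.1 T)
          omega)
    choose G hG1 hG2 hG3 using this
    refine ⟨∑ p : T, (g p / eval p.1 (G p)) • (⟨G p, hG1 p⟩ :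
      homogeneousSubmodule (Fin 3) F (d + e + r)), ?_⟩
    funext q
    rw [map_sum, Finset.sum_apply, Finset.sum_eq_single q]
    · change eval q.1 ((g q / eval q.1 (G q)) • G q) = g q
      rw [smul_eval, div_mul_cancel₀ _ (hG2 q)]
    · intro p _ hpq
      change eval q.1 ((g p / eval p.1 (G p)) • G p) = 0
      rw [smul_eval, hG3 p q.1 (Finset.mem_erase.2 ⟨fun h => hpq (Subtype.ext h.symm), q.2⟩),
        mul_zero]
    · simp
  have hle : LinearMap.range L ≤ LinearMap.ker E := by
    rintro _ ⟨u, rfl⟩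
    rw [LinearMap.mem_ker]
    funext p
    change eval p.1 (u.1.1 * h + u.2.1 * N) = 0
    rw [map_add, map_mul, map_mul, hTh _ p.2, hTN _ p.2, mul_zero, mul_zero, add_zero]
  have r1 := L.finrank_range_add_finrank_ker
  have r2 := E.finrank_range_add_finrank_ker
  have r3 := Submodule.finrank_mono hker
  have r4 := LinearMap.finrank_range_le W
  have r5 := Submodule.finrank_mono hle
  rw [LinearMap.range_eq_top.2 hsurj, finrank_top, Module.finrank_fintype_fun_eq_card,
    Fintype.card_coe] at r2
  rw [Module.finrank_prod] at r1
  have := choose_two_identity d e r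
  omega

end

/-! ### Plane equations over the field K(t) -/

section

variable {K : Type u} [Field K] {m : ℕ}

/-- A plane equation `h(t, y)` as a ternary polynomial over the field `K(t)`. -/
noncomputable def genericForm : MvPolynomial (Fin 3 × Fin m ⊕ Fin 3) K →ₐ[K]
    MvPolynomial (Fin 3) (FractionRing (MvPolynomial (Fin 3 × Fin m) K)) :=
  aeval (Sum.elim (fun p => C (algebraMap (MvPolynomial (Fin 3 × Fin m) K) _ (X p))) X)

theorem genericForm_rename_inl (s : MvPolynomial (Fin 3 × Fin m) K) :
    genericForm (rename Sum.inl s) = C (algebraMap _ _ s) := by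
  induction s using MvPolynomial.induction_on with
  | C a =>
    rw [rename_C, ← algebraMap_eq, AlgHom.commutes]
    rfl
  | add p q hp hq => simp [hp, hq]
  | mul_X p i hp =>
    rw [map_mul, map_mul, hp, rename_X, map_mul, C_mul]
    simp [genericForm]

theorem genericForm_injective : Function.Injective (genericForm (K := K) (m := m)) := by
  have h : genericForm (K := K) (m := m) = ((mapAlgHom (Algebra.ofId
      (MvPolynomial (Fin 3 × Fin m) K)
      (FractionRing (MvPolynomial (Fin 3 × Fin m) K)))).restrictScalars
      K).comp ((sumAlgEquiv K (Fin 3) (Fin 3 × Fin m)).toAlgHom.comp (rename Sum.swap)) := by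
    apply MvPolynomial.algHom_ext
    rintro (p | i)
    · simp [genericForm]
    · simp [genericForm]
  rw [h]
  exact (map_injective _ (IsFractionRing.injective _ _)).comp
    ((AlgEquiv.injective (sumAlgEquiv K (Fin 3) (Fin 3 × Fin m))).comp
      (rename_injective _ Sum.swap_leftInverse.injective))

theorem isHomogeneous_genericForm {h : MvPolynomial (Fin 3 × Fin m ⊕ Fin 3) K} {d : ℕ}
    (hh : IsWeightedHomogeneous (planeWeight m) h d) : (genericForm h).IsHomogeneous d := by
  induction hh using IsWeightedHomogeneous.induction_on with
  | zero => rw [map_zero]; exact isHomogeneous_zero _ _ _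
  | add p q _ _ hp hq => rw [map_add]; exact hp.add hq
  | monomial e r hr =>
    rw [genericForm, aeval_monomial]
    subst hr
    rw [← zero_add (Finsupp.weight _ e), Finsupp.weight_apply,
      MvPolynomial.algebraMap_apply]
    refine (isHomogeneous_C _ _).mul (IsHomogeneous.prod _ _ _ fun j _ => ?_)
    rcases j with p | i
    · simp only [Sum.elim_inl, planeWeight, Pi.zero_apply, smul_zero]
      rw [← C_pow]
      exact isHomogeneous_C _ _
    · simp only [Sum.elim_inr, planeWeight, Pi.one_apply]
      simpa using (isHomogeneous_X _ i).pow (e (Sum.inr i))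

theorem exists_genericForm_eq_mul
    (v : MvPolynomial (Fin 3) (FractionRing (MvPolynomial (Fin 3 × Fin m) K))) :
    ∃ s : MvPolynomial (Fin 3 × Fin m) K, s ≠ 0 ∧
      ∃ v', genericForm v' = C (algebraMap _ _ s) * v := by
  induction v using MvPolynomial.induction_on with
  | C a =>
    obtain ⟨r, s, hs, rfl⟩ := IsFractionRing.div_surjective (A := MvPolynomial (Fin 3 × Fin m) K) a
    have hs0 := nonZeroDivisors.ne_zero hs
    refine ⟨s, hs0, rename Sum.inl r, ?_⟩
    rw [genericForm_rename_inl, ← C_mul, mul_div_cancel₀]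
    rwa [ne_eq, map_eq_zero_iff _ (IsFractionRing.injective _ _)]
  | add p q hp hq =>
    obtain ⟨s, hs, v, hv⟩ := hp
    obtain ⟨s', hs', v', hv'⟩ := hq
    refine ⟨s * s', mul_ne_zero hs hs', rename Sum.inl s' * v + rename Sum.inl s * v', ?_⟩
    simp only [map_add, map_mul, genericForm_rename_inl, hv, hv']
    ring
  | mul_X p i hp =>
    obtain ⟨s, hs, v, hv⟩ := hp
    refine ⟨s, hs, v * X (Sum.inr i), ?_⟩
    rw [map_mul, hv, ← mul_assoc]
    simp [genericForm]

theorem eval_genericForm (x : Fin m → K) (h : MvPolynomial (Fin 3 × Fin m ⊕ Fin 3) K) :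
    eval (fun i => algebraMap (MvPolynomial (Fin 3 × Fin m) K) _ (∑ j, C (x j) * X (i, j)))
      (genericForm h) = algebraMap _ _ (planeSubst x h) := by
  induction h using MvPolynomial.induction_on with
  | C a =>
    have h1 := AlgHom.commutes (genericForm (K := K) (m := m)) a
    have h2 := AlgHom.commutes (planeSubst x) a
    rw [algebraMap_eq] at h1 h2
    rw [h1, h2]
    exact eval_C _
  | add p q hp hq => rw [map_add, map_add, hp, hq, map_add, map_add]
  | mul_X p i hp =>
    rw [map_mul, map_mul, hp, map_mul, map_mul]
    congr 1
    rcases i with p | i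
    · simp [genericForm, planeSubst]
    · simp [genericForm, planeSubst, mul_comm]

/-- Bézout over K(t), applied to the points t x, which are already distinguished by their first two
coordinates. Clearing denominators shows that the prime h still has no common factor with N over
K(t). -/
theorem card_le_mul_of_not_dvd [Infinite K] {h N : MvPolynomial (Fin 3 × Fin m ⊕ Fin 3) K}
    {d e : ℕ}
    (hh : IsWeightedHomogeneous (planeWeight m) h d)
    (hN : IsWeightedHomogeneous (planeWeight m) N e)
    (hp : Prime h) (hhN : ¬ h ∣ N) (T : Finset (PSpace K m))
    (hTh : ∀ x ∈ T, planeSubst x.rep h = 0) (hTN : ∀ x ∈ T, planeSubst x.rep N = 0) :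
    T.card ≤ d * e := by
  classical
  let v : PSpace K m → Fin 3 → FractionRing (MvPolynomial (Fin 3 × Fin m) K) := fun x i =>
    algebraMap (MvPolynomial (Fin 3 × Fin m) K) _ (∑ j, C (x.rep j) * X (i, j))
  have hinj := IsFractionRing.injective (MvPolynomial (Fin 3 × Fin m) K)
    (FractionRing (MvPolynomial (Fin 3 × Fin m) K))
  have hv : ∀ x z, x ≠ z → v x 0 * v z 1 ≠ v x 1 * v z 0 := by
    intro x z hxz hv
    simp only [v, ← map_mul] at hv
    have h1 := hinj hv
    refine hxz (eq_of_forall_mul_eq_mul fun i j => ?_)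
    have := congrArg (eval (fun p : Fin 3 × Fin m =>
      if p.1 = 0 then (if p.2 = i then (1 : K) else 0) else (if p.2 = j then 1 else 0))) h1
    simpa using this
  have hv0 : ∀ x, v x 0 ≠ 0 := by
    intro x hx
    have h1 := hinj (hx.trans (map_zero _).symm)
    apply x.rep_nonzero
    funext i
    have := congrArg (eval (fun p : Fin 3 × Fin m => if p.2 = i then (1 : K) else 0)) h1
    simpa using this
  have hvinj : Function.Injective v := fun x z hxz => by
    by_contra hne
    apply hv x z hne
    rw [hxz, mul_comm]
  rw [← Finset.card_image_of_injective T hvinj]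
  refine card_le_mul_of_ternary (isHomogeneous_genericForm hh) (isHomogeneous_genericForm hN)
    (fun h0 => hp.ne_zero (genericForm_injective (h0.trans (map_zero _).symm)))
    ?_ _ (i := 0) (k := 1)
    ?_ ?_ ?_ ?_
  · intro u w huw
    obtain ⟨s, hs, u', hu'⟩ := exists_genericForm_eq_mul u
    obtain ⟨s', hs', w', hw'⟩ := exists_genericForm_eq_mul w
    have h1 : rename Sum.inl s' * u' * h + rename Sum.inl s * w' * N = 0 := by
      apply genericForm_injective
      simp only [map_add, map_mul, genericForm_rename_inl, hu', hw', map_zero]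
      linear_combination C (algebraMap _ _ s) * C (algebraMap _ _ s') * huw
    have h2 : h ∣ rename Sum.inl s * w' * N := ⟨-(rename Sum.inl s' * u'), by linear_combination h1⟩
    have h3 := (hp.dvd_or_dvd h2).resolve_right hhN
    obtain ⟨q, hq⟩ := h3
    have hss : algebraMap (MvPolynomial (Fin 3 × Fin m) K)
        (FractionRing (MvPolynomial (Fin 3 × Fin m) K)) (s * s') ≠ 0 := by
      rw [ne_eq, map_eq_zero_iff _ hinj]
      exact mul_ne_zero hs hs'
    refine ⟨C (algebraMap _ _ (s * s'))⁻¹ * genericForm q, ?_⟩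
    have h4 := congrArg genericForm hq
    simp only [map_mul, genericForm_rename_inl, hw'] at h4
    rw [mul_left_comm, ← h4, ← mul_assoc (C (algebraMap _ _ s)), ← C_mul, ← map_mul, ← mul_assoc,
      ← C_mul, inv_mul_cancel₀ hss, C_1, one_mul]
  · simp only [Finset.mem_image]
    rintro _ ⟨x, -, rfl⟩
    exact hv0 x
  · simp only [Finset.mem_image]
    rintro _ ⟨x, -, rfl⟩ _ ⟨z, -, rfl⟩ hne
    exact hv x z fun h => hne (by rw [h])
  · simp only [Finset.mem_image]
    rintro _ ⟨x, hx, rfl⟩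
    exact (eval_genericForm x.rep h).trans (by rw [hTh x hx, map_zero])
  · simp only [Finset.mem_image]
    rintro _ ⟨x, hx, rfl⟩
    exact (eval_genericForm x.rep N).trans (by rw [hTN x hx, map_zero])

/-- The chain rule for y = t x. For h vanishing at (t, t x) it expresses x_j as -h_{t_ij} / h_{y_i},
which is the source of all the differential conditions. -/
theorem planeSubst_pderiv (x : Fin m → K) (i : Fin 3) (j : Fin m)
    (G : MvPolynomial (Fin 3 × Fin m ⊕ Fin 3) K) :
    pderiv (i, j) (planeSubst x G) =
      planeSubst x (pderiv (Sum.inl (i, j)) G) + C (x j) * planeSubst x (pderiv (Sum.inr i) G) := by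
  classical
  induction G using MvPolynomial.induction_on with
  | C a => simp [planeSubst, algebraMap_eq]
  | add p q hp hq =>
    simp only [map_add, hp, hq]
    ring
  | mul_X p k hp =>
    simp only [map_mul, pderiv_mul, map_add, hp]
    rcases k with ⟨a, b⟩ | k
    · have : planeSubst x (X (Sum.inl (a, b))) = X (a, b) := by simp [planeSubst]
      rw [this]
      simp only [pderiv_X, Pi.single_apply, Sum.inl.injEq, reduceCtorEq, if_false, map_zero,
        mul_zero, add_zero]
      split_ifs <;> simp <;> ring
    · have : planeSubst x (X (Sum.inr k)) = ∑ b, C (x b) * X (k, b) := by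
        simp [planeSubst, mul_comm]
      rw [this]
      have h2 : pderiv (i, j) (∑ b, C (x b) * X (k, b) : MvPolynomial (Fin 3 × Fin m) K) =
          if k = i then C (x j) else 0 := by
        simp only [map_sum, pderiv_C_mul, pderiv_X, Pi.single_apply, Prod.mk.injEq]
        by_cases hk : k = i <;> simp [hk]
      rw [h2]
      simp only [pderiv_X, Pi.single_apply, Sum.inr.injEq, reduceCtorEq, if_false, map_zero,
        mul_zero, add_zero]
      split_ifs <;> simp <;> ring

end

/-! ### Dependence over K and independence of the generic matrix -/

section

/-- Each element of M is a quotient of elements of the image of φ, so that image contains a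
transcendence basis of M, and `H` bounds its size. -/
theorem not_algebraicIndependent_of_forall_mul_eq {K σ M ι : Type u} [Field K]
    [Fintype ι] [Field M] [Algebra K M] (φ : MvPolynomial σ K →ₐ[K] M)
    (hφ : ∀ a : M, ∃ u v, φ v ≠ 0 ∧ a * φ v = φ u)
    (H : ∀ y : Fin (Fintype.card ι) → MvPolynomial σ K, ¬ AlgebraicIndependent K (φ ∘ y))
    (x : ι → M) : ¬ AlgebraicIndependent K x := by
  intro hx
  have halg : Algebra.IsAlgebraic (Algebra.adjoin K (Set.range φ)) M := by
    refine ⟨fun a => ?_⟩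
    obtain ⟨u, v, hv, huv⟩ := hφ a
    let u' : Algebra.adjoin K (Set.range φ) := ⟨φ u, Algebra.subset_adjoin ⟨u, rfl⟩⟩
    let v' : Algebra.adjoin K (Set.range φ) := ⟨φ v, Algebra.subset_adjoin ⟨v, rfl⟩⟩
    refine ⟨Polynomial.C v' * Polynomial.X - Polynomial.C u', fun h0 => ?_, ?_⟩
    · have := congrArg (fun p => Polynomial.coeff p 1) h0
      simp [Polynomial.coeff_C] at this
      exact hv (congrArg Subtype.val this)
    · simp only [map_sub, map_mul, Polynomial.aeval_C, Polynomial.aeval_X]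
      change φ v * a - φ u = 0
      rw [← huv]
      ring
  obtain ⟨s, hs, hbasis⟩ := exists_isTranscendenceBasis_subset (R := K) (Set.range φ)
  have h1 : Cardinal.mk (ULift.{u} (Fin (Fintype.card ι))) ≤ Cardinal.mk s := by
    rw [hbasis.cardinalMk_eq_trdeg]
    refine le_trans ?_ hx.cardinalMk_le_trdeg
    rw [Cardinal.mk_uLift, Cardinal.mk_fin, Cardinal.mk_fintype, Cardinal.lift_natCast]
  obtain ⟨e⟩ := h1
  choose y hy using fun i => hs (e i).2
  refine H (fun i => y ⟨i⟩) ?_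
  have := hbasis.1.comp (fun i => e ⟨i⟩) (e.injective.comp ULift.up_injective)
  convert this using 1
  funext i
  exact hy ⟨i⟩

variable {K M : Type u} [Field K] {m : ℕ} [Field M] [Algebra K M]

/-- The transcendence degree of M is less than 3m + n by `H`. The 3m entries of t are independent
over K[ξ], so n elements of K[ξ] cannot be independent. -/
theorem exists_dependence {n : ℕ} {t : Fin 3 × Fin m → M} {ξ : Fin m → M}
    (H : ∀ y : Fin (3 * m + n) → MvPolynomial (Fin 3 × Fin m ⊕ Fin 3) K,
      ¬ AlgebraicIndependent K (aeval (Sum.elim t (mulV t ξ)) ∘ y))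
    (hφ : ∀ a : M, ∃ u v : MvPolynomial (Fin 3 × Fin m ⊕ Fin 3) K,
      aeval (Sum.elim t (mulV t ξ)) v ≠ 0 ∧
      a * aeval (Sum.elim t (mulV t ξ)) v = aeval (Sum.elim t (mulV t ξ)) u)
    (indep : ∀ P : MvPolynomial (Fin 3 × Fin m) (MvPolynomial (Fin m) K),
      eval₂ (aeval ξ : MvPolynomial (Fin m) K →ₐ[K] M).toRingHom t P = 0 →
        ∀ e, aeval ξ (coeff e P) = 0) (g : Fin n → MvPolynomial (Fin m) K) :
    ∃ P : MvPolynomial (Fin n) K, P ≠ 0 ∧ aeval (fun i => aeval ξ (g i)) P = 0 := by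
  by_contra! hcon
  have hx : AlgebraicIndependent K (fun i : ULift.{u} (Fin 3 × Fin m ⊕ Fin n) =>
      (Sum.elim t (fun i => aeval ξ (g i)) i.down : M)) := by
    have : AlgebraicIndependent K (Sum.elim t (fun i => aeval ξ (g i))) := by
      rw [algebraicIndependent_iff]
      intro Q hQ
      let Q' := sumAlgEquiv K (Fin 3 × Fin m) (Fin n) Q
      have key : ∀ R, eval₂ (aeval ξ : MvPolynomial (Fin m) K →ₐ[K] M).toRingHom t
          (map (aeval g : MvPolynomial (Fin n) K →ₐ[K] _).toRingHom
            (sumAlgEquiv K (Fin 3 × Fin m) (Fin n) R)) =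
          aeval (Sum.elim t (fun i => aeval ξ (g i))) R := by
        intro R
        induction R using MvPolynomial.induction_on with
        | C a =>
          rw [sumAlgEquiv_C_inl, map_C, eval₂_C, aeval_C]
          simp
        | add p q hp hq => simp only [map_add, eval₂_add, hp, hq]
        | mul_X p i hp =>
          simp only [map_mul, eval₂_mul, hp]
          rcases i with i | i <;> simp
      have h1 := indep _ ((key Q).trans hQ)
      have h2 : Q' = 0 := by
        ext1 e
        by_contra h0
        refine hcon (coeff e Q') h0 ?_
        have := h1 e
        rw [coeff_map] at this
        change aeval ξ (aeval g (coeff e Q')) = 0 at this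
        rw [← this]
        generalize coeff e Q' = R
        induction R using MvPolynomial.induction_on with
        | C a => simp
        | add p q hp hq => simp only [map_add, hp, hq]
        | mul_X p i hp => simp only [map_mul, hp, aeval_X]
      exact (map_eq_zero_iff _ (AlgEquiv.injective _)).1 h2
    exact this.comp _ ULift.down_injective
  refine not_algebraicIndependent_of_forall_mul_eq
    (σ := ULift.{u} (Fin 3 × Fin m ⊕ Fin 3))
    ((aeval (Sum.elim t (mulV t ξ))).comp (rename ULift.down)) (fun a => ?_) (fun y hy => ?_) _ hx
  · obtain ⟨u, v, hv, huv⟩ := hφ a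
    refine ⟨rename ULift.up u, rename ULift.up v, ?_⟩
    simp only [AlgHom.comp_apply, rename_rename, Function.comp_def]
    simpa [← Function.id_def, rename_id] using ⟨hv, huv⟩
  · have hcard : 3 * m + n = Fintype.card (ULift.{u} (Fin 3 × Fin m ⊕ Fin n)) := by simp
    refine H (fun i => rename ULift.down (y (Fin.cast hcard i))) ?_
    exact hy.comp (Fin.cast hcard) (Fin.cast_injective hcard)

/-- If the translations `t ↦ t + ε` extend to homomorphisms to the dual numbers that fix `ξ`, then
the entries of `t` are algebraically independent over `K[ξ]`. -/
theorem aeval_coeff_eq_zero_of_dualNumber [CharZero M] {t : Fin 3 × Fin m → M} {ξ : Fin m → M}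
    (H : ∀ p, ∃ f : M →ₐ[K] DualNumber M, (∀ l, f (ξ l) = TrivSqZeroExt.inl (ξ l)) ∧
      ∀ q, f (t q) = TrivSqZeroExt.inl (t q) + TrivSqZeroExt.inr (Pi.single p 1 q))
    (P : MvPolynomial (Fin 3 × Fin m) (MvPolynomial (Fin m) K))
    (hP : eval₂ (aeval ξ : MvPolynomial (Fin m) K →ₐ[K] M).toRingHom t P = 0)
    (e : Fin 3 × Fin m →₀ ℕ) : aeval ξ (coeff e P) = 0 := by
  classical
  set φ : MvPolynomial (Fin m) K →+* M := (aeval ξ : MvPolynomial (Fin m) K →ₐ[K] M).toRingHom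
  have hder : ∀ p Q, eval₂ φ t Q = 0 → eval₂ φ t (pderiv p Q) = 0 := by
    intro p Q hQ
    obtain ⟨f, hf, hft⟩ := H p
    have hφ : ∀ x, f (φ x) = TrivSqZeroExt.inl (φ x) := by
      intro x
      have : f.comp (aeval ξ) = (TrivSqZeroExt.inlAlgHom K M M).comp (aeval ξ) := by
        apply MvPolynomial.algHom_ext
        intro l
        simp [hf]
      exact DFunLike.congr_fun this x
    have key : ∀ R, f (eval₂ φ t R) =
        TrivSqZeroExt.inl (eval₂ φ t R) + TrivSqZeroExt.inr (eval₂ φ t (pderiv p R)) := by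
      intro R
      induction R using MvPolynomial.induction_on with
      | C a => simp [hφ]
      | add p q hp hq =>
        simp only [map_add, eval₂_add, hp, hq, TrivSqZeroExt.inl_add, TrivSqZeroExt.inr_add]
        ring
      | mul_X R i hR =>
        rw [eval₂_mul, map_mul, hR, eval₂_X, hft, pderiv_mul, eval₂_add, eval₂_mul, eval₂_mul,
          eval₂_X, pderiv_X]
        have : eval₂ φ t (Pi.single (M := fun _ => MvPolynomial _ _) p 1 i) =
            (Pi.single p 1 : _ → M) i := by
          by_cases h : i = p
          · subst h; simp
          · simp [h]
        rw [this]
        ext <;> simp [mul_comm]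
    have := key Q
    rw [hQ, map_zero, TrivSqZeroExt.inl_zero, zero_add] at this
    exact (TrivSqZeroExt.inr_injective (this.symm.trans (TrivSqZeroExt.inr_zero _).symm))
  have base : ∀ Q, eval₂ φ t Q = 0 → (∀ e ≠ 0, φ (coeff e Q) = 0) → ∀ e, φ (coeff e Q) = 0 := by
    intro Q hQ hne e
    by_cases he : e = 0
    · have hC : MvPolynomial.map φ Q = C (φ (coeff 0 Q)) := by
        ext1 d
        rw [coeff_map, coeff_C]
        split_ifs with hd
        · rw [hd]
        · exact hne d (Ne.symm hd)
      rwa [eval₂_eq_eval_map, hC, eval_C, ← he] at hQ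
    · exact hne e he
  -- Induction on the degree in t: derivatives of a relation are relations of lower degree. In
  -- characteristic zero their coefficients recover every coefficient of the relation but the
  -- constant one, which `base` then handles.
  have main : ∀ n : ℕ, ∀ Q, eval₂ φ t Q = 0 → (∀ e, n < e.degree → φ (coeff e Q) = 0) →
      ∀ e, φ (coeff e Q) = 0 := by
    intro n
    induction n with
    | zero =>
      intro Q hQ hn
      exact base Q hQ fun e he => hn e (Nat.pos_of_ne_zero fun h0 =>
        he ((Finsupp.degree_eq_zero_iff e).1 h0))
    | succ n ih =>
      intro Q hQ hn
      refine base Q hQ fun e he => ?_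
      obtain ⟨p, hp⟩ : ∃ p, e p ≠ 0 := by
        by_contra! h0
        exact he (Finsupp.ext h0)
      have hcoeff : ∀ e : Fin 3 × Fin m →₀ ℕ, φ (coeff e (pderiv p Q)) =
          φ (coeff (e + Finsupp.single p 1) Q) * ((e p : M) + 1) := fun e => by
        rw [coeff_pderiv, map_mul]
        simp
      have h1 := ih (pderiv p Q) (hder p Q hQ) (fun e he => by
        rw [hcoeff, hn, zero_mul]
        rw [map_add, Finsupp.degree_single]
        omega) (e - Finsupp.single p 1)
      rw [hcoeff, tsub_add_cancel_of_le (Finsupp.single_le_iff.2 (Nat.one_le_iff_ne_zero.2 hp))]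
        at h1
      exact (mul_eq_zero.1 h1).resolve_right (Nat.cast_add_one_ne_zero _)
  exact main P.totalDegree P hP (fun e he => by
    rw [coeff_eq_zero_of_totalDegree_lt he, map_zero]) e

end

/-! ### The differential conditions on a plane equation with many points -/

section

variable {K : Type u} [Field K] {m : ℕ}

theorem dvd_of_lt_encard [Infinite K] {h N : MvPolynomial (Fin 3 × Fin m ⊕ Fin 3) K} {d e c : ℕ}
    (hp : Prime h) (hh : IsWeightedHomogeneous (planeWeight m) h d)
    (hc : (c : ℕ∞) < (planeLocus h).encard)
    (hN : IsWeightedHomogeneous (planeWeight m) N e) (hde : d * e ≤ c)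
    (hv : ∀ x : Fin m → K, planeSubst x h = 0 → planeSubst x N = 0) : h ∣ N := by
  by_contra hdvd
  obtain ⟨T, hT, hTc⟩ := Set.exists_subset_encard_eq (k := ((c + 1 : ℕ) : ℕ∞))
    (Order.add_one_le_of_lt hc)
  have hfin : T.Finite := Set.finite_of_encard_eq_coe hTc
  rw [hfin.encard_eq_coe_toFinset_card] at hTc
  have h1 := Nat.cast_injective (R := ℕ∞) hTc
  have hTh : ∀ x ∈ hfin.toFinset, planeSubst x.rep h = 0 := fun x hx =>
    mem_planeLocus_iff.1 (hT (hfin.mem_toFinset.1 hx))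
  have := card_le_mul_of_not_dvd hh hN hp hdvd hfin.toFinset hTh fun x hx => hv _ (hTh x hx)
  omega

theorem dvd_weightedHomogeneousComponent {σ : Type*} (w : σ → ℕ) {h G : MvPolynomial σ K} {d : ℕ}
    (hh : IsWeightedHomogeneous w h d) (hG : h ∣ G) (n : ℕ) :
    h ∣ weightedHomogeneousComponent w n G := by
  obtain ⟨q, rfl⟩ := hG
  rw [← coeff_weightScaling, map_mul, weightScaling_of_isWeightedHomogeneous w hh, mul_assoc,
    Polynomial.coeff_C_mul]
  exact dvd_mul_right _ _

section Vanishing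

variable {x : Fin m → K} {h : MvPolynomial (Fin 3 × Fin m ⊕ Fin 3) K} (hx : planeSubst x h = 0)

include hx

theorem planeSubst_pderiv_inl (i : Fin 3) (j : Fin m) :
    planeSubst x (pderiv (Sum.inl (i, j)) h) =
      -(C (x j) * planeSubst x (pderiv (Sum.inr i) h)) := by
  have := planeSubst_pderiv x i j h
  rw [hx, map_zero] at this
  linear_combination -this

theorem planeSubst_tangent (i k : Fin 3) (j : Fin m) :
    planeSubst x (pderiv (Sum.inl (i, j)) h * pderiv (Sum.inr k) h -
      pderiv (Sum.inl (k, j)) h * pderiv (Sum.inr i) h) = 0 := by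
  simp only [map_sub, map_mul, planeSubst_pderiv_inl hx]
  ring

theorem planeSubst_incidence (i o : Fin 3) :
    planeSubst x (X (Sum.inr i) * pderiv (Sum.inr o) h +
      ∑ j, X (Sum.inl (i, j)) * pderiv (Sum.inl (o, j)) h) = 0 := by
  simp only [map_add, map_mul, map_sum, planeSubst_pderiv_inl hx]
  have h1 : planeSubst x (X (Sum.inr i)) = ∑ j, C (x j) * X (i, j) := by simp [planeSubst]
  have h2 : ∀ j, planeSubst x (X (Sum.inl (i, j))) = X (i, j) := by simp [planeSubst]
  simp only [h1, h2, Finset.sum_mul, ← Finset.sum_add_distrib]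
  exact Finset.sum_eq_zero fun j _ => by ring

/-- Up to a power of h_{y_o}, the expression is D(h_{t_ol} / h_{y_o}) for D = ∂_{t_ij} + x_j
∂_{y_i}, with x_j replaced by -h_{t_oj} / h_{y_o}. The quotient is -x_l, which does not depend on t.
-/
theorem planeSubst_stationary (i o : Fin 3) (j l : Fin m) :
    planeSubst x (pderiv (Sum.inr o) h *
      (pderiv (Sum.inr o) h * pderiv (Sum.inl (i, j)) (pderiv (Sum.inl (o, l)) h) -
        pderiv (Sum.inl (o, j)) h * pderiv (Sum.inr i) (pderiv (Sum.inl (o, l)) h)) -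
      pderiv (Sum.inl (o, l)) h *
      (pderiv (Sum.inr o) h * pderiv (Sum.inl (i, j)) (pderiv (Sum.inr o) h) -
        pderiv (Sum.inl (o, j)) h * pderiv (Sum.inr i) (pderiv (Sum.inr o) h))) = 0 := by
  have h1 := planeSubst_pderiv x i j (pderiv (Sum.inl (o, l)) h)
  have h2 := planeSubst_pderiv x i j (pderiv (Sum.inr o) h)
  rw [planeSubst_pderiv_inl hx, map_neg, pderiv_C_mul, h2] at h1
  simp only [map_sub, map_mul, planeSubst_pderiv_inl hx o]
  linear_combination -(planeSubst x (pderiv (Sum.inr o) h)) ^ 2 * h1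

end Vanishing

theorem isWeightedHomogeneous_pderiv_inl {h : MvPolynomial (Fin 3 × Fin m ⊕ Fin 3) K} {d : ℕ}
    (hh : IsWeightedHomogeneous (planeWeight m) h d) (p : Fin 3 × Fin m) :
    IsWeightedHomogeneous (planeWeight m) (pderiv (Sum.inl p) h) d :=
  hh.pderiv (by simp [planeWeight])

theorem isWeightedHomogeneous_pderiv_inr {h : MvPolynomial (Fin 3 × Fin m ⊕ Fin 3) K} {d : ℕ}
    (hh : IsWeightedHomogeneous (planeWeight m) h (d + 1)) (i : Fin 3) :
    IsWeightedHomogeneous (planeWeight m) (pderiv (Sum.inr i) h) d :=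
  hh.pderiv (by simp [planeWeight])

/-- The differential conditions that characterize the generic plane projections of a space curve. -/
structure IsStationaryEquation (h : MvPolynomial (Fin 3 × Fin m ⊕ Fin 3) K) (o : Fin 3) : Prop where
  tangent : ∀ i j, h ∣ pderiv (Sum.inl (i, j)) h * pderiv (Sum.inr o) h -
      pderiv (Sum.inl (o, j)) h * pderiv (Sum.inr i) h
  incidence : ∀ i, h ∣ X (Sum.inr i) * pderiv (Sum.inr o) h +
      ∑ j, X (Sum.inl (i, j)) * pderiv (Sum.inl (o, j)) h
  stationary : ∀ i j l, h ∣ pderiv (Sum.inr o) h *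
      (pderiv (Sum.inr o) h * pderiv (Sum.inl (i, j)) (pderiv (Sum.inl (o, l)) h) -
        pderiv (Sum.inl (o, j)) h * pderiv (Sum.inr i) (pderiv (Sum.inl (o, l)) h)) -
      pderiv (Sum.inl (o, l)) h *
      (pderiv (Sum.inr o) h * pderiv (Sum.inl (i, j)) (pderiv (Sum.inr o) h) -
        pderiv (Sum.inl (o, j)) h * pderiv (Sum.inr i) (pderiv (Sum.inr o) h))

/-- The three conditions have degrees 2d - 1, d and 3d - 2 in y, none exceeding d². Each vanishes on
more than d³ points of h = 0, so h divides it. This is where the bound d³ comes from. -/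
theorem isStationaryEquation_of_lt_encard [Infinite K]
    {h : MvPolynomial (Fin 3 × Fin m ⊕ Fin 3) K} {d : ℕ}
    (hp : Prime h) (hh : IsWeightedHomogeneous (planeWeight m) h d) (hd : d ≠ 0)
    (hc : ((d ^ 3 : ℕ) : ℕ∞) < (planeLocus h).encard) (o : Fin 3) : IsStationaryEquation h o := by
  obtain ⟨d, rfl⟩ := Nat.exists_eq_succ_of_ne_zero hd
  have h1 := isWeightedHomogeneous_pderiv_inl hh
  have h2 := isWeightedHomogeneous_pderiv_inr hh
  refine ⟨fun i j => dvd_of_lt_encard hp hh hc (e := 2 * d + 1) ?_ ?_ fun x hx =>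
    planeSubst_tangent hx i o j, fun i => dvd_of_lt_encard hp hh hc (e := d + 1) ?_ ?_ fun x hx =>
    planeSubst_incidence hx i o, fun i j l => dvd_of_lt_encard hp hh hc (e := 3 * d + 1) ?_ ?_
    fun x hx => planeSubst_stationary hx i o j l⟩
  · have := fun i k => (h1 (i, j)).mul (h2 k)
    rw [show d + 1 + d = 2 * d + 1 by ring] at this
    exact (this i o).sub (this o i)
  · rw [Nat.succ_eq_add_one]
    nlinarith [Nat.zero_le (d ^ 3), Nat.zero_le (d ^ 2)]
  · refine IsWeightedHomogeneous.add ?_ (IsWeightedHomogeneous.sum _ _ _ fun j _ => ?_)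
    · have := (isWeightedHomogeneous_X K (planeWeight m) (Sum.inr i)).mul (h2 o)
      rwa [show planeWeight m (Sum.inr i) + d = d + 1 by simp [planeWeight, add_comm]] at this
    · have := (isWeightedHomogeneous_X K (planeWeight m) (Sum.inl (i, j))).mul (h1 (o, j))
      rwa [show planeWeight m (Sum.inl (i, j)) + (d + 1) = d + 1 by simp [planeWeight]] at this
  · rw [Nat.succ_eq_add_one]
    nlinarith [Nat.zero_le (d ^ 3), Nat.zero_le (d ^ 2)]
  · have h3 := fun i => isWeightedHomogeneous_pderiv_inl (h2 i)
    have h4 := fun p q => isWeightedHomogeneous_pderiv_inl (h1 p) q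
    have h5 := fun p => isWeightedHomogeneous_pderiv_inr (h1 p)
    have h6 : IsWeightedHomogeneous (planeWeight m) (pderiv (Sum.inl (o, j)) h *
        pderiv (Sum.inr i) (pderiv (Sum.inr o) h)) (d + d) := by
      -- The second derivative in y has weight one less than `d`. For `d = 0` it is zero, and so has
      -- every weight.
      rcases Nat.eq_zero_or_pos d with rfl | hd
      · have : pderiv (Sum.inr i) (pderiv (Sum.inr o) h) = 0 := by
          rw [pderiv_eq_zero_of_notMem_vars]
          intro hmem
          obtain ⟨e, he, hie⟩ := (mem_vars_iff_mem_support _).1 hmem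
          have := h2 o (mem_support_iff.1 he)
          rw [Finsupp.weight_apply, Finsupp.sum, Finset.sum_eq_zero_iff] at this
          have := this _ hie
          simp [planeWeight] at this
          simp [this] at hie
        rw [this, mul_zero]
        exact isWeightedHomogeneous_zero _ _ _
      · obtain ⟨d, rfl⟩ := Nat.exists_eq_succ_of_ne_zero hd.ne'
        have := (h1 (o, j)).mul (isWeightedHomogeneous_pderiv_inr (h2 o) i)
        rwa [show d.succ + 1 + d = d.succ + d.succ by omega] at this
    have h7 : d + (d + (d + 1)) = 3 * d + 1 := by ring
    have h8 : d + 1 + (d + d) = 3 * d + 1 := by ring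
    refine IsWeightedHomogeneous.sub ?_ ?_
    · rw [← h7]
      refine (h2 o).mul (((h2 o).mul (h4 _ _)).sub ?_)
      have := (h1 (o, j)).mul (h5 (o, l) i)
      rwa [show d + 1 + d = d + (d + 1) by ring] at this
    · rw [← h8]
      exact (h1 (o, l)).mul (((h2 o).mul (h3 o _)).sub h6)
  · rw [Nat.succ_eq_add_one]
    rcases d with _ | d
    · simp
    · nlinarith [Nat.zero_le (d ^ 3), Nat.zero_le (d ^ 2)]

/-- By Euler's formula in the variables y. -/
theorem exists_pderiv_inr_ne_zero [CharZero K] {h : MvPolynomial (Fin 3 × Fin m ⊕ Fin 3) K} {d : ℕ}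
    (h0 : h ≠ 0) (hh : IsWeightedHomogeneous (planeWeight m) h d) (hd : d ≠ 0) :
    ∃ o, pderiv (Sum.inr o) h ≠ 0 := by
  by_contra! hcon
  have := hh.sum_weight_X_mul_pderiv
  simp [planeWeight, hcon] at this
  exact this.elim hd h0

end

/-! ### From the differential conditions to a generic point -/

section

variable {K : Type u} [Field K] {m : ℕ}

theorem not_dvd_of_weight_lt {σ : Type*} {w : σ → ℕ} {h g : MvPolynomial σ K} {d e : ℕ}
    (hh : IsWeightedHomogeneous w h d) (hg : IsWeightedHomogeneous w g e) (hg0 : g ≠ 0)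
    (hed : e < d) : ¬ h ∣ g := by
  rintro ⟨q, rfl⟩
  obtain ⟨a, b, hab, ha, -⟩ := MvPolynomial.IsWeightedHomogeneous.of_mul w hg0 hg
  have := ha.inj_right (left_ne_zero_of_mul hg0) hh
  omega

/-- The first order deformation in the direction `v` of a homomorphism that kills `h` extends from
polynomials to the fraction field of `K[σ] / (h)` if it kills `h`. -/
theorem exists_dualNumber_extension {σ M : Type*} [Field M] [Algebra K M]
    (h : MvPolynomial σ K) [Algebra (MvPolynomial σ K ⧸ Ideal.span {h}) M]
    [IsFractionRing (MvPolynomial σ K ⧸ Ideal.span {h}) M]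
    [IsScalarTower K (MvPolynomial σ K ⧸ Ideal.span {h}) M]
    (F : MvPolynomial σ K →ₐ[K] DualNumber M) (hF : F h = 0)
    (hfst : ∀ G, (F G).fst = algebraMap (MvPolynomial σ K ⧸ Ideal.span {h}) M
      (Ideal.Quotient.mk _ G)) :
    ∃ f : M →ₐ[K] DualNumber M, ∀ G, f (algebraMap (MvPolynomial σ K ⧸ Ideal.span {h}) M
      (Ideal.Quotient.mk _ G)) = F G := by
  let F' : MvPolynomial σ K ⧸ Ideal.span {h} →ₐ[K] DualNumber M :=
    Ideal.Quotient.liftₐ (Ideal.span {h}) F (fun a ha => by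
      obtain ⟨q, rfl⟩ := Ideal.mem_span_singleton.1 ha
      rw [map_mul, hF, zero_mul])
  have hF' : ∀ y : nonZeroDivisors (MvPolynomial σ K ⧸ Ideal.span {h}), IsUnit (F' y) := by
    rintro ⟨y, hy⟩
    obtain ⟨G, rfl⟩ := Ideal.Quotient.mk_surjective y
    rw [TrivSqZeroExt.isUnit_iff_isUnit_fst]
    change IsUnit (F G).fst
    rw [hfst]
    exact IsLocalization.map_units M (⟨_, hy⟩ : nonZeroDivisors _)
  refine ⟨IsLocalization.liftAlgHom (M := nonZeroDivisors (MvPolynomial σ K ⧸ Ideal.span {h}))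
    (f := F') hF', fun G => ?_⟩
  rw [IsLocalization.coe_liftAlgHom]
  exact IsLocalization.lift_eq hF' _

section Generic

variable {M : Type u} [Field M] [Algebra K M]

/-- The first order deformation of `ι` in the direction of the `i`-th coordinate. -/
noncomputable def deformation (ι : MvPolynomial (Fin 3 × Fin m ⊕ Fin 3) K →ₐ[K] M) (ξ : Fin m → M)
    (p : Fin 3 × Fin m) (G : MvPolynomial (Fin 3 × Fin m ⊕ Fin 3) K) : M :=
  ι (pderiv (Sum.inl p) G) + ξ p.2 * ι (pderiv (Sum.inr p.1) G)

theorem exists_algHom_eq_deformation (ι : MvPolynomial (Fin 3 × Fin m ⊕ Fin 3) K →ₐ[K] M)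
    (ξ : Fin m → M) (p : Fin 3 × Fin m) :
    ∃ F : MvPolynomial (Fin 3 × Fin m ⊕ Fin 3) K →ₐ[K] DualNumber M, ∀ G, F G =
      TrivSqZeroExt.inl (ι G) + TrivSqZeroExt.inr (deformation ι ξ p G) := by
  refine ⟨aeval (fun v => TrivSqZeroExt.inl (ι (X v)) +
    TrivSqZeroExt.inr (deformation ι ξ p (X v))), fun G => ?_⟩
  induction G using MvPolynomial.induction_on with
  | C a =>
    rw [← algebraMap_eq, AlgHom.commutes, AlgHom.commutes]
    simp only [deformation, Derivation.map_algebraMap, map_zero, mul_zero, add_zero,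
      TrivSqZeroExt.inr_zero]
    rfl
  | add p q hp hq =>
    rw [map_add, hp, hq]
    ext
    · simp
    · simp [deformation]
      ring
  | mul_X G v hG =>
    rw [map_mul, hG, aeval_X]
    ext
    · simp
    · simp only [deformation, pderiv_mul, map_add, map_mul, TrivSqZeroExt.snd_mul,
        TrivSqZeroExt.fst_add, TrivSqZeroExt.fst_inl, TrivSqZeroExt.fst_inr, TrivSqZeroExt.snd_add,
        TrivSqZeroExt.snd_inl, TrivSqZeroExt.snd_inr, smul_eq_mul, MulOpposite.smul_eq_mul_unop,
        MulOpposite.unop_op]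
      ring

variable {h : MvPolynomial (Fin 3 × Fin m ⊕ Fin 3) K} {d : ℕ}
  {ι : MvPolynomial (Fin 3 × Fin m ⊕ Fin 3) K →ₐ[K] M} (hι : ∀ G, ι G = 0 ↔ h ∣ G) {o : Fin 3}
  (ho : ι (pderiv (Sum.inr o) h) ≠ 0) {ξ : Fin m → M}
  (hξ : ∀ j, ι (pderiv (Sum.inr o) h) * ξ j = -ι (pderiv (Sum.inl (o, j)) h))
  (hs : IsStationaryEquation h o)

include hι ho hξ

/-- Multiplied by h_{y_o}^N, with N the total degree of G, the value at ξ of the part of degree e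
becomes the image of a polynomial of weight N d + e. These weights differ, and h divides each
weighted component of a multiple of h. -/
theorem aeval_homogeneousComponent_eq_zero (hh : IsWeightedHomogeneous (planeWeight m) h (d + 1))
    {G : MvPolynomial (Fin m) K} (hG : aeval ξ G = 0) (e : ℕ) :
    aeval ξ (homogeneousComponent e G) = 0 := by
  have hho := isWeightedHomogeneous_pderiv_inr hh o
  let P : ℕ → MvPolynomial (Fin 3 × Fin m ⊕ Fin 3) K := fun e =>
    pderiv (Sum.inr o) h ^ (G.totalDegree - e) *
      aeval (fun j => -pderiv (Sum.inl (o, j)) h) (homogeneousComponent e G)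
  have hP : ∀ e ≤ G.totalDegree,
      ι (P e) = ι (pderiv (Sum.inr o) h) ^ G.totalDegree * aeval ξ (homogeneousComponent e G) := by
    intro e he
    have h1 : ι (aeval (fun j => -pderiv (Sum.inl (o, j)) h) (homogeneousComponent e G)) =
        aeval (fun j => ι (pderiv (Sum.inr o) h) * ξ j) (homogeneousComponent e G) := by
      rw [← AlgHom.comp_apply, comp_aeval]
      congr 2
      funext j
      rw [hξ, map_neg]
    rw [map_mul, h1, aeval_smul_of_isHomogeneous (homogeneousComponent_isHomogeneous e G),
      map_pow, ← mul_assoc, ← pow_add, Nat.sub_add_cancel he]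
  have hsum : h ∣ ∑ e ∈ Finset.range (G.totalDegree + 1), P e := by
    rw [← hι, map_sum, Finset.sum_congr rfl fun e he => hP e (by
      rw [Finset.mem_range] at he; omega), ← Finset.mul_sum, ← map_sum,
      sum_homogeneousComponent, hG, mul_zero]
  have hw : ∀ e ≤ G.totalDegree,
      IsWeightedHomogeneous (planeWeight m) (P e) (G.totalDegree * d + e) := by
    intro e he
    have h1 : IsWeightedHomogeneous (planeWeight m)
        (aeval (fun j => -pderiv (Sum.inl (o, j)) h) (homogeneousComponent e G)) (e * (d + 1)) := by
      have := homogeneousComponent_isHomogeneous e G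
      generalize homogeneousComponent e G = Q at this
      induction this using IsWeightedHomogeneous.induction_on with
      | zero => rw [map_zero]; exact isWeightedHomogeneous_zero _ _ _
      | add p q _ _ hp hq => rw [map_add]; exact hp.add hq
      | monomial a r hr =>
        rw [aeval_monomial, algebraMap_eq]
        refine IsWeightedHomogeneous.C_mul ?_ r
        have := IsWeightedHomogeneous.prod a.support
          (fun j => (-pderiv (Sum.inl (o, j)) h) ^ a j) (fun j => a j • (d + 1))
          (w := planeWeight m)
          (fun j _ => (isWeightedHomogeneous_pderiv_inl hh (o, j)).neg.pow (a j))
        convert this using 1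
        · rfl
        · rw [← hr, Finsupp.weight_apply, Finsupp.sum, Finset.sum_mul]
          simp
    have := (hho.pow (G.totalDegree - e)).mul h1
    convert this using 1
    obtain ⟨r, hr⟩ := Nat.exists_eq_add_of_le he
    rw [hr, Nat.add_sub_cancel_left, smul_eq_mul]
    ring
  by_cases he : e ≤ G.totalDegree
  · have h1 := dvd_weightedHomogeneousComponent (planeWeight m) hh hsum (G.totalDegree * d + e)
    rw [map_sum, Finset.sum_eq_single e, (hw e he).weightedHomogeneousComponent_same, ← hι,
      hP e he] at h1
    · exact (mul_eq_zero.1 h1).resolve_left (pow_ne_zero _ ho)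
    · intro e' he' hne
      refine (hw e' ?_).weightedHomogeneousComponent_ne _ ?_
      · rw [Finset.mem_range] at he'; omega
      · omega
    · intro h2
      rw [Finset.mem_range] at h2
      omega
  · rw [homogeneousComponent_eq_zero _ _ (by omega), map_zero]
include hs

theorem mulV_eq_of_isStationaryEquation (i : Fin 3) :
    mulV (fun p => ι (X (Sum.inl p))) ξ i = ι (X (Sum.inr i)) := by
  have h1 := (hι _).2 (hs.incidence i)
  rw [map_add, map_mul, map_sum] at h1
  apply mul_left_cancel₀ ho
  rw [mulV, Finset.mul_sum]
  have h2 : ∀ j, ι (pderiv (Sum.inr o) h) * (ι (X (Sum.inl (i, j))) * ξ j) =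
      -ι (X (Sum.inl (i, j)) * pderiv (Sum.inl (o, j)) h) := by
    intro j
    rw [mul_left_comm, hξ, map_mul, mul_neg]
  simp only [h2, Finset.sum_neg_distrib]
  linear_combination -h1

/-- The tangent condition makes the derivation ∂_{t_ij} + ξ_j ∂_{y_i} kill h, so it extends to the
function field. The stationary condition makes the extension kill ξ. -/
theorem exists_algHom_dualNumber
    (hext : ∀ F : MvPolynomial (Fin 3 × Fin m ⊕ Fin 3) K →ₐ[K] DualNumber M, F h = 0 →
      (∀ G, (F G).fst = ι G) → ∃ f : M →ₐ[K] DualNumber M, ∀ G, f (ι G) = F G)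
    (p : Fin 3 × Fin m) : ∃ f : M →ₐ[K] DualNumber M,
      (∀ l, f (ξ l) = TrivSqZeroExt.inl (ξ l)) ∧ ∀ q, f (ι (X (Sum.inl q))) =
        TrivSqZeroExt.inl (ι (X (Sum.inl q))) + TrivSqZeroExt.inr (Pi.single p 1 q) := by
  classical
  obtain ⟨F, hF⟩ := exists_algHom_eq_deformation ι ξ p
  have hcE : ∀ G, ι (pderiv (Sum.inr o) h) * deformation ι ξ p G =
      ι (pderiv (Sum.inr o) h * pderiv (Sum.inl p) G -
        pderiv (Sum.inl (o, p.2)) h * pderiv (Sum.inr p.1) G) := by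
    intro G
    rw [deformation, mul_add, ← mul_assoc, hξ, map_sub, map_mul, map_mul]
    ring
  have hFh : F h = 0 := by
    rw [hF]
    have h1 : deformation ι ξ p h = 0 := by
      apply mul_left_cancel₀ ho
      rw [hcE, mul_zero, hι]
      have := hs.tangent p.1 p.2
      rwa [mul_comm] at this
    rw [h1, (hι h).2 dvd_rfl, TrivSqZeroExt.inl_zero, TrivSqZeroExt.inr_zero, add_zero]
  obtain ⟨f, hf⟩ := hext F hFh (fun G => by
    rw [hF, TrivSqZeroExt.fst_add, TrivSqZeroExt.fst_inl, TrivSqZeroExt.fst_inr, add_zero])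
  refine ⟨f, fun l => ?_, fun q => ?_⟩
  · have h1 : IsUnit (f (ι (pderiv (Sum.inr o) h))) := (isUnit_iff_ne_zero.2 ho).map f
    apply h1.mul_left_cancel
    have h2 : deformation ι ξ p (pderiv (Sum.inl (o, l)) h) +
        deformation ι ξ p (pderiv (Sum.inr o) h) * ξ l = 0 := by
      have h3 := (hι _).2 (hs.stationary p.1 p.2 l)
      rw [map_sub, map_mul, map_mul, ← hcE, ← hcE] at h3
      apply mul_left_cancel₀ ho
      apply mul_left_cancel₀ ho
      linear_combination h3 + deformation ι ξ p (pderiv (Sum.inr o) h) *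
        ι (pderiv (Sum.inr o) h) * hξ l
    rw [← map_mul, hξ, map_neg, hf, hf, hF, hF]
    ext
    · simp [hξ]
    · simp only [TrivSqZeroExt.snd_mul, TrivSqZeroExt.fst_add, TrivSqZeroExt.snd_neg,
        TrivSqZeroExt.fst_inl, TrivSqZeroExt.fst_inr, TrivSqZeroExt.snd_add,
        TrivSqZeroExt.snd_inl, TrivSqZeroExt.snd_inr, smul_eq_mul, MulOpposite.smul_eq_mul_unop,
        MulOpposite.unop_op]
      linear_combination -h2
  · rw [hf, hF]
    congr 2
    simp only [deformation, pderiv_X]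
    by_cases hq : q = p
    · subst hq; simp
    · simp [hq]

/-- Incidence gives t ξ = y, so ι is the evaluation at (t, tξ) and its kernel is generated by h.
Independence of t comes from the translations in the dual numbers, dependence in ξ from counting
transcendence degrees. -/
theorem isGenericPlaneEquation_of_isStationaryEquation [CharZero M] (h0 : h ≠ 0)
    (hh : IsWeightedHomogeneous (planeWeight m) h (d + 1))
    (hext : ∀ F : MvPolynomial (Fin 3 × Fin m ⊕ Fin 3) K →ₐ[K] DualNumber M, F h = 0 →
      (∀ G, (F G).fst = ι G) → ∃ f : M →ₐ[K] DualNumber M, ∀ G, f (ι G) = F G)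
    (hfrac : ∀ a : M, ∃ u v, ι v ≠ 0 ∧ a * ι v = ι u) :
    IsGenericPlaneEquation (fun p => ι (X (Sum.inl p))) ξ h (d + 1) := by
  have hφ : aeval (Sum.elim (fun p => ι (X (Sum.inl p))) (mulV (fun p => ι (X (Sum.inl p))) ξ)) =
      ι := by
    apply MvPolynomial.algHom_ext
    rintro (p | i)
    · rw [aeval_X]; rfl
    · rw [aeval_X]; exact mulV_eq_of_isStationaryEquation hι ho hξ hs i
  have indep := aeval_coeff_eq_zero_of_dualNumber (exists_algHom_dualNumber hι ho hξ hs hext)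
  exact ⟨h0, hh, fun G => by rw [hφ]; exact hι G,
    fun G hG e => aeval_homogeneousComponent_eq_zero hι ho hξ hh hG e,
    exists_dependence (fun y hy => by
      rw [hφ] at hy
      have := card_lt_of_map_eq_zero ι hy h0 ((hι h).2 dvd_rfl)
      simp at this) (by rw [hφ]; exact hfrac) indep, indep⟩

end Generic

variable [CharZero K]

theorem isCurveEquation_of_isStationaryEquation {h : MvPolynomial (Fin 3 × Fin m ⊕ Fin 3) K} {d : ℕ}
    (hp : Prime h) (hh : IsWeightedHomogeneous (planeWeight m) h d) (hd : d ≠ 0) {o : Fin 3}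
    (ho : pderiv (Sum.inr o) h ≠ 0) (hs : IsStationaryEquation h o) : IsCurveEquation h d := by
  obtain ⟨d, rfl⟩ := Nat.exists_eq_succ_of_ne_zero hd
  have hI : (Ideal.span {h}).IsPrime := (Ideal.span_singleton_prime hp.ne_zero).2 hp
  let M := FractionRing (MvPolynomial (Fin 3 × Fin m ⊕ Fin 3) K ⧸ Ideal.span {h})
  have : CharZero M := charZero_of_injective_algebraMap (algebraMap K M).injective
  obtain ⟨ι, hι, hι'⟩ : ∃ ι : MvPolynomial (Fin 3 × Fin m ⊕ Fin 3) K →ₐ[K] M,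
      (∀ G, ι G = 0 ↔ h ∣ G) ∧
      ∀ G, ι G = algebraMap (MvPolynomial (Fin 3 × Fin m ⊕ Fin 3) K ⧸ Ideal.span {h}) M
        (Ideal.Quotient.mk _ G) := by
    refine ⟨(IsScalarTower.toAlgHom K _ M).comp (Ideal.Quotient.mkₐ K (Ideal.span {h})),
      fun G => ?_, fun G => rfl⟩
    change algebraMap _ M (Ideal.Quotient.mk (Ideal.span {h}) G) = 0 ↔ _
    rw [map_eq_zero_iff _ (IsFractionRing.injective _ M), Ideal.Quotient.eq_zero_iff_mem,
      Ideal.mem_span_singleton]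
  have ho0 : ι (pderiv (Sum.inr o) h) ≠ 0 := fun h0 => not_dvd_of_weight_lt hh
    (isWeightedHomogeneous_pderiv_inr hh o) ho (Nat.lt_succ_self d) ((hι _).1 h0)
  have hξ : ∀ j, ι (pderiv (Sum.inr o) h) *
      (-ι (pderiv (Sum.inl (o, j)) h) / ι (pderiv (Sum.inr o) h)) =
      -ι (pderiv (Sum.inl (o, j)) h) := fun j => mul_div_cancel₀ _ ho0
  have hext : ∀ F : MvPolynomial (Fin 3 × Fin m ⊕ Fin 3) K →ₐ[K] DualNumber M, F h = 0 →
      (∀ G, (F G).fst = ι G) → ∃ f : M →ₐ[K] DualNumber M, ∀ G, f (ι G) = F G := by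
    intro F hF hfst
    obtain ⟨f, hf⟩ := exists_dualNumber_extension (M := M) h F hF fun G => (hfst G).trans (hι' G)
    exact ⟨f, fun G => by rw [hι', hf]⟩
  have hfrac : ∀ a : M, ∃ u v, ι v ≠ 0 ∧ a * ι v = ι u := by
    intro a
    obtain ⟨r, s, hs, rfl⟩ := IsFractionRing.div_surjective
      (A := MvPolynomial (Fin 3 × Fin m ⊕ Fin 3) K ⧸ Ideal.span {h}) a
    obtain ⟨u, rfl⟩ := Ideal.Quotient.mk_surjective r
    obtain ⟨v, rfl⟩ := Ideal.Quotient.mk_surjective s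
    have hv : ι v ≠ 0 := by
      rw [hι']
      exact IsFractionRing.to_map_ne_zero_of_mem_nonZeroDivisors hs
    exact ⟨u, v, hv, by rw [← hι', ← hι', div_mul_cancel₀ _ hv]⟩
  exact ⟨M, inferInstance, inferInstance, _, _,
    isGenericPlaneEquation_of_isStationaryEquation hι ho0 hξ hs hp.ne_zero hh hext hfrac⟩

/-- A prime plane equation either defines a curve or has few points. -/
theorem isCurveEquation_or_encard_planeLocus_le {h : MvPolynomial (Fin 3 × Fin m ⊕ Fin 3) K} {d : ℕ}
    (hp : Prime h) (hh : IsWeightedHomogeneous (planeWeight m) h d) (hd : d ≠ 0) :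
    IsCurveEquation h d ∨ (planeLocus h).encard ≤ ((d ^ 3 : ℕ) : ℕ∞) := by
  by_contra! hcon
  obtain ⟨o, ho⟩ := exists_pderiv_inr_ne_zero hp.ne_zero hh hd
  exact hcon.1 (isCurveEquation_of_isStationaryEquation hp hh hd ho
    (isStationaryEquation_of_lt_encard hp hh hd hcon.2 o))

end

/-! ### Cone ideals and generic points of closed sets -/

section

variable {K : Type u} [Field K] {m : ℕ}

/-- The ideal of the polynomials that vanish on the affine cone over a set of points. -/
def coneIdeal (Γ : Set (PSpace K m)) : Ideal (MvPolynomial (Fin m) K) where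
  carrier := {G | ∀ x ∈ Γ, ∀ c : K, eval (c • x.rep) G = 0}
  add_mem' := fun hf hg x hx c => by rw [map_add, hf x hx c, hg x hx c, add_zero]
  zero_mem' := fun x _ c => map_zero _
  smul_mem' := fun f g hg x hx c => by rw [smul_eq_mul, map_mul, hg x hx c, mul_zero]

theorem forall_eval_smul_eq_zero_iff [Infinite K] {G : MvPolynomial (Fin m) K} {v : Fin m → K} :
    (∀ c : K, eval (c • v) G = 0) ↔ ∀ e, eval v (homogeneousComponent e G) = 0 := by
  refine ⟨fun h e => ?_, fun h c => ?_⟩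
  · by_contra h0
    obtain ⟨c, -, hc⟩ := exists_smul_eval_ne_zero h0
    exact hc (h c)
  · rw [← sum_homogeneousComponent G, map_sum]
    exact Finset.sum_eq_zero fun e _ => by
      rw [eval_smul_of_isHomogeneous (homogeneousComponent_isHomogeneous e G), h, mul_zero]

theorem homogeneousComponent_mem_coneIdeal [Infinite K] {Γ : Set (PSpace K m)}
    {G : MvPolynomial (Fin m) K} (hG : G ∈ coneIdeal Γ) (e : ℕ) :
    homogeneousComponent e G ∈ coneIdeal Γ := fun x hx c => by
  rw [eval_smul_of_isHomogeneous (homogeneousComponent_isHomogeneous e G),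
    forall_eval_smul_eq_zero_iff.1 (hG x hx) e, mul_zero]

theorem mem_of_forall_mem_coneIdeal {Γ : Set (PSpace K m)} (hΓ : IsClosed Γ) {x : PSpace K m}
    (hx : ∀ d G, G.IsHomogeneous d → G ∈ coneIdeal Γ → eval x.rep G = 0) : x ∈ Γ := by
  obtain ⟨T, hT, rfl⟩ := (isClosed_iff_isAlgebraic Γ).1 hΓ
  intro G hG
  obtain ⟨d, hd⟩ := hT G hG
  exact hx d G hd fun z hz c => by rw [eval_smul_of_isHomogeneous hd, hz G hG, mul_zero]

theorem coneIdeal_strictAnti {Γ Γ' : Set (PSpace K m)} (hΓ : IsClosed Γ) (h : Γ < Γ') :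
    coneIdeal Γ' < coneIdeal Γ := by
  refine lt_of_le_not_ge (fun G hG x hx => hG x (h.1 hx)) fun hle => h.2 fun x hx => ?_
  refine mem_of_forall_mem_coneIdeal hΓ fun d G _ hG => ?_
  have := hle hG x hx 1
  rwa [one_smul] at this

instance : TopologicalSpace.NoetherianSpace (PSpace K m) := by
  have h : WellFounded ((· > ·) : Ideal (MvPolynomial (Fin m) K) → _ → Prop) :=
    wellFounded_gt
  have h' : WellFoundedLT (TopologicalSpace.Closeds (PSpace K m)) :=
    ⟨Subrelation.wf (r := InvImage (· > ·) fun Z : TopologicalSpace.Closeds (PSpace K m) =>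
      coneIdeal (Z : Set (PSpace K m))) (fun {Z Z'} hlt => coneIdeal_strictAnti Z.isClosed hlt)
      (InvImage.wf _ h)⟩
  exact ((TopologicalSpace.noetherianSpace_TFAE (PSpace K m)).out 0 1).2 h'

/-- On the line through x, f and g become polynomials in one variable with product zero, so one of
them vanishes on that line. Γ is then covered by two closed sets, and irreducibility selects one. -/
theorem isPrime_coneIdeal [Infinite K] {Γ : Set (PSpace K m)} (hΓ : IsIrreducible Γ) :
    (coneIdeal Γ).IsPrime := by
  rw [Ideal.isPrime_iff]
  constructor
  · intro htop
    obtain ⟨x, hx⟩ := hΓ.1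
    have : (1 : MvPolynomial (Fin m) K) ∈ coneIdeal Γ := htop ▸ Submodule.mem_top
    simpa using this x hx 1
  · intro f g hfg
    have hclosed : ∀ f : MvPolynomial (Fin m) K,
        IsClosed {x : PSpace K m | ∀ c : K, eval (c • x.rep) f = 0} := by
      intro f
      rw [isClosed_iff_isAlgebraic]
      refine ⟨Set.range fun e => homogeneousComponent e f, ?_, ?_⟩
      · rintro _ ⟨e, rfl⟩
        exact ⟨e, homogeneousComponent_isHomogeneous e f⟩
      · ext x
        simp [ProjCurve.zeroLocus, forall_eval_smul_eq_zero_iff]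
    have hcov : Γ ⊆ {x : PSpace K m | ∀ c : K, eval (c • x.rep) f = 0} ∪
        {x : PSpace K m | ∀ c : K, eval (c • x.rep) g = 0} := by
      intro x hx
      have hP : ∀ (G : MvPolynomial (Fin m) K) (c : K), Polynomial.eval c
          (aeval (fun j => Polynomial.C (x.rep j) * Polynomial.X) G) = eval (c • x.rep) G := by
        intro G c
        rw [polynomial_eval_aeval]
        congr 2
        funext j
        rw [Polynomial.eval_mul, Polynomial.eval_C, Polynomial.eval_X, Pi.smul_apply, smul_eq_mul,
          mul_comm]
      have h0 : (aeval (fun j => Polynomial.C (x.rep j) * Polynomial.X) f : Polynomial K) *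
          aeval (fun j => Polynomial.C (x.rep j) * Polynomial.X) g = 0 := by
        rw [← map_mul]
        exact Polynomial.funext fun c => by rw [hP, hfg x hx c, Polynomial.eval_zero]
      rcases mul_eq_zero.1 h0 with h | h
      · exact Or.inl fun c => by rw [← hP, h, Polynomial.eval_zero]
      · exact Or.inr fun c => by rw [← hP, h, Polynomial.eval_zero]
    rcases isPreirreducible_iff_isClosed_union_isClosed.1 hΓ.2 _ _ (hclosed f) (hclosed g) hcov
      with h | h
    · exact Or.inl fun x hx => h hx
    · exact Or.inr fun x hx => h hx

/-- A point `ξ` with vanishing ideal `I`, together with a matrix `t` of independent entries. -/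
theorem exists_generic_matrix (I : Ideal (MvPolynomial (Fin m) K)) [I.IsPrime] :
    ∃ (M : Type u) (_ : Field M) (_ : Algebra K M) (t : Fin 3 × Fin m → M) (ξ : Fin m → M),
      (∀ P : MvPolynomial (Fin 3 × Fin m) (MvPolynomial (Fin m) K),
        eval₂ (aeval ξ : MvPolynomial (Fin m) K →ₐ[K] M).toRingHom t P = 0 ↔
          ∀ e, coeff e P ∈ I) ∧
      ∀ a : M, ∃ P Q, eval₂ (aeval ξ : MvPolynomial (Fin m) K →ₐ[K] M).toRingHom t Q ≠ 0 ∧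
        a * eval₂ (aeval ξ : MvPolynomial (Fin m) K →ₐ[K] M).toRingHom t Q =
          eval₂ (aeval ξ : MvPolynomial (Fin m) K →ₐ[K] M).toRingHom t P := by
  let R := MvPolynomial (Fin 3 × Fin m) (MvPolynomial (Fin m) K ⧸ I)
  let M := FractionRing R
  let ξ : Fin m → M := fun j => algebraMap R M (C (Ideal.Quotient.mk I (X j)))
  let t : Fin 3 × Fin m → M := fun p => algebraMap R M (X p)
  have key : ∀ P : MvPolynomial (Fin 3 × Fin m) (MvPolynomial (Fin m) K),
      eval₂ (aeval ξ : MvPolynomial (Fin m) K →ₐ[K] M).toRingHom t P =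
        algebraMap R M (map (Ideal.Quotient.mk I) P) := by
    have h1 : ∀ G : MvPolynomial (Fin m) K, aeval ξ G =
        algebraMap R M (C (Ideal.Quotient.mk I G)) := by
      intro G
      induction G using MvPolynomial.induction_on with
      | C a => rw [aeval_C]; rfl
      | add p q hp hq => simp only [map_add, hp, hq]
      | mul_X p i hp => rw [map_mul, hp, aeval_X, map_mul, C_mul, map_mul]
    intro P
    induction P using MvPolynomial.induction_on with
    | C a => rw [eval₂_C, map_C]; exact h1 a
    | add p q hp hq => simp only [eval₂_add, map_add, hp, hq]
    | mul_X p i hp => rw [eval₂_mul, hp, eval₂_X, map_mul, map_X, map_mul]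
  refine ⟨M, inferInstance, inferInstance, t, ξ, fun P => ?_, fun a => ?_⟩
  · rw [key, map_eq_zero_iff _ (IsFractionRing.injective R M)]
    refine ⟨fun h e => ?_, fun h => ?_⟩
    · rw [← Ideal.Quotient.eq_zero_iff_mem, ← coeff_map, h, coeff_zero]
    · ext1 e
      rw [coeff_map, coeff_zero, Ideal.Quotient.eq_zero_iff_mem]
      exact h e
  · obtain ⟨r, s, hs, rfl⟩ := IsFractionRing.div_surjective (A := R) a
    obtain ⟨P, rfl⟩ := map_surjective _ Ideal.Quotient.mk_surjective r
    obtain ⟨Q, rfl⟩ := map_surjective _ Ideal.Quotient.mk_surjective s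
    have hQ : algebraMap R M (map (Ideal.Quotient.mk I) Q) ≠ 0 :=
      IsFractionRing.to_map_ne_zero_of_mem_nonZeroDivisors hs
    exact ⟨P, Q, by rwa [key], by rw [key, key, div_mul_cancel₀ _ hQ]⟩

/-- The substitution `y = t x` for a generic matrix `t` and a generic vector `x`. -/
noncomputable def genericSubst : MvPolynomial (Fin 3 × Fin m ⊕ Fin 3) K →ₐ[K]
    MvPolynomial (Fin 3 × Fin m) (MvPolynomial (Fin m) K) :=
  aeval (Sum.elim X (fun i => ∑ j, C (X j) * X (i, j)))

theorem map_eval_genericSubst (v : Fin m → K) (G : MvPolynomial (Fin 3 × Fin m ⊕ Fin 3) K) :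
    MvPolynomial.map (eval v) (genericSubst G) = planeSubst v G := by
  induction G using MvPolynomial.induction_on with
  | C a =>
    rw [← algebraMap_eq, AlgHom.commutes, AlgHom.commutes]
    change MvPolynomial.map (eval v) (C (C a)) = C a
    rw [map_C, eval_C]
  | add p q hp hq => simp only [map_add, hp, hq]
  | mul_X p i hp =>
    rw [map_mul, map_mul, hp, map_mul]
    congr 1
    rcases i with i | i <;> simp [genericSubst, planeSubst]

theorem eval₂_genericSubst {M : Type*} [Field M] [Algebra K M] (t : Fin 3 × Fin m → M)
    (ξ : Fin m → M) (G : MvPolynomial (Fin 3 × Fin m ⊕ Fin 3) K) :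
    eval₂ (aeval ξ : MvPolynomial (Fin m) K →ₐ[K] M).toRingHom t (genericSubst G) =
      aeval (Sum.elim t (mulV t ξ)) G := by
  induction G using MvPolynomial.induction_on with
  | C a =>
    rw [← algebraMap_eq, AlgHom.commutes, AlgHom.commutes]
    change eval₂ _ t (C (C a)) = _
    rw [eval₂_C]
    exact aeval_C _ _
  | add p q hp hq => simp only [map_add, eval₂_add, hp, hq]
  | mul_X p i hp =>
    rw [map_mul, map_mul, eval₂_mul, hp]
    congr 1
    rcases i with i | i
    · simp [genericSubst]
    · simp [genericSubst, mulV, eval₂_sum, eval₂_mul, mul_comm]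

end

/-! ### The projection of an irreducible closed set and its function field -/

section

variable {K : Type u} [Field K] {m : ℕ}

theorem finite_of_forall_dependent [Infinite K] {Γ : Set (PSpace K m)}
    (h : ∀ a c : Fin m, ∃ P : MvPolynomial (Fin 2) K, P ≠ 0 ∧
      ∀ x ∈ Γ, ∀ s : K, eval ![s * x.rep a, s * x.rep c] P = 0) : Γ.Finite := by
  refine finite_of_forall_pair fun a c => ?_
  obtain ⟨P, hP, hPx⟩ := h a c
  obtain ⟨y, hy⟩ := exists_forall_eval_ne_zero Finset.univ
    (![P, X 1] : Fin 2 → MvPolynomial (Fin 2) K) (by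
      intro i _
      fin_cases i
      · exact hP
      · exact X_ne_zero _)
  have hy0 : eval y P ≠ 0 := hy 0 (Finset.mem_univ _)
  have hy1 : y 1 ≠ 0 := by simpa using hy 1 (Finset.mem_univ _)
  let q : Polynomial K := aeval (![Polynomial.C (y 1) * Polynomial.X, Polynomial.C (y 1)]) P
  have hq : ∀ s, q.eval s = eval ![y 1 * s, y 1] P := by
    intro s
    rw [polynomial_eval_aeval]
    congr 2
    funext i
    fin_cases i <;> simp
  refine ⟨q, fun h0 => hy0 ?_, fun x hx hc => ?_⟩
  · have := hq (y 0 / y 1)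
    rw [h0, Polynomial.eval_zero, mul_div_cancel₀ _ hy1] at this
    rw [this]
    congr 2
    funext i
    fin_cases i <;> rfl
  · rw [hq, ← hPx x hx (y 1 / x.rep c)]
    congr 2
    funext i
    fin_cases i
    · simp; ring
    · simp; field_simp

/-- The image of a set of points in the space is not dense in the plane if some hyperplane section
is finite. -/
theorem exists_ne_zero_aeval_eq_zero [IsAlgClosed K] {Γ : Set (PSpace K m)} (hΓ : IsClosed Γ)
    {a : PSpace K m} (hfin : (Γ ∩ hyperplane a).Finite)
    {M : Type*} [Field M] [Algebra K M] {t : Fin 3 × Fin m → M} {ξ : Fin m → M}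
    (hξ : ∀ G : MvPolynomial (Fin m) K, G ∈ coneIdeal Γ → aeval ξ G = 0) :
    ∃ G : MvPolynomial (Fin 3 × Fin m ⊕ Fin 3) K, G ≠ 0 ∧
      aeval (Sum.elim t (mulV t ξ)) G = 0 := by
  classical
  by_contra! hcon
  -- If no equation existed, every matrix and target would be a specialization. With rows 0, a, r
  -- and target (1, 0, 1), the resulting z in Γ satisfies a · z = 0 and r · z = 0, while r was
  -- chosen nonzero on the finite section by a.
  obtain ⟨r, hr⟩ := exists_forall_eval_ne_zero hfin.toFinset
    (fun x : PSpace K m => linForm x.rep) (fun x _ h0 => by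
      apply x.rep_nonzero
      funext j
      have := eval_linForm x.rep (Pi.single j 1)
      rw [h0, map_zero] at this
      simpa [Pi.single_apply] using this.symm)
  obtain ⟨z, hz0, hz, hzA⟩ := exists_specialization t ξ
    (fun p => if p.1 = 0 then 0 else if p.1 = 1 then a.rep p.2 else r p.2) ![1, 0, 1]
    (fun h => by simpa using congrFun h 0) (fun G hG => by
      by_contra h0
      exact hcon G (fun h => h0 (by rw [h, map_zero])) hG)
  have h1 := hzA 1 2
  have h2 := hzA 0 2
  simp only [mulV, Fin.isValue, Matrix.cons_val, one_ne_zero, if_false, if_true, one_mul, zero_mul,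
    Fin.reduceEq, Finset.sum_const_zero] at h1 h2
  have hmem : Projectivization.mk K z hz0 ∈ Γ := by
    refine mem_of_forall_mem_coneIdeal hΓ fun d G hd hG => ?_
    rw [eval_rep_mk hd]
    exact hz d G hd (hξ G hG)
  have hmem2 : Projectivization.mk K z hz0 ∈ hyperplane a := by
    change Projectivization.orthogonal a _
    conv_lhs => rw [← a.mk_rep]
    rw [Projectivization.orthogonal_mk a.rep_nonzero hz0]
    exact h1
  have h3 := hr _ (hfin.mem_toFinset.2 ⟨hmem, hmem2⟩)
  rw [eval_linForm] at h3
  obtain ⟨c, hc⟩ := Projectivization.exists_smul_eq_mk_rep K z hz0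
  apply h3
  rw [← hc]
  have : ∑ j, (c • z) j * r j = (c : K) * ∑ j, r j * z j := by
    rw [Finset.mul_sum]
    refine Finset.sum_congr rfl fun j _ => ?_
    simp [Units.smul_def]
    ring
  rw [this, ← h2, mul_zero]

section Component

variable {M : Type u} [Field M] [Algebra K M] {t : Fin 3 × Fin m → M} {ξ : Fin m → M}
  {Γ : Set (PSpace K m)}
  (hI : ∀ P : MvPolynomial (Fin 3 × Fin m) (MvPolynomial (Fin m) K),
    eval₂ (aeval ξ : MvPolynomial (Fin m) K →ₐ[K] M).toRingHom t P = 0 ↔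
      ∀ e, coeff e P ∈ coneIdeal Γ)

include hI

theorem aeval_eq_zero_iff_mem_coneIdeal {G : MvPolynomial (Fin m) K} :
    aeval ξ G = 0 ↔ G ∈ coneIdeal Γ := by
  classical
  have := hI (C G)
  rw [eval₂_C] at this
  refine this.trans ⟨fun h => by simpa using h 0, fun h e => ?_⟩
  rw [coeff_C]
  split_ifs
  · exact h
  · exact Ideal.zero_mem _

theorem eval₂_eq_zero_iff_forall_map {P : MvPolynomial (Fin 3 × Fin m) (MvPolynomial (Fin m) K)} :
    eval₂ (aeval ξ : MvPolynomial (Fin m) K →ₐ[K] M).toRingHom t P = 0 ↔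
      ∀ x ∈ Γ, ∀ c : K, MvPolynomial.map (eval (c • x.rep)) P = 0 := by
  rw [hI]
  refine ⟨fun h x hx c => ?_, fun h e x hx c => ?_⟩
  · ext1 e
    rw [coeff_map, coeff_zero]
    exact h e x hx c
  · rw [← coeff_map, h x hx c, coeff_zero]

theorem aeval_eq_zero_iff_forall_planeSubst {G : MvPolynomial (Fin 3 × Fin m ⊕ Fin 3) K} :
    aeval (Sum.elim t (mulV t ξ)) G = 0 ↔
      ∀ x ∈ Γ, ∀ c : K, planeSubst (c • x.rep) G = 0 := by
  rw [← eval₂_genericSubst, eval₂_eq_zero_iff_forall_map hI]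
  simp only [map_eval_genericSubst]

theorem aeval_pderiv_add_mul_aeval_pderiv {G : MvPolynomial (Fin 3 × Fin m ⊕ Fin 3) K}
    (hG : aeval (Sum.elim t (mulV t ξ)) G = 0) (i : Fin 3) (j : Fin m) :
    aeval (Sum.elim t (mulV t ξ)) (pderiv (Sum.inl (i, j)) G) +
      ξ j * aeval (Sum.elim t (mulV t ξ)) (pderiv (Sum.inr i) G) = 0 := by
  have h1 : eval₂ (aeval ξ : MvPolynomial (Fin m) K →ₐ[K] M).toRingHom t
      (genericSubst (pderiv (Sum.inl (i, j)) G) + C (X j) * genericSubst (pderiv (Sum.inr i) G)) =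
      0 := by
    rw [eval₂_eq_zero_iff_forall_map hI]
    intro x hx c
    rw [map_add, map_mul, map_eval_genericSubst, map_eval_genericSubst, map_C, eval_X,
      ← planeSubst_pderiv, (aeval_eq_zero_iff_forall_planeSubst hI).1 hG x hx c, map_zero]
  rw [eval₂_add, eval₂_mul, eval₂_C, eval₂_genericSubst, eval₂_genericSubst] at h1
  rw [← h1]
  simp

/-- The coordinates of `ξ` are rational functions of `t` and of the generic projection of `ξ`. -/
theorem exists_aeval_pderiv_ne_zero [CharZero K]
    (hex : ∃ G : MvPolynomial (Fin 3 × Fin m ⊕ Fin 3) K, G ≠ 0 ∧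
      aeval (Sum.elim t (mulV t ξ)) G = 0) :
    ∃ (G : MvPolynomial (Fin 3 × Fin m ⊕ Fin 3) K) (i : Fin 3),
      aeval (Sum.elim t (mulV t ξ)) G = 0 ∧
      aeval (Sum.elim t (mulV t ξ)) (pderiv (Sum.inr i) G) ≠ 0 := by
  have hex' : ∃ n, ∃ G : MvPolynomial (Fin 3 × Fin m ⊕ Fin 3) K, G ≠ 0 ∧
      aeval (Sum.elim t (mulV t ξ)) G = 0 ∧ G.totalDegree = n := by
    obtain ⟨G, hG⟩ := hex
    exact ⟨_, G, hG.1, hG.2, rfl⟩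
  classical
  -- A relation of least total degree. If its y-derivatives were all relations, so would be its
  -- t-derivatives; by minimality all would be zero, and G constant in characteristic zero.
  obtain ⟨G, hG0, hG, hGn⟩ := Nat.find_spec hex'
  have hmin := fun n hn => Nat.find_min hex' (m := n) hn
  rw [← hGn] at hmin
  by_contra! hcon
  have h1 := fun i => hcon G i hG
  have h2 : ∀ v, aeval (Sum.elim t (mulV t ξ)) (pderiv v G) = 0 := by
    rintro (⟨i, j⟩ | i)
    · have := aeval_pderiv_add_mul_aeval_pderiv hI hG i j
      rwa [h1, mul_zero, add_zero] at this
    · exact h1 i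
  have h3 : ∀ v, pderiv v G = 0 := by
    intro v
    by_contra h0
    refine hmin _ ?_ ⟨_, h0, h2 v, rfl⟩
    have hle : ∀ e ∈ (pderiv v G).support, Finsupp.degree e + 1 ≤ G.totalDegree := by
      intro e he
      rw [mem_support_iff, coeff_pderiv] at he
      have := le_totalDegree (mem_support_iff.2 (left_ne_zero_of_mul he))
      change Finsupp.degree _ ≤ _ at this
      rwa [map_add, Finsupp.degree_single] at this
    obtain ⟨e, he⟩ := Finset.nonempty_iff_ne_empty.2 (fun h => h0 (support_eq_empty.1 h))
    have hpos := hle e he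
    refine lt_of_le_of_lt (Finset.sup_le (a := G.totalDegree - 1) fun e he => ?_) (by omega)
    have := hle e he
    change Finsupp.degree _ ≤ _
    omega
  have h4 : G = C (coeff 0 G) := by
    ext1 e
    rw [coeff_C]
    split_ifs with he
    · rw [he]
    · obtain ⟨v, hv⟩ : ∃ v, e v ≠ 0 := by
        by_contra! h0
        exact he (Finsupp.ext h0).symm
      have := congrArg (coeff (e - Finsupp.single v 1)) (h3 v)
      rw [coeff_pderiv, tsub_add_cancel_of_le
        (Finsupp.single_le_iff.2 (Nat.one_le_iff_ne_zero.2 hv)), coeff_zero] at this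
      exact (mul_eq_zero.1 this).resolve_right (Nat.cast_add_one_ne_zero _)
  have h5 : coeff 0 G ≠ 0 := fun h => hG0 (by rw [h4, h, C_0])
  rw [h4, aeval_C, map_eq_zero] at hG
  exact h5 hG

theorem exists_mul_aeval_eq [CharZero K]
    (hfrac : ∀ a : M, ∃ P Q, eval₂ (aeval ξ : MvPolynomial (Fin m) K →ₐ[K] M).toRingHom t Q ≠ 0 ∧
        a * eval₂ (aeval ξ : MvPolynomial (Fin m) K →ₐ[K] M).toRingHom t Q =
          eval₂ (aeval ξ : MvPolynomial (Fin m) K →ₐ[K] M).toRingHom t P)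
    (hex : ∃ G : MvPolynomial (Fin 3 × Fin m ⊕ Fin 3) K, G ≠ 0 ∧
      aeval (Sum.elim t (mulV t ξ)) G = 0) (a : M) :
    ∃ u v : MvPolynomial (Fin 3 × Fin m ⊕ Fin 3) K, aeval (Sum.elim t (mulV t ξ)) v ≠ 0 ∧
      a * aeval (Sum.elim t (mulV t ξ)) v = aeval (Sum.elim t (mulV t ξ)) u := by
  obtain ⟨G, i, hG, hGi⟩ := exists_aeval_pderiv_ne_zero hI hex
  set φ : MvPolynomial (Fin 3 × Fin m ⊕ Fin 3) K →ₐ[K] M := aeval (Sum.elim t (mulV t ξ))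
  -- The fractions of elements of the image of φ. It contains t, and also ξ through ξ_j = -G_{t_ij}
  -- / G_{y_i}.
  let S : Subalgebra K M :=
    { carrier := {a | ∃ u v, φ v ≠ 0 ∧ a * φ v = φ u}
      mul_mem' := by
        rintro a b ⟨u, v, hv, h⟩ ⟨u', v', hv', h'⟩
        refine ⟨u * u', v * v', ?_, ?_⟩
        · rw [map_mul]; exact mul_ne_zero hv hv'
        · rw [map_mul, map_mul, ← h, ← h']; ring
      add_mem' := by
        rintro a b ⟨u, v, hv, h⟩ ⟨u', v', hv', h'⟩
        refine ⟨u * v' + u' * v, v * v', ?_, ?_⟩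
        · rw [map_mul]; exact mul_ne_zero hv hv'
        · rw [map_add, map_mul, map_mul, map_mul, ← h, ← h']; ring
      algebraMap_mem' := fun c => ⟨algebraMap K _ c, 1, by simp, by simp⟩ }
  have hξS : ∀ j, ξ j ∈ S := fun j =>
    ⟨-pderiv (Sum.inl (i, j)) G, pderiv (Sum.inr i) G, hGi, by
      rw [map_neg]
      linear_combination aeval_pderiv_add_mul_aeval_pderiv hI hG i j⟩
  have htS : ∀ p, t p ∈ S := fun p => ⟨X (Sum.inl p), 1, by simp, by simp [φ]⟩
  have hP : ∀ P, eval₂ (aeval ξ : MvPolynomial (Fin m) K →ₐ[K] M).toRingHom t P ∈ S := by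
    intro P
    induction P using MvPolynomial.induction_on with
    | C G =>
      rw [eval₂_C]
      change aeval ξ G ∈ S
      induction G using MvPolynomial.induction_on with
      | C a => rw [aeval_C]; exact S.algebraMap_mem a
      | add p q hp hq => rw [map_add]; exact S.add_mem hp hq
      | mul_X p i hp => rw [map_mul, aeval_X]; exact S.mul_mem hp (hξS i)
    | add p q hp hq => rw [eval₂_add]; exact S.add_mem hp hq
    | mul_X p i hp => rw [eval₂_mul, eval₂_X]; exact S.mul_mem hp (htS i)
  obtain ⟨P, Q, hQ, hPQ⟩ := hfrac a
  obtain ⟨u, v, hv, h⟩ := hP P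
  obtain ⟨u', v', hv', h'⟩ := hP Q
  refine ⟨u * v', u' * v, ?_, ?_⟩
  · rw [map_mul, ← h']
    exact mul_ne_zero (mul_ne_zero hQ hv') hv
  · rw [map_mul, map_mul, ← h, ← h', ← hPQ]
    ring

end Component

end

/-! ### Every curve has a plane equation -/

section

variable {K : Type u} [Field K] {m : ℕ}

theorem planeSubst_smul_eq_eval_weightScaling (x : Fin m → K) (c : K)
    (G : MvPolynomial (Fin 3 × Fin m ⊕ Fin 3) K) : planeSubst (c • x) G =
      ((weightScaling (planeWeight m) G).map (planeSubst x).toRingHom).eval (C c) := by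
  induction G using MvPolynomial.induction_on with
  | C a =>
    rw [← algebraMap_eq, AlgHom.commutes, AlgHom.commutes,
      Polynomial.algebraMap_apply, Polynomial.map_C, Polynomial.eval_C]
    exact (AlgHom.commutes (planeSubst x) a).symm
  | add p q hp hq => rw [map_add, map_add, hp, hq, Polynomial.map_add, Polynomial.eval_add]
  | mul_X p i hp =>
    rw [map_mul, map_mul, hp, Polynomial.map_mul, Polynomial.eval_mul]
    congr 1
    rcases i with i | i
    · simp [weightScaling, planeSubst, planeWeight]
    · simp only [planeSubst, aeval_X, Sum.elim_inr, weightScaling, planeWeight, Polynomial.map_mul,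
        Polynomial.map_C, Polynomial.map_X, Polynomial.eval_mul,
        Polynomial.eval_C, Polynomial.eval_X, Pi.one_apply, pow_one,
        AlgHom.toRingHom_eq_coe, RingHom.coe_coe, Finset.sum_mul]
      exact Finset.sum_congr rfl fun j _ => by
        rw [Pi.smul_apply, smul_eq_mul, C_mul]
        ring

theorem planeSubst_weightedHomogeneousComponent_eq_zero [Infinite K] {x : Fin m → K}
    {G : MvPolynomial (Fin 3 × Fin m ⊕ Fin 3) K} (h : ∀ c : K, planeSubst (c • x) G = 0) (n : ℕ) :
    planeSubst x (weightedHomogeneousComponent (planeWeight m) n G) = 0 := by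
  have h0 : (weightScaling (planeWeight m) G).map (planeSubst x).toRingHom = 0 := by
    refine Polynomial.eq_zero_of_infinite_isRoot _ (Set.infinite_of_injective_forall_mem
      (C_injective _ K) fun c => ?_)
    change Polynomial.eval _ _ = 0
    rw [← planeSubst_smul_eq_eval_weightScaling, h c]
  have := congrArg (Polynomial.coeff · n) h0
  simpa [coeff_weightScaling] using this

theorem IsIrreducible.subsingleton_of_finite {X : Type*} [TopologicalSpace X] [T1Space X]
    {Γ : Set X} (h : IsIrreducible Γ) (hfin : Γ.Finite) : Γ.Subsingleton := by
  obtain ⟨z, hz, hzΓ⟩ := isIrreducible_iff_sUnion_isClosed.1 h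
    ((hfin.toFinset.image fun x => ({x} : Set X))) (by
      intro z hz
      obtain ⟨x, -, rfl⟩ := Finset.mem_image.1 hz
      exact isClosed_singleton) (by
      intro x hx
      exact Set.mem_sUnion.2 ⟨{x}, Finset.mem_coe.2
        (Finset.mem_image_of_mem _ (hfin.mem_toFinset.2 hx)), rfl⟩)
  obtain ⟨x, -, rfl⟩ := Finset.mem_image.1 hz
  exact Set.subsingleton_singleton.anti hzΓ

/-- The cone ideal is prime and provides a generic point ξ. A finite hyperplane section yields a
relation for (t, tξ), hence a prime weighted homogeneous one, h. The dimension hypothesis enters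
only through the infinitude of Γ, which shows that h generates all relations. -/
theorem exists_isCurveEquation_of_isIrreducible [IsAlgClosed K] [CharZero K] {Γ : Set (PSpace K m)}
    (hΓ : IsClosed Γ) (hirr : IsIrreducible Γ) (hdim : topologicalKrullDim Γ = 1)
    {a : PSpace K m} (hfin : (Γ ∩ hyperplane a).Finite) :
    ∃ h d, IsCurveEquation h d ∧ planeLocus h = Γ := by
  classical
  have hprime := isPrime_coneIdeal hirr
  obtain ⟨M, _, _, t, ξ, hI, hfrac⟩ := exists_generic_matrix (coneIdeal Γ)
  have hξ := fun G => aeval_eq_zero_iff_mem_coneIdeal hI (G := G)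
  have hinf : ¬ Γ.Finite := by
    intro hf
    have : Subsingleton Γ := (Set.subsingleton_coe _).2
      (IsIrreducible.subsingleton_of_finite hirr hf)
    have h1 := topologicalKrullDim_le_zero (X := Γ)
    rw [hdim] at h1
    exact absurd h1 (by decide)
  have hex := exists_ne_zero_aeval_eq_zero hΓ hfin (t := t) (ξ := ξ) fun G => (hξ G).2
  have hfrac' := exists_mul_aeval_eq hI hfrac hex
  obtain ⟨G, hG0, hG⟩ := hex
  obtain ⟨n, hn⟩ : ∃ n, weightedHomogeneousComponent (planeWeight m) n G ≠ 0 := by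
    by_contra! h0
    apply hG0
    rw [← sum_weightedHomogeneousComponent (planeWeight m) G]
    exact finsum_eq_zero_of_forall_eq_zero h0
  have hGn : aeval (Sum.elim t (mulV t ξ))
      (weightedHomogeneousComponent (planeWeight m) n G) = 0 := by
    rw [aeval_eq_zero_iff_forall_planeSubst hI] at hG ⊢
    intro x hx c
    refine planeSubst_weightedHomogeneousComponent_eq_zero (fun s => ?_) n
    rw [smul_smul]
    exact hG x hx _
  obtain ⟨h, hh, hφh⟩ := exists_prime_dvd_map_eq_zero
    (aeval (Sum.elim t (mulV t ξ)) : _ →ₐ[K] M).toRingHom hn hGn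
  change aeval (Sum.elim t (mulV t ξ)) h = 0 at hφh
  have hp := UniqueFactorizationMonoid.prime_of_factor h hh
  obtain ⟨q, hq⟩ := UniqueFactorizationMonoid.dvd_of_mem_factors hh
  have hw := weightedHomogeneousComponent_isWeightedHomogeneous n G (w := planeWeight m)
  rw [hq] at hn hw
  obtain ⟨d, _, -, hd, -⟩ := MvPolynomial.IsWeightedHomogeneous.of_mul _ hn hw
  have hindep : ∀ P : MvPolynomial (Fin 3 × Fin m) (MvPolynomial (Fin m) K),
      eval₂ (aeval ξ : MvPolynomial (Fin m) K →ₐ[K] M).toRingHom t P = 0 →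
        ∀ e, aeval ξ (coeff e P) = 0 := fun P hP e => (hξ _).2 ((hI P).1 hP e)
  have hdvd : ∀ G, aeval (Sum.elim t (mulV t ξ)) G = 0 → h ∣ G := by
    intro G hG
    by_contra hGh
    -- A second relation, not divisible by h, would lower the transcendence degree below 3m + 2. Any
    -- two coordinates of ξ would then be dependent, and Γ finite.
    refine hinf (finite_of_forall_dependent fun b c => ?_)
    obtain ⟨P, hP, hP0⟩ := exists_dependence (n := 2) (fun y hy => by
      have := card_add_two_le_of_map_eq_zero _ hy hp hφh hGh hG
      simp at this) hfrac' hindep ![X b, X c]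
    refine ⟨P, hP, fun x hx s => ?_⟩
    have h1 : aeval ξ (aeval (![X b, X c] : Fin 2 → MvPolynomial (Fin m) K) P) = 0 := by
      rw [← hP0, ← AlgHom.comp_apply, comp_aeval]
    have h2 := (hξ _).1 h1 x hx s
    rw [eval_aeval] at h2
    rw [← h2]
    congr 2
    funext i
    fin_cases i <;> simp
  have H : IsGenericPlaneEquation t ξ h d :=
    ⟨hp.ne_zero, hd, fun G => ⟨hdvd G, fun ⟨q, hq⟩ => by rw [hq, map_mul, hφh, zero_mul]⟩,
      fun G hG e => (hξ _).2 (homogeneousComponent_mem_coneIdeal ((hξ G).1 hG) e),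
      exists_dependence (n := 3) (fun y hy => by
        have := card_lt_of_map_eq_zero _ hy hp.ne_zero hφh
        simp at this) hfrac' hindep, hindep⟩
  refine ⟨h, d, ⟨M, _, _, t, ξ, H⟩, ?_⟩
  rw [H.planeLocus_eq]
  refine Set.Subset.antisymm (fun x hx => ?_) (fun x hx => ?_)
  · exact mem_of_forall_mem_coneIdeal hΓ fun d G hG hGI => hx G ⟨⟨d, hG⟩, (hξ G).2 hGI⟩
  · rintro G ⟨-, hG⟩
    have := (hξ G).1 hG x hx 1
    rwa [one_smul] at this

theorem planeLocus_mul [Infinite K] (f g : MvPolynomial (Fin 3 × Fin m ⊕ Fin 3) K) :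
    planeLocus (f * g) = planeLocus f ∪ planeLocus g := by
  ext x
  simp only [Set.mem_union, mem_planeLocus_iff, map_mul, mul_eq_zero]

theorem planeLocus_eq_empty_of_weight_zero [Infinite K] {f : MvPolynomial (Fin 3 × Fin m ⊕ Fin 3) K}
    (hf : f ≠ 0) (hw : IsWeightedHomogeneous (planeWeight m) f 0) : planeLocus f = ∅ := by
  rw [Set.eq_empty_iff_forall_notMem]
  intro x hx
  obtain ⟨A, y, hA⟩ := exists_forall_eval_ne_zero' {0} (fun _ : Fin 1 => f) (fun _ _ => hf)
  apply hA 0 (Finset.mem_singleton_self _)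
  have h1 := eval_smul_of_planeWeight hw A y 0
  have h2 := eval_smul_of_planeWeight hw A (mulV A x.rep) 0
  simp only [pow_zero, one_mul, zero_mul] at h1 h2
  rw [← h1, h2]
  exact hx A

/-- A squarefree plane equation of degree `k` that defines a curve. -/
structure IsReducedEquation (g : MvPolynomial (Fin 3 × Fin m ⊕ Fin 3) K) (k : ℕ) : Prop where
  ne_zero : g ≠ 0
  weight : IsWeightedHomogeneous (planeWeight m) g k
  squarefree : Squarefree g
  isCurveEquation : ∀ p, Prime p → p ∣ g → ∃ d, IsCurveEquation p d

theorem isReducedEquation_one : IsReducedEquation (1 : MvPolynomial (Fin 3 × Fin m ⊕ Fin 3) K) 0 :=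
  ⟨one_ne_zero, isWeightedHomogeneous_one _ _, squarefree_one,
    fun _ hp h => absurd (isUnit_of_dvd_one h) hp.not_isUnit⟩

theorem IsReducedEquation.exists_insert [IsAlgClosed K]
    {g : MvPolynomial (Fin 3 × Fin m ⊕ Fin 3) K} {k : ℕ} (hg : IsReducedEquation g k)
    {p : MvPolynomial (Fin 3 × Fin m ⊕ Fin 3) K} {d : ℕ} (hp : IsCurveEquation p d) :
    ∃ g' k', IsReducedEquation g' k' ∧ k' ≤ d + k ∧
      planeLocus g' = planeLocus p ∪ planeLocus g := by
  obtain ⟨M, _, _, t, ξ, H⟩ := id hp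
  by_cases hpg : p ∣ g
  · exact ⟨g, k, hg, Nat.le_add_left _ _,
      (Set.union_eq_right.2 (planeLocus_subset_of_dvd hpg)).symm⟩
  · refine ⟨p * g, d + k, ⟨mul_ne_zero H.ne_zero hg.ne_zero, H.weight.mul hg.weight, ?_, ?_⟩,
      le_rfl,
      planeLocus_mul p g⟩
    · rw [squarefree_mul_iff]
      exact ⟨(H.prime.irreducible.isRelPrime_iff_not_dvd).2 hpg, H.prime.irreducible.squarefree,
        hg.squarefree⟩
    · intro q hq hqpg
      rcases hq.dvd_or_dvd hqpg with h | h
      · exact hp.of_associated (hq.associated_of_dvd H.prime h).symm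
      · exact hg.isCurveEquation q hq h

theorem exists_isHomogeneous_of_isOpen {U : Set (PSpace K m)} (hU : IsOpen U) (h : U.Nonempty) :
    ∃ d, ∃ G : MvPolynomial (Fin m) K,
      G ≠ 0 ∧ G.IsHomogeneous d ∧ ∀ x, eval x.rep G ≠ 0 → x ∈ U := by
  obtain ⟨x, hx⟩ := h
  obtain ⟨T, hT, hTU⟩ := (isClosed_iff_isAlgebraic Uᶜ).1 hU.isClosed_compl
  have hx' : x ∉ ProjCurve.zeroLocus T := by rw [← hTU]; exact fun h => h hx
  simp only [ProjCurve.zeroLocus, Set.mem_ofPred_eq, not_forall] at hx'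
  obtain ⟨G, hG, hGx⟩ := hx'
  obtain ⟨d, hd⟩ := hT G hG
  refine ⟨d, G, fun h0 => hGx (by rw [h0, map_zero]), hd, fun y hy => ?_⟩
  by_contra hyU
  have : y ∈ ProjCurve.zeroLocus T := by rw [← hTU]; exact hyU
  exact hy (this G hG)

theorem nonempty_inter_of_isOpen [Infinite K] {U U' : Set (PSpace K m)} (hU : IsOpen U)
    (hU' : IsOpen U')
    (h : U.Nonempty) (h' : U'.Nonempty) : (U ∩ U').Nonempty := by
  obtain ⟨d, G, hG, hGd, hGU⟩ := exists_isHomogeneous_of_isOpen hU h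
  obtain ⟨d', G', hG', hGd', hGU'⟩ := exists_isHomogeneous_of_isOpen hU' h'
  obtain ⟨x, -⟩ := h
  obtain ⟨j, -⟩ : ∃ j, x.rep j ≠ 0 := by
    by_contra! hc
    exact x.rep_nonzero (funext hc)
  obtain ⟨v, hv⟩ := exists_forall_eval_ne_zero Finset.univ
    (![G, G', X j] : Fin 3 → MvPolynomial (Fin m) K) (by
      intro i _
      fin_cases i
      · exact hG
      · exact hG'
      · exact X_ne_zero _)
  have hv0 : v ≠ 0 := by
    rintro rfl
    simpa using hv 2 (Finset.mem_univ _)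
  refine ⟨Projectivization.mk K v hv0, hGU _ ?_, hGU' _ ?_⟩
  · rw [ne_eq, eval_rep_mk hGd]; exact hv 0 (Finset.mem_univ _)
  · rw [ne_eq, eval_rep_mk hGd']; exact hv 1 (Finset.mem_univ _)

theorem IsCurveOfDegree.eq [Infinite K] {D : Set (PSpace K m)} {k k' : ℕ} (h : IsCurveOfDegree D k)
    (h' : IsCurveOfDegree D k') : k = k' := by
  obtain ⟨-, U, hU, hU0, hUk⟩ := h
  obtain ⟨-, U', hU', hU0', hUk'⟩ := h'
  obtain ⟨a, ha, ha'⟩ := nonempty_inter_of_isOpen hU hU' hU0 hU0'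
  exact Nat.cast_injective ((hUk a ha).symm.trans (hUk' a ha'))

variable [IsAlgClosed K] [CharZero K] {g : MvPolynomial (Fin 3 × Fin m ⊕ Fin 3) K} {k : ℕ}

theorem IsReducedEquation.isCurveOfDegree (hg : IsReducedEquation g k) (hm : 0 < m) :
    IsCurveOfDegree (planeLocus g) k :=
  isCurveOfDegree_planeLocus hm hg.ne_zero hg.weight hg.squarefree fun p hp =>
    hg.isCurveEquation p (UniqueFactorizationMonoid.prime_of_factor p hp)
      (UniqueFactorizationMonoid.dvd_of_mem_factors hp)

theorem exists_isReducedEquation {ι : Type*} (s : Finset ι)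
    (h : ι → MvPolynomial (Fin 3 × Fin m ⊕ Fin 3) K) (hs : ∀ i ∈ s, ∃ d, IsCurveEquation (h i) d) :
    ∃ g k, IsReducedEquation g k ∧ planeLocus g = ⋃ i ∈ s, planeLocus (h i) := by
  classical
  induction s using Finset.induction_on with
  | empty =>
    refine ⟨1, 0, isReducedEquation_one, ?_⟩
    rw [planeLocus_eq_empty_of_weight_zero one_ne_zero (isWeightedHomogeneous_one _ _)]
    simp
  | insert i s hi ih =>
    obtain ⟨g, k, hg, hgs⟩ := ih fun j hj => hs j (Finset.mem_insert_of_mem hj)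
    obtain ⟨d, hd⟩ := hs i (Finset.mem_insert_self _ _)
    obtain ⟨g', k', hg', -, h'⟩ := hg.exists_insert hd
    exact ⟨g', k', hg', by rw [h', hgs, Finset.set_biUnion_insert]⟩

/-- Every space curve is defined by the equation of its generic plane projection. -/
theorem exists_planeLocus_eq_of_isCurveOfDegree {D : Set (PSpace K m)} {k : ℕ}
    (hD : IsCurveOfDegree D k) : ∃ f : MvPolynomial (Fin 3 × Fin m ⊕ Fin 3) K, f ≠ 0 ∧
      IsWeightedHomogeneous (planeWeight m) f k ∧ planeLocus f = D := by
  classical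
  obtain ⟨⟨hclosed, hcomp⟩, U, hU, ⟨a, ha⟩, hUk⟩ := id hD
  have hm : 0 < m := by
    rcases Nat.eq_zero_or_pos m with rfl | hm
    · exact absurd (Subsingleton.elim _ _) a.rep_nonzero
    · exact hm
  have hfin : (D ∩ hyperplane a).Finite := Set.finite_of_encard_eq_coe (hUk a ha)
  have key : ∀ Z ∈ irreducibleComponents D, ∃ h d, IsCurveEquation h d ∧
      planeLocus h = (Subtype.val '' Z : Set (PSpace K m)) := by
    intro Z hZ
    refine exists_isCurveEquation_of_isIrreducible
      (hclosed.isClosedMap_subtype_val _ (isClosed_of_mem_irreducibleComponents Z hZ))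
      (IsIrreducible.image hZ.1 _ continuous_subtype_val.continuousOn)
      ((topologicalKrullDim_image_val Z).trans (hcomp Z hZ)) (a := a)
      (hfin.subset (Set.inter_subset_inter_left _ (by rintro _ ⟨x, -, rfl⟩; exact x.2)))
  choose! h d hd hh using key
  have hf : (irreducibleComponents D).Finite :=
    TopologicalSpace.NoetherianSpace.finite_irreducibleComponents
  obtain ⟨g, k', hg, hgD⟩ := exists_isReducedEquation hf.toFinset h fun Z hZ =>
    ⟨d Z, hd Z (hf.mem_toFinset.1 hZ)⟩
  have hgD' : planeLocus g = D := by
    rw [hgD]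
    ext x
    simp only [Set.mem_iUnion, Set.Finite.mem_toFinset, exists_prop]
    constructor
    · rintro ⟨Z, hZ, hx⟩
      rw [hh Z hZ] at hx
      obtain ⟨y, -, rfl⟩ := hx
      exact y.2
    · intro hx
      refine ⟨irreducibleComponent (⟨x, hx⟩ : D),
        irreducibleComponent_mem_irreducibleComponents _, ?_⟩
      rw [hh _ (irreducibleComponent_mem_irreducibleComponents _)]
      exact ⟨⟨x, hx⟩, mem_irreducibleComponent, rfl⟩
  -- The reduced equation g has some degree k', which is also the degree of the curve D it defines;
  -- general hyperplanes for both counts exist, so the degrees agree.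
  have hk : k = k' := IsCurveOfDegree.eq hD (hgD' ▸ hg.isCurveOfDegree hm)
  exact ⟨g, hg.ne_zero, hk ▸ hg.weight, hgD'⟩

end

/-! ### Splitting off the curve, and an equation for the points of S -/

section

variable {K : Type u} [Field K] {m : ℕ}

/-- Each prime factor is put into g if it defines a curve, and otherwise adds its degree to e and at
most d³ points. A repeated curve factor only loses degree, whence the inequality k' + e ≤ k. -/
theorem exists_isReducedEquation_encard_diff_le [IsAlgClosed K] [CharZero K]
    (f : MvPolynomial (Fin 3 × Fin m ⊕ Fin 3) K) : f ≠ 0 → ∀ k,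
    IsWeightedHomogeneous (planeWeight m) f k → ∃ g k' e, IsReducedEquation g k' ∧ k' + e ≤ k ∧
      (planeLocus f \ planeLocus g).encard ≤ ((e ^ 3 : ℕ) : ℕ∞) := by
  induction f using UniqueFactorizationMonoid.induction_on_prime with
  | h₁ => exact fun h => absurd rfl h
  | h₂ f hf =>
    intro h0 k hk
    obtain ⟨q, hq⟩ := hf.exists_right_inv
    obtain ⟨a, b, hab, ha, -⟩ := MvPolynomial.IsWeightedHomogeneous.of_mul (planeWeight m)
      (hq ▸ one_ne_zero) (hq ▸ isWeightedHomogeneous_one K (planeWeight m))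
    obtain rfl : a = 0 := by omega
    refine ⟨1, 0, 0, isReducedEquation_one, Nat.zero_le _, ?_⟩
    rw [planeLocus_eq_empty_of_weight_zero h0 ha]
    simp
  | h₃ f p hf hp ih =>
    intro h0 k hk
    obtain ⟨d, l, hdl, hd, hl⟩ := MvPolynomial.IsWeightedHomogeneous.of_mul (planeWeight m) h0 hk
    obtain ⟨g, k', e, hg, hke, hle⟩ := ih hf l hl
    rw [planeLocus_mul]
    by_cases hd0 : d = 0
    · subst hd0
      refine ⟨g, k', e, hg, by omega, ?_⟩
      rwa [planeLocus_eq_empty_of_weight_zero hp.ne_zero hd, Set.empty_union]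
    rcases isCurveEquation_or_encard_planeLocus_le hp hd hd0 with h | h
    · obtain ⟨g', k'', hg', hk'', hgg'⟩ := hg.exists_insert h
      refine ⟨g', k'', e, hg', by omega, le_trans (Set.encard_le_encard ?_) hle⟩
      rw [hgg']
      rintro x ⟨hx | hx, hx'⟩
      · exact absurd (Or.inl hx) hx'
      · exact ⟨hx, fun h => hx' (Or.inr h)⟩
    · refine ⟨g, k', d + e, hg, by omega, ?_⟩
      calc _ ≤ (planeLocus p \ planeLocus g).encard + (planeLocus f \ planeLocus g).encard :=
            Set.union_sdiff_distrib ▸ Set.encard_union_le _ _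
        _ ≤ ((d ^ 3 : ℕ) : ℕ∞) + ((e ^ 3 : ℕ) : ℕ∞) :=
            add_le_add ((Set.encard_le_encard Set.sdiff_subset).trans h) hle
        _ ≤ (((d + e) ^ 3 : ℕ) : ℕ∞) := by
            rw [← Nat.cast_add]
            refine Nat.cast_le.2 ?_
            ring_nf
            nlinarith [Nat.zero_le (d * e ^ 2), Nat.zero_le (d ^ 2 * e)]

theorem isWeightedHomogeneous_rename_inl (v : MvPolynomial (Fin 3 × Fin m) K) :
    IsWeightedHomogeneous (planeWeight m) (rename Sum.inl v) 0 := by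
  induction v using MvPolynomial.induction_on with
  | C a => rw [rename_C]; exact isWeightedHomogeneous_C _ _
  | add p q hp hq => rw [map_add]; exact hp.add hq
  | mul_X p i hp =>
    rw [map_mul, rename_X]
    exact hp.mul (isWeightedHomogeneous_X K (planeWeight m) (Sum.inl i))

theorem isWeightedHomogeneous_rename_inr {k : ℕ} {g : MvPolynomial (Fin 3) K}
    (hg : g.IsHomogeneous k) :
    IsWeightedHomogeneous (planeWeight m) (rename Sum.inr g) k := by
  induction hg using IsWeightedHomogeneous.induction_on with
  | zero => rw [map_zero]; exact isWeightedHomogeneous_zero _ _ _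
  | add p q _ _ hp hq => rw [map_add]; exact hp.add hq
  | monomial e r hr =>
    rw [rename_monomial]
    refine isWeightedHomogeneous_monomial _ _ _ ?_
    rw [← hr, Finsupp.weight_apply, Finsupp.weight_apply, Finsupp.sum_mapDomain_index]
    · rfl
    · simp
    · exact fun _ _ _ => add_smul _ _ _

theorem genericForm_rename_inr_monomial (e : Fin 3 →₀ ℕ) :
    genericForm (m := m) (rename Sum.inr (monomial e (1 : K))) = monomial e 1 := by
  rw [genericForm, aeval_rename, aeval_monomial, map_one, monomial_eq, C_1]
  rfl

theorem eval_planeSubst_rename_inr (A : Fin 3 × Fin m → K) (x : Fin m → K)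
    (g : MvPolynomial (Fin 3) K) :
    eval A (planeSubst x (rename Sum.inr g)) = eval (mulV A x) g := by
  rw [eval_planeSubst, eval_rename]
  rfl

theorem eval_eq_sum_finsuppAntidiag {k : ℕ} {g : MvPolynomial (Fin 3) K} (hg : g.IsHomogeneous k)
    (y : Fin 3 → K) : eval y g =
      ∑ e : (Finset.univ : Finset (Fin 3)).finsuppAntidiag k,
        coeff e.1 g * eval y (monomial e.1 1) := by
  rw [Finset.sum_coe_sort ((Finset.univ : Finset (Fin 3)).finsuppAntidiag k)
    (fun e => coeff e g * eval y (monomial e 1))]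
  conv_lhs => rw [g.as_sum, map_sum]
  have h1 : ∀ e, eval y (monomial e (coeff e g)) = coeff e g * eval y (monomial e 1) := fun e => by
    rw [eval_monomial, eval_monomial, one_mul]
  simp only [h1]
  refine Finset.sum_subset (fun e he => ?_) fun e _ he => ?_
  · rw [Finset.mem_finsuppAntidiag]
    have := hg (mem_support_iff.1 he)
    change Finsupp.weight (fun _ => 1) e = k at this
    rw [← Finsupp.degree_eq_weight_one] at this
    refine ⟨?_, Finset.subset_univ _⟩
    rw [← this]
    exact (Finsupp.degree_eq_sum e).symm
  · rw [notMem_support_iff.1 he, zero_mul]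

/-- A matrix over `K[t]` with linearly independent columns specializes to a matrix with linearly
independent columns. -/
theorem exists_eval_ne_zero_of_forall_sum_eq_zero {σ ι κ : Type*} [Fintype ι] [Fintype κ]
    [DecidableEq ι] (E : κ → ι → MvPolynomial σ K)
    (hE : ∀ v : ι → MvPolynomial σ K, (∀ x, ∑ e, v e * E x e = 0) → v = 0) :
    ∃ c : MvPolynomial σ K, c ≠ 0 ∧ ∀ A, eval A c ≠ 0 → ∀ v : ι → K,
      (∀ x, ∑ e, v e * eval A (E x e) = 0) → v = 0 := by
  let F := FractionRing (MvPolynomial σ K)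
  have hinj := IsFractionRing.injective (MvPolynomial σ K) F
  let f : (ι → F) →ₗ[F] (κ → F) :=
    { toFun := fun v x => ∑ e, v e * algebraMap (MvPolynomial σ K) F (E x e)
      map_add' := fun v w => by funext x; simp [add_mul, Finset.sum_add_distrib]
      map_smul' := fun a v => by
        funext x
        simp only [Pi.smul_apply, smul_eq_mul, RingHom.id_apply, mul_assoc]
        exact (Finset.mul_sum _ _ _).symm }
  have hf : LinearMap.ker f = ⊥ := by
    rw [LinearMap.ker_eq_bot']
    intro v hv
    obtain ⟨b, hb⟩ := IsLocalization.exist_integer_multiples_of_finite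
      (nonZeroDivisors (MvPolynomial σ K)) v
    choose w hw using hb
    have h1 : w = 0 := hE w fun x => by
      apply hinj
      have h2 := congrFun hv x
      change ∑ e, v e * algebraMap (MvPolynomial σ K) F (E x e) = 0 at h2
      rw [map_sum, map_zero, ← smul_zero b.1, ← h2, Finset.smul_sum]
      refine Finset.sum_congr rfl fun e _ => ?_
      rw [map_mul, hw, smul_mul_assoc]
    funext e
    have h3 := hw e
    rw [h1, Pi.zero_apply, map_zero] at h3
    exact (smul_eq_zero.1 h3.symm).resolve_left (nonZeroDivisors.ne_zero b.2)
  -- A left inverse over the fraction field; its common denominator b serves as c. Wherever b does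
  -- not vanish, the cleared inverse specializes.
  obtain ⟨g, hg⟩ := f.exists_leftInverse_of_injective hf
  classical
  obtain ⟨b, hb⟩ := IsLocalization.exist_integer_multiples_of_finite
    (nonZeroDivisors (MvPolynomial σ K)) (fun p : κ × ι => g (Pi.single p.1 1) p.2)
  choose L hL using hb
  refine ⟨b.1, nonZeroDivisors.ne_zero b.2, fun A hA v hv => ?_⟩
  have key : ∀ e e', ∑ x, E x e * L (x, e') = if e = e' then b.1 else 0 := by
    intro e e'
    apply hinj
    have h1 := congrFun (LinearMap.congr_fun hg (Pi.single e 1)) e'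
    have h2 : f (Pi.single e 1) = ∑ x, algebraMap (MvPolynomial σ K) F (E x e) • Pi.single x 1 := by
      funext x
      rw [Finset.sum_apply, Finset.sum_eq_single x]
      · change ∑ e', _ = _
        rw [Finset.sum_eq_single e]
        · simp
        · intro e' _ he'
          simp [he']
        · simp
      · intro x' _ hx'
        simp [hx'.symm]
      · simp
    rw [LinearMap.comp_apply, h2, map_sum, Finset.sum_apply, LinearMap.id_apply] at h1
    rw [map_sum]
    simp only [map_smul, Pi.smul_apply, smul_eq_mul] at h1
    have h3 : ∀ x, algebraMap (MvPolynomial σ K) F (E x e * L (x, e')) =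
        b.1 • (algebraMap (MvPolynomial σ K) F (E x e) * g (Pi.single x 1) e') := by
      intro x
      rw [map_mul, hL, mul_smul_comm]
    simp only [h3]
    rw [← Finset.smul_sum, h1, Pi.single_apply]
    split_ifs with h4 h5 h5
    · rw [Algebra.smul_def, mul_one]
    · exact absurd h4.symm h5
    · exact absurd h5.symm h4
    · rw [smul_zero, map_zero]
  funext e'
  have h1 : ∑ x, eval A (L (x, e')) * ∑ e, v e * eval A (E x e) = 0 :=
    Finset.sum_eq_zero fun x _ => by rw [hv x, mul_zero]
  simp only [Finset.mul_sum] at h1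
  rw [Finset.sum_comm] at h1
  have h2 : ∀ e, ∑ x, eval A (L (x, e')) * (v e * eval A (E x e)) =
      v e * if e = e' then eval A b.1 else 0 := by
    intro e
    have := congrArg (eval A) (key e e')
    rw [map_sum] at this
    rw [apply_ite (eval A), map_zero] at this
    rw [← this, Finset.mul_sum]
    refine Finset.sum_congr rfl fun x _ => ?_
    rw [map_mul]
    ring
  simp only [h2, mul_ite, mul_zero, Finset.sum_ite_eq', Finset.mem_univ, if_true] at h1
  exact (mul_eq_zero.1 h1).resolve_right hA

/-- The monomials of degree k evaluated at the points t x form a matrix over K[t]. Were its columns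
independent, they would stay so at every A outside a hypersurface, against the plane forms supplied
by `H`. A dependence between the columns is the required f. -/
theorem exists_planeLocus_superset [Infinite K] (S : Finset (PSpace K m)) (k : ℕ)
    (H : ∀ c : MvPolynomial (Fin 3 × Fin m) K, c ≠ 0 → ∃ A, eval A c ≠ 0 ∧
      ∃ g : MvPolynomial (Fin 3) K, g ≠ 0 ∧ g.IsHomogeneous k ∧
        ∀ x ∈ S, eval (mulV A x.rep) g = 0) :
    ∃ f : MvPolynomial (Fin 3 × Fin m ⊕ Fin 3) K, f ≠ 0 ∧
      IsWeightedHomogeneous (planeWeight m) f k ∧ (S : Set (PSpace K m)) ⊆ planeLocus f := by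
  classical
  let E : S → (Finset.univ : Finset (Fin 3)).finsuppAntidiag k → MvPolynomial (Fin 3 × Fin m) K :=
    fun x e => planeSubst x.1.rep (rename Sum.inr (monomial e.1 1))
  have hdeg : ∀ e : (Finset.univ : Finset (Fin 3)).finsuppAntidiag k,
      (monomial e.1 (1 : K)).IsHomogeneous k := fun e => isHomogeneous_monomial _ (by
    rw [Finsupp.degree_eq_sum]
    exact (Finset.mem_finsuppAntidiag.1 e.2).1)
  by_cases hE : ∀ v : _ → MvPolynomial (Fin 3 × Fin m) K, (∀ x, ∑ e, v e * E x e = 0) → v = 0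
  · exfalso
    obtain ⟨c, hc, hcA⟩ := exists_eval_ne_zero_of_forall_sum_eq_zero E hE
    obtain ⟨A, hA, g, hg0, hg, hgS⟩ := H c hc
    have h1 := hcA A hA (fun e => coeff e.1 g) (fun x => by
      rw [← hgS x.1 x.2, eval_eq_sum_finsuppAntidiag hg]
      simp only [E, eval_planeSubst_rename_inr])
    apply hg0
    ext1 e
    by_contra he
    have hmem : e ∈ (Finset.univ : Finset (Fin 3)).finsuppAntidiag k := by
      rw [Finset.mem_finsuppAntidiag]
      refine ⟨?_, Finset.subset_univ _⟩
      rw [← Finsupp.degree_eq_sum, Finsupp.degree_eq_weight_one]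
      exact hg he
    exact he (congrFun h1 ⟨e, hmem⟩)
  · push Not at hE
    obtain ⟨v, hv, hv0⟩ := hE
    obtain ⟨e₀, he₀⟩ : ∃ e, v e ≠ 0 := by
      by_contra! h
      exact hv0 (funext h)
    refine ⟨∑ e, rename Sum.inl (v e) * rename Sum.inr (monomial e.1 1), fun h0 => he₀ ?_, ?_, ?_⟩
    · have h1 := congrArg (fun f => coeff e₀.1 (genericForm f)) h0
      simp only [map_sum, map_mul, genericForm_rename_inl, genericForm_rename_inr_monomial,
        coeff_sum, coeff_C_mul, coeff_monomial, map_zero, coeff_zero] at h1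
      rw [Finset.sum_eq_single e₀] at h1
      · simpa using h1
      · intro e _ he
        rw [if_neg fun h => he (Subtype.ext h), mul_zero]
      · simp
    · refine IsWeightedHomogeneous.sum _ _ _ fun e _ => ?_
      have := (isWeightedHomogeneous_rename_inl (v e)).mul
        (isWeightedHomogeneous_rename_inr (m := m) (hdeg e))
      rwa [zero_add] at this
    · intro x hx
      rw [mem_planeLocus_iff, map_sum, ← hv ⟨x, hx⟩]
      refine Finset.sum_congr rfl fun e _ => ?_
      rw [map_mul]
      congr 1
      rw [planeSubst, aeval_rename]
      exact (aeval_X_left_apply (v e))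

end

/-! ### From projections from a point to projections to the plane -/

section

variable {K : Type u} [Field K] {m : ℕ}

theorem exists_mulV_eq_zero (hm : 3 < m) (A : Fin 3 × Fin m → K) : ∃ w ≠ 0, mulV A w = 0 := by
  let f : (Fin m → K) →ₗ[K] (Fin 3 → K) := Matrix.mulVecLin (Matrix.of fun i j => A (i, j))
  have hf : LinearMap.ker f ≠ ⊥ := LinearMap.ker_ne_bot_of_finrank_lt (by simpa using hm)
  obtain ⟨w, hw, hw0⟩ := (Submodule.ne_bot_iff _).1 hf
  exact ⟨w, hw0, hw⟩

theorem exists_mem_mulV_eq_zero [Infinite K] (hm : 3 < m) {U : Set (PSpace K m)} (hU : IsOpen U)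
    (hne : U.Nonempty) (S : Finset (PSpace K m)) {c : MvPolynomial (Fin 3 × Fin m) K}
    (hc : c ≠ 0) : ∃ p ∈ U, p ∉ S ∧ ∃ A, eval A c ≠ 0 ∧ mulV A p.rep = 0 := by
  classical
  obtain ⟨A₁, hA₁⟩ : ∃ A, eval A c ≠ 0 := by
    by_contra! h
    exact hc (MvPolynomial.funext fun A => by rw [h, map_zero])
  obtain ⟨w, hw0, hw⟩ := exists_mulV_eq_zero hm A₁
  obtain ⟨j₀, hj₀⟩ := Function.ne_iff.1 hw0
  rw [Pi.zero_apply] at hj₀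
  obtain ⟨d, G, hG0, hG, hGU⟩ := exists_isHomogeneous_of_isOpen hU hne
  -- Correcting column j₀ turns a matrix A into v_{j₀} A minus A v in that column, which kills v. So
  -- pairs (A, v) of independent entries parametrize matrices with a point of their kernel, and
  -- generic conditions can be imposed on both.
  let Q : MvPolynomial (Fin 3 × Fin m ⊕ Fin m) K := aeval (fun q : Fin 3 × Fin m =>
    X (Sum.inr j₀) * X (Sum.inl q) -
      if q.2 = j₀ then ∑ l, X (Sum.inl (q.1, l)) * X (Sum.inr l) else 0) c
  have hQ : ∀ A v, eval (Sum.elim A v) Q =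
      eval (fun q => v j₀ * A q - if q.2 = j₀ then mulV A v q.1 else 0) c := by
    intro A v
    rw [eval_aeval]
    congr 2
    funext q
    simp only [map_sub, map_mul, eval_X, Sum.elim_inl, Sum.elim_inr]
    split_ifs <;> simp [mulV]
  have hQ0 : Q ≠ 0 := by
    intro h
    -- For m > 3 the matrix A₁ kills some w; scaled by the inverse of w_{j₀}, it is reproduced by
    -- the correction.
    have h1 := hQ ((w j₀)⁻¹ • A₁) w
    rw [h, map_zero] at h1
    apply hA₁
    rw [h1]
    congr 2
    funext q
    have h2 : mulV ((w j₀)⁻¹ • A₁) w = 0 := by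
      funext i
      have := congrFun hw i
      simp only [mulV, Pi.smul_apply, smul_eq_mul, mul_assoc, ← Finset.mul_sum,
        Pi.zero_apply] at this ⊢
      rw [this, mul_zero]
    rw [h2, Pi.zero_apply, ite_self, sub_zero, Pi.smul_apply, smul_eq_mul, mul_inv_cancel_left₀ hj₀]
  have hℓ : ∀ x : PSpace K m, ∃ i j, (C (x.rep j) * X i - C (x.rep i) * X j :
      MvPolynomial (Fin m) K) ≠ 0 := by
    intro x
    obtain ⟨j, hj⟩ := Function.ne_iff.1 x.rep_nonzero
    rw [Pi.zero_apply] at hj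
    have : Nontrivial (Fin m) := Fin.nontrivial_iff_two_le.2 (by omega)
    obtain ⟨i, hij⟩ := exists_ne j
    refine ⟨i, j, fun h => hj ?_⟩
    simpa [Pi.single_apply, hij.symm] using congrArg (eval (Pi.single i 1)) h
  choose i j hij using hℓ
  have hinr := rename_injective (R := K) (Sum.inr : Fin m → Fin 3 × Fin m ⊕ Fin m)
    Sum.inr_injective
  let ℓ : PSpace K m → MvPolynomial (Fin 3 × Fin m ⊕ Fin m) K := fun x =>
    rename Sum.inr (C (x.rep (j x)) * X (i x) - C (x.rep (i x)) * X (j x))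
  have hs : ∀ P ∈ insert Q (insert (rename Sum.inr G) (insert (X (Sum.inr j₀)) (S.image ℓ))),
      P ≠ 0 := by
    simp only [Finset.forall_mem_insert, Finset.forall_mem_image]
    exact ⟨hQ0, (map_ne_zero_iff _ hinr).2 hG0, X_ne_zero _,
      fun x _ => (map_ne_zero_iff _ hinr).2 (hij x)⟩
  obtain ⟨a, ha⟩ := exists_forall_eval_ne_zero _ id hs
  simp only [Finset.forall_mem_insert, Finset.forall_mem_image, id, ℓ, eval_rename, eval_X] at ha
  obtain ⟨haQ, haG, haj, haS⟩ := ha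
  set v : Fin m → K := a ∘ Sum.inr
  have hv0 : v ≠ 0 := fun h => haj (congrFun h j₀)
  obtain ⟨r, hr⟩ := Projectivization.exists_smul_eq_mk_rep K v hv0
  refine ⟨Projectivization.mk K v hv0, hGU _ fun h => haG ((eval_rep_mk hG v hv0).1 h),
    fun hS => haS hS ?_, fun q => v j₀ * a (Sum.inl q) -
      if q.2 = j₀ then mulV (a ∘ Sum.inl) v q.1 else 0, ?_, ?_⟩
  · rw [← hr]
    simp only [map_sub, map_mul, eval_C, eval_X, Units.smul_def, Pi.smul_apply, smul_eq_mul]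
    ring
  · rw [← Sum.elim_comp_inl_inr a, hQ] at haQ
    exact haQ
  · rw [← hr, Units.smul_def, mulV_smul]
    funext i
    rw [Pi.zero_apply]
    refine mul_eq_zero_of_right _ ?_
    simp only [mulV, sub_mul, ite_mul, zero_mul, Finset.sum_sub_distrib, Finset.sum_ite_eq',
      Finset.mem_univ, if_true, mul_assoc, ← Finset.mul_sum]
    rw [mul_comm (v j₀)]
    exact sub_self _

/-- The matrix of the composition of the linear map with matrix `b` and the linear map `π`. -/
def compMatrix {n : ℕ} (π : (Fin m → K) →ₗ[K] (Fin n → K)) (b : Fin 3 × Fin n → K) :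
    Fin 3 × Fin m → K := fun q => mulV b (π (Pi.single q.2 1)) q.1

theorem mulV_compMatrix {n : ℕ} (π : (Fin m → K) →ₗ[K] (Fin n → K)) (b : Fin 3 × Fin n → K)
    (x : Fin m → K) : mulV (compMatrix π b) x = mulV b (π x) := by
  funext i
  simp only [compMatrix, mulV, Finset.sum_mul]
  rw [Finset.sum_comm]
  refine Finset.sum_congr rfl fun l _ => ?_
  rw [LinearMap.pi_apply_eq_sum_univ π x, Finset.sum_apply, Finset.mul_sum]
  refine Finset.sum_congr rfl fun j _ => ?_
  have : (fun j' => if j = j' then (1 : K) else 0) = Pi.single j 1 := by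
    funext j'
    simp [Pi.single_apply, eq_comm]
  rw [this, Pi.smul_apply, smul_eq_mul]
  ring

theorem exists_isProjectionFrom_compMatrix {n : ℕ} (p : PSpace K (n + 1))
    {A : Fin 3 × Fin (n + 1) → K} (hA : mulV A p.rep = 0) :
    ∃ π : (Fin (n + 1) → K) →ₗ[K] (Fin n → K), IsProjectionFrom p π ∧
      ∃ b, compMatrix π b = A := by
  have hfin : Module.finrank K ((Fin (n + 1) → K) ⧸ p.submodule) =
      Module.finrank K (Fin n → K) := by
    have := p.submodule.finrank_quotient_add_finrank
    rw [p.finrank_submodule] at this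
    simp only [Module.finrank_fin_fun] at this ⊢
    omega
  let φ := LinearEquiv.ofFinrankEq _ _ hfin
  let f : (Fin (n + 1) → K) →ₗ[K] (Fin 3 → K) := Matrix.mulVecLin (Matrix.of fun i j => A (i, j))
  have hf : p.submodule ≤ LinearMap.ker f := by
    rw [p.submodule_eq, Submodule.span_singleton_le_iff_mem]
    exact hA
  let B := p.submodule.liftQ f hf ∘ₗ φ.symm.toLinearMap
  refine ⟨φ.toLinearMap ∘ₗ p.submodule.mkQ, ?_, fun q => B (Pi.single q.2 1) q.1, ?_⟩
  · rw [IsProjectionFrom, LinearEquiv.ker_comp, Submodule.ker_mkQ]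
  · funext q
    have hB : ∀ x, mulV (fun q : Fin 3 × Fin n => B (Pi.single q.2 1) q.1) x = B x := by
      intro x
      rw [← LinearMap.toMatrix'_mulVec B x]
      funext i
      simp [mulV, Matrix.mulVec, dotProduct, LinearMap.toMatrix'_apply]
    rw [compMatrix, hB]
    change p.submodule.liftQ f hf (φ.symm (φ (p.submodule.mkQ _))) q.1 = _
    rw [LinearEquiv.symm_apply_apply, Submodule.mkQ_apply, Submodule.liftQ_apply]
    simp [f]

/-- The plane form obtained from `f` at the matrix `A`. -/
noncomputable def specialize (A : Fin 3 × Fin m → K) :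
    MvPolynomial (Fin 3 × Fin m ⊕ Fin 3) K →ₐ[K] MvPolynomial (Fin 3) K :=
  aeval (Sum.elim (fun q => C (A q)) X)

theorem eval_specialize (A : Fin 3 × Fin m → K) (y : Fin 3 → K)
    (f : MvPolynomial (Fin 3 × Fin m ⊕ Fin 3) K) :
    eval y (specialize A f) = eval (Sum.elim A y) f := by
  rw [specialize, eval_aeval]
  congr 2
  funext q
  rcases q with q | i <;> simp

theorem isHomogeneous_specialize (A : Fin 3 × Fin m → K)
    {f : MvPolynomial (Fin 3 × Fin m ⊕ Fin 3) K} {d : ℕ}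
    (hf : IsWeightedHomogeneous (planeWeight m) f d) : (specialize A f).IsHomogeneous d := by
  induction hf using IsWeightedHomogeneous.induction_on with
  | zero => rw [map_zero]; exact isHomogeneous_zero _ _ _
  | add p q _ _ hp hq => rw [map_add]; exact hp.add hq
  | monomial e r hr =>
    rw [specialize, aeval_monomial]
    subst hr
    rw [← zero_add (Finsupp.weight _ e), Finsupp.weight_apply, MvPolynomial.algebraMap_apply]
    refine (isHomogeneous_C _ _).mul (IsHomogeneous.prod _ _ _ fun j _ => ?_)
    rcases j with p | i
    · simp only [Sum.elim_inl, planeWeight, Pi.zero_apply, smul_zero]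
      rw [← C_pow]
      exact isHomogeneous_C _ _
    · simp only [Sum.elim_inr, planeWeight, Pi.one_apply]
      simpa using (isHomogeneous_X _ i).pow (e (Sum.inr i))

/-- The curve D has a plane equation f(b, y) of degree k. The given b need not be general for f, so
it is moved to a matrix B where f(B, ·) ≠ 0 and c is still nonzero at the composition with π. -/
theorem exists_ternary_of_rationalImage_subset [IsAlgClosed K] [CharZero K] {n k : ℕ}
    {p : PSpace K (n + 1)} {S : Set (PSpace K (n + 1))} (hp : p ∉ S)
    {π : (Fin (n + 1) → K) →ₗ[K] (Fin n → K)} (hπ : IsProjectionFrom p π)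
    {D : Set (PSpace K n)} (hD : IsCurveOfDegree D k) (hSD : rationalImage π S ⊆ D)
    {c : MvPolynomial (Fin 3 × Fin (n + 1)) K} {b : Fin 3 × Fin n → K}
    (hb : eval (compMatrix π b) c ≠ 0) :
    ∃ A, eval A c ≠ 0 ∧ ∃ g : MvPolynomial (Fin 3) K, g ≠ 0 ∧ g.IsHomogeneous k ∧
      ∀ x ∈ S, eval (mulV A x.rep) g = 0 := by
  classical
  obtain ⟨f, hf0, hf, rfl⟩ := exists_planeLocus_eq_of_isCurveOfDegree hD
  let Q : MvPolynomial (Fin 3 × Fin n) K := aeval (fun q : Fin 3 × Fin (n + 1) =>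
    ∑ l, X (q.1, l) * C (π (Pi.single q.2 1) l)) c
  have hQ : ∀ b, eval b Q = eval (compMatrix π b) c := by
    intro b
    rw [eval_aeval]
    congr 2
    funext q
    simp [compMatrix, mulV]
  have hQ0 : Q ≠ 0 := fun h => hb (by rw [← hQ, h, map_zero])
  obtain ⟨B, y, hBy⟩ := exists_forall_eval_ne_zero' {rename Sum.inl Q, f} id (by
    simp only [Finset.mem_insert, Finset.mem_singleton, forall_eq_or_imp, forall_eq, id]
    exact ⟨(map_ne_zero_iff _ (rename_injective _ Sum.inl_injective)).2 hQ0, hf0⟩)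
  simp only [Finset.mem_insert, Finset.mem_singleton, forall_eq_or_imp, forall_eq, id,
    eval_rename, Sum.elim_comp_inl, hQ] at hBy
  refine ⟨compMatrix π B, hBy.1, specialize B f, fun h => hBy.2 ?_, isHomogeneous_specialize B hf,
    fun x hx => ?_⟩
  · rw [← eval_specialize, h, map_zero]
  · have hx0 : π x.rep ≠ 0 := by
      intro h
      apply hp
      have h1 : x.rep ∈ p.submodule := by rw [← hπ]; exact h
      rw [p.submodule_eq, Submodule.mem_span_singleton] at h1
      obtain ⟨a, ha⟩ := h1
      convert hx
      exact eq_of_forall_mul_eq_mul fun i j => by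
        rw [← ha]
        simp only [Pi.smul_apply, smul_eq_mul]
        ring
    have h1 := hSD ⟨x, hx, hx0, rfl⟩ B
    obtain ⟨r, hr⟩ := Projectivization.exists_smul_eq_mk_rep K (π x.rep) hx0
    rw [← hr, Units.smul_def, mulV_smul, eval_smul_of_planeWeight hf] at h1
    rw [mulV_compMatrix, eval_specialize]
    exact (mul_eq_zero.1 h1).resolve_left (pow_ne_zero _ r.ne_zero)

theorem cube_le_mul_sub {k k' e : ℕ} (h : k' + e ≤ k) : e ^ 3 ≤ (k - k') * (k ^ 2 - k') := by
  rcases Nat.eq_zero_or_pos e with rfl | he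
  · simp
  have h1 : e ≤ k - k' := by omega
  -- For e ≥ 1, k² ≥ (k' + e)² ≥ e² + 2k'e ≥ e² + k'.
  have h2 : e ^ 2 ≤ k ^ 2 - k' := by
    apply Nat.le_sub_of_add_le
    nlinarith [Nat.pow_le_pow_left h 2, Nat.zero_le (k' * k'), Nat.mul_le_mul_left k' he]
  calc e ^ 3 = e * e ^ 2 := by ring
    _ ≤ _ := Nat.mul_le_mul h1 h2

end

theorem mainTheorem10 {K : Type*} [Field K] [IsAlgClosed K] [CharZero K] (n k : ℕ) (hn : 3 ≤ n)
    (S : Set (ProjCurve.PSpace K (n + 1))) (hS : S.Finite)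
    (hproj : ProjCurve.GenericProjectionLiesOnCurve S k) :
    ∃ k' : ℕ, k' ≤ k ∧ ∃ C : Set (ProjCurve.PSpace K (n + 1)),
      ProjCurve.IsCurveOfDegree C k' ∧ (S \ C).ncard ≤ (k - k') * (k ^ 2 - k') := by
  lift S to Finset (ProjCurve.PSpace K (n + 1)) using hS
  obtain ⟨U, hU, hne, hUS⟩ := hproj
  obtain ⟨f, hf0, hf, hSf⟩ := exists_planeLocus_superset S k fun c hc => by
    -- The centre is also taken outside S, since a point at the centre contributes nothing to
    -- `rationalImage`. The dimension hypothesis n ≥ 3 gives the matrix A a kernel to contain it.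
    obtain ⟨p, hpU, hpS, A, hA, hAp⟩ := exists_mem_mulV_eq_zero (by omega) hU hne S hc
    obtain ⟨π, hπ, b, rfl⟩ := exists_isProjectionFrom_compMatrix p hAp
    obtain ⟨D, hD, hSD⟩ := hUS p hpU π hπ
    exact exists_ternary_of_rationalImage_subset (S := S) hpS hπ hD hSD hA
  obtain ⟨g, k', e, hg, hke, hle⟩ := exists_isReducedEquation_encard_diff_le f hf0 k hf
  refine ⟨k', by omega, planeLocus g, hg.isCurveOfDegree n.succ_pos, ?_⟩
  refine le_trans ?_ (cube_le_mul_sub hke)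
  have h1 := (Set.encard_le_encard (Set.sdiff_subset_sdiff_left hSf)).trans hle
  exact ENat.toNat_le_of_le_natCast h1
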